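/- Let $\pi : X \to (\mathbb{C}^2,0)$ be a finite sequence of point blowing-ups over the germ $(\mathbb{C}^2,0)$: $\pi$ is a composite $X = X_N \to X_{N-1} \to \dots \to X_0 = (\mathbb{C}^2,0)$, where each $X_{i+1} \to X_i$ is the blowing-up of a point of $X_i$ lying over the origin. Then there is a ramification $\rho : (\mathbb{C}^2,0) \to (\mathbb{C}^2,0)$, that is, a holomorphic germ which in suitable local holomorphic coordinates of the source and of the target has the form $(u,v) \mapsto (u^n,v)$ with $n \ge 1$, such that the following holds. 1. The elimination of indeterminacies of $\pi^{-1}\circ\rho$ exists as a finite sequence of point blowing-ups: there is a finite sequence of point blowing-ups $\tilde\pi : \tilde X \to (\mathbb{C}^2,0)$ such that $\pi^{-1}\circ\rho\circ\tilde\pi$ extends to a holomorphic map $f : \tilde X \to X$ (so $\pi\circ f = \rho\circ\tilde\pi$) near the fibre $\tilde\pi^{-1}(0)$, and which is minimal: every finite sequence of point blowing-ups $\sigma : Z \to (\mathbb{C}^2,0)$ for which $\pi^{-1}\circ\rho\circ\sigma$ extends to a holomorphic map near $\sigma^{-1}(0)$ factors, near $\sigma^{-1}(0)$, through $\tilde\pi$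 by a holomorphic map. 2. For every finite sequence of point blowing-ups $\tilde\pi$ with the two properties in 1, every center of $\tilde\pi$ after the first one (which is the origin of $\mathbb{C}^2$) is a regular point of the exceptional divisor created by the preceding blowing-ups; that is, near this center the exceptional divisor is a smooth holomorphic curve. In particular no center is a corner (a crossing of two components of the exceptional divisor). -/

import Mathlib

open scoped Manifold ContDiff Topology

noncomputable section

namespace PointBlowup

/-! ### The blowing-up of a complex surface at a point -/

/-- The points of the blowing-up of `M` at `p`: the points of `M` other than `p`, and the points of
the exceptional projective line.  The point `dir t` is the tangent direction at `p` of slope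
`t ∈ ℂ ∪ {∞}`, that is, the direction `y = t * x` (and `x = 0` for `t = ∞`), where `(x, y)` are
the coordinates centred at `p` given by the preferred chart of `M` at `p`. -/
inductive Blowup (M : Type) (p : M) : Type
  | away (x : M) (hx : x ≠ p) : Blowup M p
  | dir (t : OnePoint ℂ) : Blowup M p

namespace Blowup

/-- The slope `y / x` of a vector `(x, y)`, with value `∞` for `x = 0`. -/
def slopeInv (u : ℂ) : OnePoint ℂ := if u = 0 then OnePoint.infty else OnePoint.some u⁻¹

/-- The complex number `1 / t`, for `t` in `(ℂ ∪ {∞}) \ {0}`. -/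
def invSlope (t : OnePoint ℂ) : ℂ := t.elim 0 (fun s => s⁻¹)

/-- The slope as a complex number (`0` for `∞`, which is never used). -/
def finSlope (t : OnePoint ℂ) : ℂ := t.elim 0 (fun s => s)

@[simp] lemma finSlope_some (s : ℂ) : finSlope (OnePoint.some s) = s := rfl
@[simp] lemma invSlope_some (s : ℂ) : invSlope (OnePoint.some s) = s⁻¹ := rfl
@[simp] lemma invSlope_infty : invSlope OnePoint.infty = 0 := rfl

variable {M : Type}

/-- The blowing-down map. -/
def down {p : M} : Blowup M p → M
  | away x _ => x
  | dir _ => p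

variable [TopologicalSpace M]

/-- A chart `e` of `M`, seen on the complement of the exceptional line. -/
def awayChart (p : M) (e : OpenPartialHomeomorph M (ℂ × ℂ)) :
    PartialEquiv (Blowup M p) (ℂ × ℂ) where
  toFun b := e b.down
  invFun z := open Classical in
    if h : e.symm z = p then dir OnePoint.infty else away (e.symm z) h
  source := {b | b.down ≠ p ∧ b.down ∈ e.source}
  target := {z | z ∈ e.target ∧ e.symm z ≠ p}
  map_source' := by
    rintro b ⟨h1, h2⟩
    exact ⟨e.map_source h2, by rwa [e.left_inv h2]⟩
  map_target' := by
    rintro z ⟨h1, h2⟩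
    simp [h2, down, e.map_target h1]
  left_inv' := by
    rintro b ⟨h1, h2⟩
    cases b with
    | away x hx =>
      have hx2 : e.symm (e x) = x := e.left_inv h2
      simp [down, hx2, hx]
    | dir t => exact absurd rfl h1
  right_inv' := by
    rintro z ⟨h1, h2⟩
    simp [h2, down, e.right_inv h1]

lemma away_mem_awayChart {p x : M} {hx : x ≠ p} {e : OpenPartialHomeomorph M (ℂ × ℂ)} :
    away x hx ∈ (awayChart p e).source ↔ x ∈ e.source :=
  ⟨fun h => h.2, fun h => ⟨hx, h⟩⟩

lemma dir_mem_awayChart {p : M} {t : OnePoint ℂ} {e : OpenPartialHomeomorph M (ℂ × ℂ)} :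
    dir t ∈ (awayChart p e).source ↔ False :=
  ⟨fun h => h.1 rfl, False.elim⟩

lemma awayChart_symm {p : M} {e : OpenPartialHomeomorph M (ℂ × ℂ)} {z : ℂ × ℂ}
    (h : e.symm z ≠ p) : (awayChart p e).symm z = away (e.symm z) h := dif_neg h

variable [ChartedSpace (ℂ × ℂ) M]

/-- The coordinates `(x, y)` centred at `p`, from the preferred chart at `p`. -/
def coord (p x : M) : ℂ × ℂ := chartAt (ℂ × ℂ) p x - chartAt (ℂ × ℂ) p p

/-- The point with given coordinates `(x, y)` centred at `p`. -/
def point (p : M) (z : ℂ × ℂ) : M := (chartAt (ℂ × ℂ) p).symm (z + chartAt (ℂ × ℂ) p p)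

/-- The open set of values of the centred coordinates. -/
def dom (p : M) : Set (ℂ × ℂ) := {z | z + chartAt (ℂ × ℂ) p p ∈ (chartAt (ℂ × ℂ) p).target}

lemma coord_self (p : M) : coord p p = 0 := sub_self _

lemma point_zero (p : M) : point p 0 = p := by simp [point]

lemma coord_point {p : M} {z : ℂ × ℂ} (hz : z ∈ dom p) : coord p (point p z) = z := by
  simp only [coord, point]
  rw [(chartAt (ℂ × ℂ) p).right_inv hz]
  simp

lemma point_coord {p x : M} (hx : x ∈ (chartAt (ℂ × ℂ) p).source) : point p (coord p x) = x := by
  simp [coord, point, hx]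

lemma point_mem {p : M} {z : ℂ × ℂ} (hz : z ∈ dom p) :
    point p z ∈ (chartAt (ℂ × ℂ) p).source := (chartAt (ℂ × ℂ) p).map_target hz

lemma coord_mem {p x : M} (hx : x ∈ (chartAt (ℂ × ℂ) p).source) : coord p x ∈ dom p := by
  simp [coord, dom, hx]

lemma point_eq_iff {p : M} {z : ℂ × ℂ} (hz : z ∈ dom p) : point p z = p ↔ z = 0 := by
  constructor
  · intro h
    rw [← coord_point hz, h, coord_self]
  · rintro rfl
    exact point_zero p

lemma zero_mem_dom (p : M) : (0 : ℂ × ℂ) ∈ dom p := by simp [dom]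

/-- The chart `(u, v)` of the blowing-up with `x = u`, `y = u * v`. -/
def chartX (p : M) : PartialEquiv (Blowup M p) (ℂ × ℂ) where
  toFun
    | away x _ => ((coord p x).1, (coord p x).2 / (coord p x).1)
    | dir t => (0, finSlope t)
  invFun w := open Classical in
    if h : point p (w.1, w.1 * w.2) = p then dir (OnePoint.some w.2) else away _ h
  source := {b | match b with
    | away x _ => x ∈ (chartAt (ℂ × ℂ) p).source ∧ (coord p x).1 ≠ 0
    | dir t => t ≠ OnePoint.infty}
  target := {w | (w.1, w.1 * w.2) ∈ dom p}
  map_source' := by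
    rintro (⟨x, hx⟩ | t) h
    · obtain ⟨h1, h2⟩ := h
      simpa [mul_div_cancel₀ _ h2] using coord_mem h1
    · have h0 : ((0 : ℂ), (0 : ℂ)) ∈ dom p := zero_mem_dom p
      simpa using h0
  map_target' := by
    intro w hw
    by_cases h : point p (w.1, w.1 * w.2) = p
    · rw [dif_pos h]
      exact OnePoint.coe_ne_infty _
    · rw [dif_neg h]
      refine ⟨point_mem hw, ?_⟩
      rw [coord_point hw]
      intro h0
      refine h ((point_eq_iff hw).2 ?_)
      simp only at h0
      simp [h0]
  left_inv' := by
    rintro (⟨x, hx⟩ | t) h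
    · obtain ⟨h1, h2⟩ := h
      simp [mul_div_cancel₀ _ h2, point_coord h1, hx]
    · obtain ⟨s, rfl⟩ := OnePoint.ne_infty_iff_exists.1 h
      have h0 : point p ((0 : ℂ), (0 : ℂ)) = p := point_zero p
      simp [h0]
  right_inv' := by
    intro w hw
    by_cases h : point p (w.1, w.1 * w.2) = p
    · rw [dif_pos h]
      have h0 := (point_eq_iff hw).1 h
      simp only [Prod.mk_eq_zero] at h0
      ext <;> simp [h0.1]
    · rw [dif_neg h]
      have h1 : w.1 ≠ 0 := by
        intro h1
        refine h ((point_eq_iff hw).2 ?_)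
        simp [h1]
      simp only [coord_point hw]
      ext
      · rfl
      · simp [h1]

/-- The chart `(u, v)` of the blowing-up with `x = u * v`, `y = v`. -/
def chartY (p : M) : PartialEquiv (Blowup M p) (ℂ × ℂ) where
  toFun
    | away x _ => ((coord p x).1 / (coord p x).2, (coord p x).2)
    | dir t => (invSlope t, 0)
  invFun w := open Classical in
    if h : point p (w.1 * w.2, w.2) = p then dir (slopeInv w.1) else away _ h
  source := {b | match b with
    | away x _ => x ∈ (chartAt (ℂ × ℂ) p).source ∧ (coord p x).2 ≠ 0
    | dir t => t ≠ OnePoint.some 0}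
  target := {w | (w.1 * w.2, w.2) ∈ dom p}
  map_source' := by
    rintro (⟨x, hx⟩ | t) h
    · obtain ⟨h1, h2⟩ := h
      simpa [div_mul_cancel₀ _ h2] using coord_mem h1
    · have h0 : ((0 : ℂ), (0 : ℂ)) ∈ dom p := zero_mem_dom p
      simpa using h0
  map_target' := by
    intro w hw
    by_cases h : point p (w.1 * w.2, w.2) = p
    · rw [dif_pos h]
      change slopeInv w.1 ≠ OnePoint.some 0
      unfold slopeInv
      split_ifs with h0
      · exact OnePoint.infty_ne_coe _
      · simpa using h0
    · rw [dif_neg h]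
      refine ⟨point_mem hw, ?_⟩
      rw [coord_point hw]
      intro h0
      refine h ((point_eq_iff hw).2 ?_)
      simp only at h0
      simp [h0]
  left_inv' := by
    rintro (⟨x, hx⟩ | t) h
    · obtain ⟨h1, h2⟩ := h
      simp [div_mul_cancel₀ _ h2, point_coord h1, hx]
    · have h0 : point p ((0 : ℂ), (0 : ℂ)) = p := point_zero p
      have h1 : slopeInv (invSlope t) = t := by
        induction t using OnePoint.rec with
        | infty => simp [slopeInv]
        | coe s =>
          have hs : s ≠ 0 := by
            rintro rfl
            exact h rfl
          simp [slopeInv, hs]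
      simp [h0, h1]
  right_inv' := by
    intro w hw
    by_cases h : point p (w.1 * w.2, w.2) = p
    · rw [dif_pos h]
      have h0 := (point_eq_iff hw).1 h
      simp only [Prod.mk_eq_zero] at h0
      ext
      · by_cases h1 : w.1 = 0 <;> simp [slopeInv, h1]
      · simp [h0.2]
    · rw [dif_neg h]
      have h1 : w.2 ≠ 0 := by
        intro h1
        refine h ((point_eq_iff hw).2 ?_)
        simp [h1]
      simp only [coord_point hw]
      ext
      · simp [h1]
      · rfl

lemma away_mem_chartX {p x : M} {hx : x ≠ p} : away x hx ∈ (chartX p).source ↔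
    x ∈ (chartAt (ℂ × ℂ) p).source ∧ (coord p x).1 ≠ 0 := Iff.rfl

lemma dir_mem_chartX {p : M} {t : OnePoint ℂ} : dir t ∈ (chartX p).source ↔
    t ≠ OnePoint.infty := Iff.rfl

lemma away_mem_chartY {p x : M} {hx : x ≠ p} : away x hx ∈ (chartY p).source ↔
    x ∈ (chartAt (ℂ × ℂ) p).source ∧ (coord p x).2 ≠ 0 := Iff.rfl

lemma dir_mem_chartY {p : M} {t : OnePoint ℂ} : dir t ∈ (chartY p).source ↔
    t ≠ OnePoint.some 0 := Iff.rfl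

lemma chartX_symm_away {p : M} {w : ℂ × ℂ} (hw : w ∈ (chartX p).target) (h : w.1 ≠ 0) :
    ∃ h', (chartX p).symm w = away (point p (w.1, w.1 * w.2)) h' := by
  have h' : point p (w.1, w.1 * w.2) ≠ p := by
    rw [Ne, point_eq_iff hw]
    simp [h]
  exact ⟨h', dif_neg h'⟩

lemma chartX_symm_dir {p : M} {w : ℂ × ℂ} (h : w.1 = 0) :
    (chartX p).symm w = dir (OnePoint.some w.2) := by
  have h' : point p (w.1, w.1 * w.2) = p := by
    have : (w.1, w.1 * w.2) = 0 := by simp [h]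
    rw [this, point_zero]
  exact dif_pos h'

lemma chartY_symm_away {p : M} {w : ℂ × ℂ} (hw : w ∈ (chartY p).target) (h : w.2 ≠ 0) :
    ∃ h', (chartY p).symm w = away (point p (w.1 * w.2, w.2)) h' := by
  have h' : point p (w.1 * w.2, w.2) ≠ p := by
    rw [Ne, point_eq_iff hw]
    simp [h]
  exact ⟨h', dif_neg h'⟩

lemma chartY_symm_dir {p : M} {w : ℂ × ℂ} (h : w.2 = 0) :
    (chartY p).symm w = dir (slopeInv w.1) := by
  have h' : point p (w.1 * w.2, w.2) = p := by
    have : (w.1 * w.2, w.2) = 0 := by simp [h]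
    rw [this, point_zero]
  exact dif_pos h'

lemma isOpen_dom (p : M) : IsOpen (dom p) :=
  (chartAt (ℂ × ℂ) p).open_target.preimage (continuous_id.add continuous_const)

lemma blowX_contDiff : ContDiff ℂ ω (fun w : ℂ × ℂ => (w.1, w.1 * w.2)) :=
  contDiff_fst.prodMk (contDiff_fst.mul contDiff_snd)

lemma blowY_contDiff : ContDiff ℂ ω (fun w : ℂ × ℂ => (w.1 * w.2, w.2)) :=
  (contDiff_fst.mul contDiff_snd).prodMk contDiff_snd

lemma isOpen_targetX (p : M) : IsOpen (chartX p).target :=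
  (isOpen_dom p).preimage blowX_contDiff.continuous

lemma isOpen_targetY (p : M) : IsOpen (chartY p).target :=
  (isOpen_dom p).preimage blowY_contDiff.continuous

/-- The atlas of the blowing-up. -/
def charts (p : M) : Set (PartialEquiv (Blowup M p) (ℂ × ℂ)) :=
  {f | f = chartX p ∨ f = chartY p ∨ ∃ e ∈ atlas (ℂ × ℂ) M, f = awayChart p e}

/-- The preferred chart at a point of the blowing-up. -/
def prefChart {p : M} : Blowup M p → PartialEquiv (Blowup M p) (ℂ × ℂ)
  | away x _ => awayChart p (chartAt (ℂ × ℂ) x)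
  | dir t => open Classical in if t = OnePoint.infty then chartY p else chartX p

/-- The change of charts is defined on an open set and is holomorphic there. -/
def Compat {N : Type} (e e' : PartialEquiv N (ℂ × ℂ)) : Prop :=
  IsOpen (e.symm.trans e').source ∧
    ContDiffOn ℂ ω (e.symm.trans e') (e.symm.trans e').source

lemma compat_of {N : Type} {e e' : PartialEquiv N (ℂ × ℂ)} (S : Set (ℂ × ℂ))
    (f : ℂ × ℂ → ℂ × ℂ) (hS : IsOpen S) (hf : ContDiffOn ℂ ω f S)
    (h1 : ∀ z, (z ∈ e.target ∧ e.symm z ∈ e'.source) ↔ z ∈ S)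
    (h2 : ∀ z ∈ S, e' (e.symm z) = f z) : Compat e e' := by
  have h : (e.symm.trans e').source = S := by
    ext z
    rw [PartialEquiv.trans_source]
    exact h1 z
  refine ⟨h ▸ hS, ?_⟩
  rw [h]
  exact hf.congr h2

lemma compat_self {N : Type} (e : PartialEquiv N (ℂ × ℂ)) (he : IsOpen e.target) : Compat e e :=
  compat_of e.target id he contDiffOn_id
    (fun _ => ⟨fun h => h.1, fun h => ⟨h, e.map_target h⟩⟩) (fun _ h => e.right_inv h)

lemma compat_X_Y (p : M) : Compat (chartX p) (chartY p) := by
  refine compat_of ((chartX p).target ∩ {w | w.2 ≠ 0}) (fun w => (w.2⁻¹, w.1 * w.2))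
    ((isOpen_targetX p).inter (isOpen_ne.preimage continuous_snd)) ?_ ?_ ?_
  · exact (contDiffOn_snd.inv fun w hw => hw.2).prodMk (contDiffOn_fst.mul contDiffOn_snd)
  · intro w
    refine and_congr_right fun hw => ?_
    by_cases h : w.1 = 0
    · simp [chartX_symm_dir h, dir_mem_chartY]
    · obtain ⟨h3, h4⟩ := chartX_symm_away hw h
      simp [h4, away_mem_chartY, coord_point hw, point_mem hw, h]
  · rintro w ⟨hw, h'⟩
    by_cases h : w.1 = 0
    · simp [chartX_symm_dir h, chartY, h]
    · obtain ⟨h3, h4⟩ := chartX_symm_away hw h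
      rw [h4]
      simp only [chartY, coord_point hw]
      ext
      · simp only
        field_simp
      · rfl

lemma compat_Y_X (p : M) : Compat (chartY p) (chartX p) := by
  refine compat_of ((chartY p).target ∩ {w | w.1 ≠ 0}) (fun w => (w.1 * w.2, w.1⁻¹))
    ((isOpen_targetY p).inter (isOpen_ne.preimage continuous_fst)) ?_ ?_ ?_
  · exact (contDiffOn_fst.mul contDiffOn_snd).prodMk (contDiffOn_fst.inv fun w hw => hw.2)
  · intro w
    refine and_congr_right fun hw => ?_
    by_cases h : w.2 = 0
    · by_cases h0 : w.1 = 0 <;> simp [chartY_symm_dir h, dir_mem_chartX, slopeInv, h0]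
    · obtain ⟨h3, h4⟩ := chartY_symm_away hw h
      simp [h4, away_mem_chartX, coord_point hw, point_mem hw, h]
  · rintro w ⟨hw, h'⟩
    have h' : w.1 ≠ 0 := h'
    by_cases h : w.2 = 0
    · simp [chartY_symm_dir h, chartX, h, slopeInv, h']
    · obtain ⟨h3, h4⟩ := chartY_symm_away hw h
      rw [h4]
      simp only [chartX, coord_point hw]
      ext
      · rfl
      · simp only
        field_simp

variable [IsManifold 𝓘(ℂ, ℂ × ℂ) ω M]

lemma chart_change {e e' : OpenPartialHomeomorph M (ℂ × ℂ)} (he : e ∈ atlas (ℂ × ℂ) M)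
    (he' : e' ∈ atlas (ℂ × ℂ) M) :
    ContDiffOn ℂ ω (fun z => e' (e.symm z)) (e.symm.trans e').source := by
  have h := (contDiffGroupoid ω 𝓘(ℂ, ℂ × ℂ)).compatible he he'
  have := (contDiffGroupoid ω 𝓘(ℂ, ℂ × ℂ)).mem_of_eqOnSource h (Setoid.refl _)
  rw [contDiffGroupoid, mem_groupoid_of_pregroupoid] at this
  simpa [contDiffPregroupoid, Function.comp_def] using this.1

lemma coord_change (p : M) {e : OpenPartialHomeomorph M (ℂ × ℂ)} (he : e ∈ atlas (ℂ × ℂ) M) :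
    IsOpen {z | z ∈ e.target ∧ e.symm z ∈ (chartAt (ℂ × ℂ) p).source} ∧
    ContDiffOn ℂ ω (fun z => coord p (e.symm z))
      {z | z ∈ e.target ∧ e.symm z ∈ (chartAt (ℂ × ℂ) p).source} := by
  have h : (e.symm.trans (chartAt (ℂ × ℂ) p)).source =
      {z | z ∈ e.target ∧ e.symm z ∈ (chartAt (ℂ × ℂ) p).source} := by
    ext z
    simp
  rw [← h]
  exact ⟨(e.symm.trans _).open_source,
    (chart_change he (chart_mem_atlas (ℂ × ℂ) p)).sub contDiffOn_const⟩

lemma point_change (p : M) {e : OpenPartialHomeomorph M (ℂ × ℂ)} (he : e ∈ atlas (ℂ × ℂ) M) :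
    IsOpen {z | z ∈ dom p ∧ point p z ∈ e.source} ∧
    ContDiffOn ℂ ω (fun z => e (point p z)) {z | z ∈ dom p ∧ point p z ∈ e.source} := by
  have h : {z | z ∈ dom p ∧ point p z ∈ e.source} = (fun z => z + chartAt (ℂ × ℂ) p p) ⁻¹'
      ((chartAt (ℂ × ℂ) p).symm.trans e).source := by
    ext z
    simp [dom, point]
  rw [h]
  refine ⟨((chartAt (ℂ × ℂ) p).symm.trans e).open_source.preimage
    (continuous_id.add continuous_const), ?_⟩
  exact (chart_change (chart_mem_atlas (ℂ × ℂ) p) he).comp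
    (contDiffOn_id.add contDiffOn_const) (fun z hz => hz)

lemma compat_away_away (p : M) {e e' : OpenPartialHomeomorph M (ℂ × ℂ)}
    (he : e ∈ atlas (ℂ × ℂ) M) (he' : e' ∈ atlas (ℂ × ℂ) M) :
    Compat (awayChart p e) (awayChart p e') := by
  have hS : {z | z ∈ (e.symm.trans e').source ∧ e.symm z ≠ p} =
      (e.symm.trans e').source ∩ (e.target ∩ e.symm ⁻¹' {p})ᶜ := by
    ext z
    simp +contextual
  have hc : IsClosed (e.target ∩ e.symm ⁻¹' {p}) := by
    refine Set.Subsingleton.isClosed ?_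
    rintro a ⟨ha, ha'⟩ b ⟨hb, hb'⟩
    rw [← e.right_inv ha, ← e.right_inv hb, ha', hb']
  refine compat_of {z | z ∈ (e.symm.trans e').source ∧ e.symm z ≠ p} (fun z => e' (e.symm z))
    ?_ ?_ ?_ ?_
  · rw [hS]
    exact (e.symm.trans e').open_source.inter hc.isOpen_compl
  · exact (chart_change he he').mono (fun z hz => hz.1)
  · intro z
    by_cases h : e.symm z = p <;>
      simp [awayChart, down, h]
  · rintro z ⟨-, h⟩
    simp [awayChart, down, h]

lemma compat_away_X (p : M) {e : OpenPartialHomeomorph M (ℂ × ℂ)}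
    (he : e ∈ atlas (ℂ × ℂ) M) : Compat (awayChart p e) (chartX p) := by
  obtain ⟨h1, h2⟩ := coord_change p he
  refine compat_of ({z | z ∈ e.target ∧ e.symm z ∈ (chartAt (ℂ × ℂ) p).source} ∩
      (fun z => coord p (e.symm z)) ⁻¹' {w | w.1 ≠ 0})
    (fun z => ((coord p (e.symm z)).1, (coord p (e.symm z)).2 / (coord p (e.symm z)).1))
    (h2.continuousOn.isOpen_inter_preimage h1 (isOpen_ne.preimage continuous_fst)) ?_ ?_ ?_
  · have h3 := h2.mono (Set.inter_subset_left (t := (fun z => coord p (e.symm z)) ⁻¹'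
      {w : ℂ × ℂ | w.1 ≠ 0}))
    exact h3.fst.prodMk (h3.snd.div h3.fst (fun z hz => hz.2))
  · intro z
    by_cases h : e.symm z = p
    · simp [awayChart, h, coord_self]
    · simp [awayChart, chartX, h, and_assoc]
  · rintro z ⟨-, h⟩
    have h0 : e.symm z ≠ p := by
      intro h0
      simp [h0, coord_self] at h
    simp [awayChart, chartX, h0]

lemma compat_away_Y (p : M) {e : OpenPartialHomeomorph M (ℂ × ℂ)}
    (he : e ∈ atlas (ℂ × ℂ) M) : Compat (awayChart p e) (chartY p) := by
  obtain ⟨h1, h2⟩ := coord_change p he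
  refine compat_of ({z | z ∈ e.target ∧ e.symm z ∈ (chartAt (ℂ × ℂ) p).source} ∩
      (fun z => coord p (e.symm z)) ⁻¹' {w | w.2 ≠ 0})
    (fun z => ((coord p (e.symm z)).1 / (coord p (e.symm z)).2, (coord p (e.symm z)).2))
    (h2.continuousOn.isOpen_inter_preimage h1 (isOpen_ne.preimage continuous_snd)) ?_ ?_ ?_
  · have h3 := h2.mono (Set.inter_subset_left (t := (fun z => coord p (e.symm z)) ⁻¹'
      {w : ℂ × ℂ | w.2 ≠ 0}))
    exact (h3.fst.div h3.snd (fun z hz => hz.2)).prodMk h3.snd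
  · intro z
    by_cases h : e.symm z = p
    · simp [awayChart, h, coord_self]
    · simp [awayChart, chartY, h, and_assoc]
  · rintro z ⟨-, h⟩
    have h0 : e.symm z ≠ p := by
      intro h0
      simp [h0, coord_self] at h
    simp [awayChart, chartY, h0]

lemma compat_X_away (p : M) {e : OpenPartialHomeomorph M (ℂ × ℂ)}
    (he : e ∈ atlas (ℂ × ℂ) M) : Compat (chartX p) (awayChart p e) := by
  obtain ⟨h1, h2⟩ := point_change p he
  refine compat_of ((fun w : ℂ × ℂ => (w.1, w.1 * w.2)) ⁻¹'
      {z | z ∈ dom p ∧ point p z ∈ e.source} ∩ {w : ℂ × ℂ | w.1 ≠ 0})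
    (fun w => e (point p (w.1, w.1 * w.2)))
    ((h1.preimage blowX_contDiff.continuous).inter (isOpen_ne.preimage continuous_fst)) ?_ ?_ ?_
  · exact h2.comp blowX_contDiff.contDiffOn (fun z hz => hz.1)
  · intro w
    by_cases h : w.1 = 0
    · simp [chartX_symm_dir h, dir_mem_awayChart, h]
    · change _ ↔ (w ∈ (chartX p).target ∧ _) ∧ _
      rw [and_assoc]
      refine and_congr_right fun hw => ?_
      obtain ⟨h3, h4⟩ := chartX_symm_away hw h
      simp [h4, away_mem_awayChart, h]
  · rintro w ⟨⟨hw, -⟩, h⟩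
    obtain ⟨h3, h4⟩ := chartX_symm_away hw h
    rw [h4]
    rfl

lemma compat_Y_away (p : M) {e : OpenPartialHomeomorph M (ℂ × ℂ)}
    (he : e ∈ atlas (ℂ × ℂ) M) : Compat (chartY p) (awayChart p e) := by
  obtain ⟨h1, h2⟩ := point_change p he
  refine compat_of ((fun w : ℂ × ℂ => (w.1 * w.2, w.2)) ⁻¹'
      {z | z ∈ dom p ∧ point p z ∈ e.source} ∩ {w : ℂ × ℂ | w.2 ≠ 0})
    (fun w => e (point p (w.1 * w.2, w.2)))
    ((h1.preimage blowY_contDiff.continuous).inter (isOpen_ne.preimage continuous_snd)) ?_ ?_ ?_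
  · exact h2.comp blowY_contDiff.contDiffOn (fun z hz => hz.1)
  · intro w
    by_cases h : w.2 = 0
    · simp [chartY_symm_dir h, dir_mem_awayChart, h]
    · change _ ↔ (w ∈ (chartY p).target ∧ _) ∧ _
      rw [and_assoc]
      refine and_congr_right fun hw => ?_
      obtain ⟨h3, h4⟩ := chartY_symm_away hw h
      simp [h4, away_mem_awayChart, h]
  · rintro w ⟨⟨hw, -⟩, h⟩
    obtain ⟨h3, h4⟩ := chartY_symm_away hw h
    rw [h4]
    rfl

lemma compat_charts (p : M) {f f' : PartialEquiv (Blowup M p) (ℂ × ℂ)} (hf : f ∈ charts p)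
    (hf' : f' ∈ charts p) : Compat f f' := by
  rcases hf with rfl | rfl | ⟨e, he, rfl⟩ <;> rcases hf' with rfl | rfl | ⟨e', he', rfl⟩
  · exact compat_self _ (isOpen_targetX p)
  · exact compat_X_Y p
  · exact compat_X_away p he'
  · exact compat_Y_X p
  · exact compat_self _ (isOpen_targetY p)
  · exact compat_Y_away p he'
  · exact compat_away_X p he
  · exact compat_away_Y p he
  · exact compat_away_away p he he'

/-- The blowing-up as a set with an atlas. -/
def core (M : Type) [TopologicalSpace M] [ChartedSpace (ℂ × ℂ) M] [IsManifold 𝓘(ℂ, ℂ × ℂ) ω M]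
    (p : M) : ChartedSpaceCore (ℂ × ℂ) (Blowup M p) where
  atlas := charts p
  chartAt := prefChart
  mem_chart_source := by
    rintro (⟨x, hx⟩ | t)
    · exact away_mem_awayChart.2 (mem_chart_source (ℂ × ℂ) x)
    · by_cases h : t = OnePoint.infty
      · simp [prefChart, h, dir_mem_chartY]
      · simp [prefChart, h, dir_mem_chartX]
  chart_mem_atlas := by
    rintro (⟨x, hx⟩ | t)
    · exact Or.inr (Or.inr ⟨_, chart_mem_atlas (ℂ × ℂ) x, rfl⟩)
    · by_cases h : t = OnePoint.infty
      · simp [prefChart, h, charts]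
      · simp [prefChart, h, charts]
  open_source _ _ he he' := (compat_charts p he he').1
  continuousOn_toFun _ _ he he' := (compat_charts p he he').2.continuousOn

instance (p : M) : TopologicalSpace (Blowup M p) := (core M p).toTopologicalSpace

instance (p : M) : ChartedSpace (ℂ × ℂ) (Blowup M p) := (core M p).toChartedSpace

instance (p : M) : IsManifold 𝓘(ℂ, ℂ × ℂ) ω (Blowup M p) := by
  refine isManifold_of_contDiffOn _ _ _ ?_
  rintro e e' he he'
  obtain ⟨f, hf, rfl⟩ : ∃ f, ∃ hf : f ∈ charts p, e = (core M p).openPartialHomeomorph f hf := by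
    have h : e ∈ ⋃ (f : PartialEquiv (Blowup M p) (ℂ × ℂ)) (hf : f ∈ charts p),
      {(core M p).openPartialHomeomorph f hf} := he
    simpa only [Set.mem_iUnion, Set.mem_singleton_iff] using h
  obtain ⟨f', hf', rfl⟩ : ∃ f, ∃ hf : f ∈ charts p, e' = (core M p).openPartialHomeomorph f hf := by
    have h : e' ∈ ⋃ (f : PartialEquiv (Blowup M p) (ℂ × ℂ)) (hf : f ∈ charts p),
      {(core M p).openPartialHomeomorph f hf} := he'
    simpa only [Set.mem_iUnion, Set.mem_singleton_iff] using h
  have := (compat_charts p hf hf').2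
  simp
  exact this

end Blowup
/-! ### Sequences of point blowing-ups over `(ℂ², 0)` -/

/-- A complex surface together with a map to `ℂ²`. -/
structure Surface where
  carrier : Type
  [top : TopologicalSpace carrier]
  [charted : ChartedSpace (ℂ × ℂ) carrier]
  [manifold : IsManifold 𝓘(ℂ, ℂ × ℂ) ω carrier]
  proj : carrier → ℂ × ℂ

attribute [instance] Surface.top Surface.charted Surface.manifold

namespace Surface

/-- The plane `ℂ²`, with the identity map. -/
def plane : Surface where
  carrier := ℂ × ℂ
  proj := id

/-- The blowing-up of a surface over `ℂ²` at the point `c`. -/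
def blowup (X : Surface) (c : X.carrier) : Surface where
  carrier := Blowup X.carrier c
  proj b := X.proj b.down

/-- The fibre over the origin. -/
def fibre (X : Surface) : Set X.carrier := {q | X.proj q = 0}

/-- `c` is a regular point of the analytic subset `D`: near `c`, the set `D` is a smooth
holomorphic curve, namely the zero set of a holomorphic function with nonzero differential
at `c`. -/
def IsRegularPoint (X : Surface) (D : Set X.carrier) (c : X.carrier) : Prop :=
  c ∈ D ∧ ∃ g : X.carrier → ℂ,
    ContMDiffAt 𝓘(ℂ, ℂ × ℂ) 𝓘(ℂ, ℂ) ω g c ∧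
    mfderiv 𝓘(ℂ, ℂ × ℂ) 𝓘(ℂ, ℂ) g c ≠ 0 ∧
    ∀ᶠ q in 𝓝 c, q ∈ D ↔ g q = 0

end Surface

/-- `BlowupSeq X` is the type of finite sequences of point blowing-ups over `(ℂ², 0)` with final
surface `X`: one starts with `ℂ²` and blows up, at each step, a point over the origin.  Such a
sequence does not change anything outside the fibre over the origin, so the germs at the origin of
these sequences are all the sequences over the germ `(ℂ², 0)`. -/
inductive BlowupSeq : Surface → Type 1
  | nil : BlowupSeq Surface.plane
  | cons {X : Surface} (s : BlowupSeq X) (c : X.carrier) (hc : X.proj c = 0) :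
      BlowupSeq (X.blowup c)

namespace BlowupSeq

/-- The exceptional divisor of a sequence of point blowing-ups: the whole fibre over the origin,
as soon as at least one point was blown up. -/
def exceptionalDivisor : {X : Surface} → BlowupSeq X → Set X.carrier
  | _, nil => ∅
  | _, cons (X := X) _ c _ => (X.blowup c).fibre

/-- Every center after the first one (which is the origin of `ℂ²`, when the exceptional divisor is
still empty) is a regular point of the exceptional divisor of the preceding blowing-ups. -/
def CentersRegular : {X : Surface} → BlowupSeq X → Prop
  | _, nil => True
  | _, cons (X := X) s c _ => s.CentersRegular ∧
      (s.exceptionalDivisor = ∅ ∨ X.IsRegularPoint s.exceptionalDivisor c)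

end BlowupSeq

/-! ### Ramifications and elimination of indeterminacies -/

/-- `α` represents the germ of a biholomorphism `(ℂ², 0) → (ℂ², 0)`. -/
def IsLocalBiholomorphism (α : ℂ × ℂ → ℂ × ℂ) : Prop :=
  α 0 = 0 ∧ AnalyticAt ℂ α 0 ∧
    ∃ L : (ℂ × ℂ) ≃L[ℂ] (ℂ × ℂ), HasFDerivAt α (L : ℂ × ℂ →L[ℂ] ℂ × ℂ) 0

/-- `ρ` represents the germ of a ramification `(ℂ², 0) → (ℂ², 0)`: in suitable holomorphic
coordinates of the source and of the target it is `(u, v) ↦ (u ^ n, v)` with `n ≥ 1`. -/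
def IsRamification (ρ : ℂ × ℂ → ℂ × ℂ) : Prop :=
  ∃ n : ℕ, 1 ≤ n ∧ ∃ α β : ℂ × ℂ → ℂ × ℂ,
    IsLocalBiholomorphism α ∧ IsLocalBiholomorphism β ∧
    ∀ᶠ z in 𝓝 (0 : ℂ × ℂ), ρ z = α ((β z).1 ^ n, (β z).2)

/-- For surfaces `π' : Y → ℂ²` and `π : X → ℂ²` and a germ `ρ`, the map `π⁻¹ ∘ ρ ∘ π'` has no
indeterminacy: it extends to a holomorphic map `f` to `X` on the part of `Y` over some
neighbourhood of the origin, that is, `π ∘ f = ρ ∘ π'` there. -/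
def Extends (ρ : ℂ × ℂ → ℂ × ℂ) (X Y : Surface) : Prop :=
  ∃ f : Y.carrier → X.carrier, ∀ᶠ z in 𝓝 (0 : ℂ × ℂ), ∀ q : Y.carrier, Y.proj q = z →
    ContMDiffAt 𝓘(ℂ, ℂ × ℂ) 𝓘(ℂ, ℂ × ℂ) ω f q ∧ X.proj (f q) = ρ z

/-- `Y`, the final surface of a sequence of point blowing-ups, is the elimination of
indeterminacies of `π⁻¹ ∘ ρ`, where `π : X → ℂ²`: the composite with `π⁻¹ ∘ ρ` has no
indeterminacy on `Y`, and every sequence of point blowing-ups with this property factors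
through `Y`. -/
def IsElimination (ρ : ℂ × ℂ → ℂ × ℂ) (X Y : Surface) : Prop :=
  Extends ρ X Y ∧ ∀ Z : Surface, BlowupSeq Z → Extends ρ X Z → Extends id Y Z

end PointBlowup

end

noncomputable section

namespace PointBlowup

open Filter

/-! Write u for the first coordinate of ℂ². The ramification is (u, v) ↦ (u ^ n, v), with n
divisible by all positive integers up to a bound B which doubles with each blowing-up in π. This B
bounds the multiplicities of the divisor u = 0 on X and, at a crossing of two of its branches, the
sum of their multiplicities, which is the multiplicity of the exceptional line obtained by blowing
up that crossing.

As in semistable reduction, such a base change makes u = 0 reduced with at most nodes on the minimal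
elimination W: at each point of the fibre π⁻¹ ∘ ρ is a monomial map up to units, and u is x or x * y
(`Model`). The proof is an induction on the blowing-ups of X. When X is blown up at c, the map lifts
by itself at contracted points and, thanks to the divisibility of n, at corners
(`HasModel.blowup_target`). A regular point sent to c carries the map (x ^ m, y), and m successive
blowing-ups of W resolve it (`Pending.blowup_source`). Each center used is a true point of
indeterminacy, so every sequence that eliminates the indeterminacies dominates the new W
(`extends_blowup_of_not_liftsAt`). That rests on a cancellation law for composites of blowing-up
charts (`IsBlowGerm.of_comp`). Hence W is minimal.

Any elimination Y is isomorphic to W over ℂ² near the fibre, so u vanishes to order at most two at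
every point of the fibre of Y. If du vanished at a center of Y, the quadratic part of u there would
vanish in some tangent direction, u would have order at least three at that point of the new
exceptional line (`exists_kap_isBigO`), and still at all points above it in Y. So du ≠ 0 at each
center, and once the origin has been blown up the exceptional divisor near the center is exactly the
smooth curve u = 0 (`isRegularPoint_fibre`). -/

/-- Hadamard's lemma: an analytic function vanishing at the origin is `z ↦ L z z` for an analytic
family `L` of continuous linear maps. -/
lemma AnalyticAt.exists_clm_apply {E F : Type*} [NormedAddCommGroup E] [NormedSpace ℂ E]
    [NormedAddCommGroup F] [NormedSpace ℂ F] [CompleteSpace F] {f : E → F}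
    (hf : AnalyticAt ℂ f 0) (h0 : f 0 = 0) :
    ∃ L : E → E →L[ℂ] F, AnalyticAt ℂ L 0 ∧ ∀ᶠ z in 𝓝 0, f z = L z z := by
  obtain ⟨p, r, hp⟩ := hf
  -- `L` is the sum of the shifted series, where one argument of each term is left open. Feeding `z`
  -- back gives `p` because its constant term vanishes.
  have hr : 0 < p.shift.radius := by
    rw [FormalMultilinearSeries.radius_shift]
    exact hp.r_pos.trans_le hp.r_le
  have hs := p.shift.hasFPowerSeriesOnBall hr
  have hu := hs.unshift (z := (0 : F))
  have hpu : p.shift.unshift (0 : F) = p := by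
    ext n v
    cases n with
    | zero =>
      have : p 0 v = 0 := by
        rw [hp.hasFPowerSeriesAt.coeff_zero, h0]
      simp [FormalMultilinearSeries.unshift, this]
    | succ n =>
      simp [FormalMultilinearSeries.unshift, FormalMultilinearSeries.shift]
      try rfl
  rw [hpu] at hu
  refine ⟨p.shift.sum, hs.analyticAt, ?_⟩
  have h1 := hp.hasFPowerSeriesAt.eventually_hasSum_sub
  have h2 := hu.hasFPowerSeriesAt.eventually_hasSum_sub
  filter_upwards [h1, h2] with z hz1 hz2
  simpa using hz1.unique hz2

/-! ### Germs of local coordinates on a surface -/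

section Param

variable {M N K : Type} [TopologicalSpace M] [ChartedSpace (ℂ × ℂ) M]
  [TopologicalSpace N] [ChartedSpace (ℂ × ℂ) N] [TopologicalSpace K] [ChartedSpace (ℂ × ℂ) K]

/-- A map between complex surfaces is holomorphic at a point. -/
abbrev Hol (f : M → N) (q : M) : Prop := ContMDiffAt 𝓘(ℂ, ℂ × ℂ) 𝓘(ℂ, ℂ × ℂ) ω f q

lemma hol_iff_analyticAt {f : ℂ × ℂ → ℂ × ℂ} {z : ℂ × ℂ} : Hol f z ↔ AnalyticAt ℂ f z := by
  rw [Hol, contMDiffAt_iff_contDiffAt]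
  exact ⟨fun h => h.analyticAt, fun h => h.contDiffAt⟩

/-- `γ` represents the germ at `0` of a holomorphic parametrization of `M` near `γ 0`. -/
def IsParam (γ : ℂ × ℂ → M) : Prop :=
  ∃ κ : M → ℂ × ℂ, Hol γ 0 ∧ Hol κ (γ 0) ∧ (∀ᶠ z in 𝓝 0, κ (γ z) = z) ∧
    ∀ᶠ q in 𝓝 (γ 0), γ (κ q) = q

lemma IsParam.hol {γ : ℂ × ℂ → M} (h : IsParam γ) : Hol γ 0 := h.choose_spec.1

lemma IsParam.congr {γ γ' : ℂ × ℂ → M} (h : IsParam γ) (e : γ' =ᶠ[𝓝 0] γ) : IsParam γ' := by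
  obtain ⟨κ, h1, h2, h3, h4⟩ := h
  have e0 : γ' 0 = γ 0 := e.self_of_nhds
  have hk : κ (γ 0) = 0 := h3.self_of_nhds
  refine ⟨κ, h1.congr_of_eventuallyEq e, e0 ▸ h2, ?_, ?_⟩
  · filter_upwards [h3, e] with z hz hz'
    rw [hz', hz]
  · rw [e0]
    have hk' : Tendsto κ (𝓝 (γ 0)) (𝓝 0) := by
      have := h2.continuousAt
      rwa [ContinuousAt, hk] at this
    filter_upwards [h4, hk'.eventually e] with q hq hq'
    rw [hq', hq]

lemma IsParam.comp {γ : ℂ × ℂ → M} {β : ℂ × ℂ → ℂ × ℂ} (h : IsParam γ) (hβ : IsParam β)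
    (h0 : β 0 = 0) : IsParam (γ ∘ β) := by
  obtain ⟨κ, h1, h2, h3, h4⟩ := h
  obtain ⟨τ, g1, g2, g3, g4⟩ := hβ
  have hk : κ (γ 0) = 0 := h3.self_of_nhds
  have hb : Tendsto β (𝓝 0) (𝓝 0) := by
    have := g1.continuousAt
    rwa [ContinuousAt, h0] at this
  have hk' : Tendsto κ (𝓝 (γ 0)) (𝓝 0) := by
    have := h2.continuousAt
    rwa [ContinuousAt, hk] at this
  rw [h0] at g2 g4
  refine ⟨τ ∘ κ, ?_, ?_, ?_, ?_⟩
  · exact ContMDiffAt.comp (0 : ℂ × ℂ) (by rwa [h0]) g1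
  · simp only [Function.comp_apply, h0]
    exact ContMDiffAt.comp _ (by rwa [hk]) h2
  · filter_upwards [g3, hb.eventually h3] with z hz hz'
    simp [hz', hz]
  · simp only [Function.comp_apply, h0]
    filter_upwards [h4, hk'.eventually g4] with q hq hq'
    simp [hq', hq]

/-- Two parametrizations at the same point differ by a change of coordinates. -/
lemma IsParam.exists_comp {γ γ' : ℂ × ℂ → M} (h : IsParam γ) (h' : IsParam γ')
    (h0 : γ' 0 = γ 0) : ∃ β : ℂ × ℂ → ℂ × ℂ, IsParam β ∧ β 0 = 0 ∧ γ' =ᶠ[𝓝 0] γ ∘ β := by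
  obtain ⟨κ, h1, h2, h3, h4⟩ := h
  obtain ⟨τ, g1, g2, g3, g4⟩ := h'
  have hk : κ (γ 0) = 0 := h3.self_of_nhds
  have ht : τ (γ 0) = 0 := h0 ▸ g3.self_of_nhds
  have hγ' : Tendsto γ' (𝓝 0) (𝓝 (γ 0)) := h0 ▸ g1.continuousAt
  have hγ : Tendsto γ (𝓝 0) (𝓝 (γ 0)) := h1.continuousAt
  rw [h0] at g2 g4
  refine ⟨κ ∘ γ', ⟨τ ∘ γ, ?_, ?_, ?_, ?_⟩, ?_, ?_⟩
  · exact ContMDiffAt.comp (0 : ℂ × ℂ) (by rwa [h0]) g1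
  · simp only [Function.comp_apply, h0, hk]
    exact ContMDiffAt.comp _ g2 h1
  · filter_upwards [g3, hγ'.eventually h4] with z hz hz'
    simp [hz', hz]
  · simp only [Function.comp_apply, h0, hk]
    filter_upwards [h3, hγ.eventually g4] with z hz hz'
    simp [hz', hz]
  · simp [h0, hk]
  · filter_upwards [hγ'.eventually h4] with z hz
    simp [hz]

lemma IsParam.exists_inv {β : ℂ × ℂ → ℂ × ℂ} (h : IsParam β) (h0 : β 0 = 0) :
    ∃ τ : ℂ × ℂ → ℂ × ℂ, IsParam τ ∧ τ 0 = 0 ∧ (∀ᶠ z in 𝓝 0, τ (β z) = z) ∧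
      ∀ᶠ z in 𝓝 0, β (τ z) = z := by
  obtain ⟨τ, g1, g2, g3, g4⟩ := h
  have ht : τ 0 = 0 := by simpa [h0] using g3.self_of_nhds
  rw [h0] at g2 g4
  exact ⟨τ, ⟨β, g2, ht.symm ▸ g1, g4, ht.symm ▸ g3⟩, ht, g3, g4⟩

lemma isParam_id : IsParam (id : ℂ × ℂ → ℂ × ℂ) :=
  ⟨id, contMDiffAt_id, contMDiffAt_id, by simp, by simp⟩

/-- The inverse function theorem. -/
lemma isParam_of_fderiv_injective {β : ℂ × ℂ → ℂ × ℂ} (h : AnalyticAt ℂ β 0)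
    (hi : ∀ z, fderiv ℂ β 0 z = 0 → z = 0) : IsParam β := by
  have hinj : Function.Injective (fderiv ℂ β 0 : ℂ × ℂ →ₗ[ℂ] ℂ × ℂ) := by
    rw [← LinearMap.ker_eq_bot, LinearMap.ker_eq_bot']
    exact hi
  let L : (ℂ × ℂ) ≃L[ℂ] (ℂ × ℂ) :=
    (LinearEquiv.ofInjectiveEndo (fderiv ℂ β 0 : ℂ × ℂ →ₗ[ℂ] ℂ × ℂ) hinj).toContinuousLinearEquiv
  have hL : (L : ℂ × ℂ →L[ℂ] ℂ × ℂ) = fderiv ℂ β 0 := by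
    ext <;> rfl
  have hc : ContDiffAt ℂ ω β 0 := h.contDiffAt
  have hd : HasFDerivAt β (L : ℂ × ℂ →L[ℂ] ℂ × ℂ) 0 := by
    rw [hL]
    exact h.differentiableAt.hasFDerivAt
  have hs : HasStrictFDerivAt β (L : ℂ × ℂ →L[ℂ] ℂ × ℂ) 0 := hc.hasStrictFDerivAt' hd (by simp)
  refine ⟨hc.localInverse hd (by simp), hol_iff_analyticAt.2 h, ?_, ?_, ?_⟩
  · rw [hol_iff_analyticAt]
    exact (hc.to_localInverse hd (by simp)).analyticAt
  · exact hs.eventually_left_inverse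
  · exact hs.eventually_right_inverse

lemma IsParam.fderiv_injective {β : ℂ × ℂ → ℂ × ℂ} (h : IsParam β) {z : ℂ × ℂ}
    (hz : fderiv ℂ β 0 z = 0) : z = 0 := by
  obtain ⟨τ, g1, g2, g3, g4⟩ := h
  have d1 := (hol_iff_analyticAt.1 g1).differentiableAt.hasFDerivAt
  have d2 := (hol_iff_analyticAt.1 g2).differentiableAt.hasFDerivAt
  have d3 := (d2.comp (0 : ℂ × ℂ) d1).congr_of_eventuallyEq
    (f₁ := id) (by filter_upwards [g3] with w hw; simp [hw])
  have := congrArg (fun A : ℂ × ℂ →L[ℂ] ℂ × ℂ => A z) (d3.unique (hasFDerivAt_id _))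
  simpa [hz] using this.symm

end Param

/-! ### Charts of the blown-up plane and lifting of coordinate changes -/

/-- The blowing-up map of the origin of `ℂ²` in the chart centred at the direction `d`. -/
def kap (d : OnePoint ℂ) (w : ℂ × ℂ) : ℂ × ℂ :=
  d.elim (w.1 * w.2, w.2) (fun s => (w.1, w.1 * (w.2 + s)))

@[simp] lemma kap_infty (w : ℂ × ℂ) : kap OnePoint.infty w = (w.1 * w.2, w.2) := rfl
@[simp] lemma kap_coe (s : ℂ) (w : ℂ × ℂ) : kap (s : OnePoint ℂ) w = (w.1, w.1 * (w.2 + s)) := rfl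

lemma kap_zero (d : OnePoint ℂ) : kap d 0 = 0 := by
  induction d using OnePoint.rec <;> simp

/-- The exceptional coordinate of the chart at the direction `d`. -/
def kapExc (d : OnePoint ℂ) (w : ℂ × ℂ) : ℂ := d.elim w.2 (fun _ => w.1)

/-- The direction vector, as a function on the chart at the direction `d`. -/
def kapVec (d : OnePoint ℂ) (w : ℂ × ℂ) : ℂ × ℂ := d.elim (w.1, 1) (fun s => (1, w.2 + s))

/-- The homogeneous form of the blowing-up: the exceptional equation times a nowhere zero direction
vector. It allows both types of charts to be treated together. -/
lemma kap_eq_smul (d : OnePoint ℂ) (w : ℂ × ℂ) : kap d w = kapExc d w • kapVec d w := by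
  induction d using OnePoint.rec <;> simp [kapExc, kapVec, mul_comm]

lemma analyticAt_fst {z : ℂ × ℂ} : AnalyticAt ℂ (fun w : ℂ × ℂ => w.1) z :=
  (ContinuousLinearMap.fst ℂ ℂ ℂ).analyticAt z

lemma analyticAt_snd {z : ℂ × ℂ} : AnalyticAt ℂ (fun w : ℂ × ℂ => w.2) z :=
  (ContinuousLinearMap.snd ℂ ℂ ℂ).analyticAt z

lemma analyticAt_kap (d : OnePoint ℂ) (z : ℂ × ℂ) : AnalyticAt ℂ (kap d) z := by
  induction d using OnePoint.rec with
  | infty => exact (analyticAt_fst.mul analyticAt_snd).prod analyticAt_snd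
  | coe s => exact analyticAt_fst.prod (analyticAt_fst.mul (analyticAt_snd.add analyticAt_const))

lemma tendsto_kap (d : OnePoint ℂ) : Tendsto (kap d) (𝓝 0) (𝓝 0) := by
  simpa [ContinuousAt, kap_zero] using (analyticAt_kap d 0).continuousAt

lemma analyticAt_kapExc (d : OnePoint ℂ) (z : ℂ × ℂ) : AnalyticAt ℂ (kapExc d) z := by
  induction d using OnePoint.rec with
  | infty => exact analyticAt_snd
  | coe s => exact analyticAt_fst

lemma analyticAt_kapVec (d : OnePoint ℂ) (z : ℂ × ℂ) : AnalyticAt ℂ (kapVec d) z := by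
  induction d using OnePoint.rec with
  | infty => exact analyticAt_fst.prod analyticAt_const
  | coe s => exact analyticAt_const.prod (analyticAt_snd.add analyticAt_const)

lemma isParam_swap : IsParam (Prod.swap : ℂ × ℂ → ℂ × ℂ) :=
  ⟨Prod.swap, hol_iff_analyticAt.2 (analyticAt_snd.prod analyticAt_fst),
    hol_iff_analyticAt.2 (analyticAt_snd.prod analyticAt_fst), by simp, by simp⟩

lemma kapVec_ne_zero (d : OnePoint ℂ) (z : ℂ × ℂ) : kapVec d z ≠ 0 := by
  induction d using OnePoint.rec <;> simp [kapVec]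

lemma kapExc_zero (d : OnePoint ℂ) : kapExc d 0 = 0 := by
  induction d using OnePoint.rec <;> simp [kapExc]

/-- Write β z = L z z. Then β ∘ kap d is the exceptional coordinate times W w = L (kap d w) (kapVec
d w), and W 0 is the image of the direction d under the derivative of β. If W₁ does not vanish at 0,
the new coordinates are the exceptional coordinate times W₁ and the slope W₂ / W₁, centred at 0. -/
lemma IsParam.exists_comp_kap_aux {β : ℂ × ℂ → ℂ × ℂ} (h : IsParam β) (h0 : β 0 = 0)
    (d : OnePoint ℂ) (hP : (fderiv ℂ β 0 (kapVec d 0)).1 ≠ 0) :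
    ∃ β' : ℂ × ℂ → ℂ × ℂ, IsParam β' ∧ β' 0 = 0 ∧ β ∘ kap d =ᶠ[𝓝 0]
      kap (((fderiv ℂ β 0 (kapVec d 0)).2 / (fderiv ℂ β 0 (kapVec d 0)).1 : ℂ) : OnePoint ℂ) ∘
        β' := by
  obtain ⟨L, hL, hβL⟩ := AnalyticAt.exists_clm_apply (hol_iff_analyticAt.1 h.hol) h0
  have hL0 : fderiv ℂ β 0 = L 0 := by
    have h1 := hL.differentiableAt.hasFDerivAt.clm_apply (hasFDerivAt_id (𝕜 := ℂ) (0 : ℂ × ℂ))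
    have h2 := h1.congr_of_eventuallyEq hβL
    rw [h2.fderiv]
    ext <;> simp
  rw [hL0] at hP ⊢
  have hLk : AnalyticAt ℂ (fun w => L (kap d w)) 0 :=
    AnalyticAt.fun_comp (by rwa [kap_zero]) (analyticAt_kap d 0)
  set W : ℂ × ℂ → ℂ × ℂ := fun w => L (kap d w) (kapVec d w) with hW
  have hWa : AnalyticAt ℂ W 0 := (hLk.contDiffAt.clm_apply (analyticAt_kapVec d 0).contDiffAt).analyticAt
  have hW0 : W 0 = L 0 (kapVec d 0) := by simp [hW, kap_zero]
  rw [← hW0] at hP ⊢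
  have hW1 : AnalyticAt ℂ (fun w => (W w).1) 0 := analyticAt_fst.comp hWa
  have hW2 : AnalyticAt ℂ (fun w => (W w).2) 0 := analyticAt_snd.comp hWa
  refine ⟨fun w => (kapExc d w * (W w).1, (W w).2 / (W w).1 - (W 0).2 / (W 0).1), ?_, ?_, ?_⟩
  · refine isParam_of_fderiv_injective (((analyticAt_kapExc d 0).mul hW1).prod
      ((hW2.div hW1 hP).sub analyticAt_const)) fun v hv => ?_
    have dE := (analyticAt_kapExc d 0).differentiableAt.hasFDerivAt
    have dV := (analyticAt_kapVec d 0).differentiableAt.hasFDerivAt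
    have dW := hWa.differentiableAt.hasFDerivAt
    have dK : HasFDerivAt (kap d) (fderiv ℂ (kap d) 0) 0 :=
      (analyticAt_kap d 0).differentiableAt.hasFDerivAt
    have dL : HasFDerivAt L (fderiv ℂ L 0) (kap d 0) := by
      rw [kap_zero]
      exact hL.differentiableAt.hasFDerivAt
    have dK' : fderiv ℂ (kap d) 0 v = fderiv ℂ (kapExc d) 0 v • kapVec d 0 := by
      have := dE.smul dV
      have h2 := this.congr_of_eventuallyEq (Eventually.of_forall (kap_eq_smul d))
      rw [h2.fderiv]
      simp [kapExc_zero]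
    have dW' : fderiv ℂ W 0 v = fderiv ℂ L 0 (fderiv ℂ (kap d) 0 v) (kapVec d 0) +
        L 0 (fderiv ℂ (kapVec d) 0 v) := by
      have := (dL.comp (0 : ℂ × ℂ) dK).clm_apply dV
      have h2 : fderiv ℂ W 0 = _ := this.fderiv
      rw [h2]
      simp [kap_zero, add_comm]
    have dW1 : HasFDerivAt (fun w => (W w).1) _ 0 := dW.fst
    have dW2 : HasFDerivAt (fun w => (W w).2) _ 0 := dW.snd
    set Q : ℂ × ℂ → ℂ := fun w => (W w).2 / (W w).1 with hQ
    have dQ : HasFDerivAt Q (fderiv ℂ Q 0) 0 := (hW2.div hW1 hP).differentiableAt.hasFDerivAt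
    have key := ((dE.mul dW1).prodMk (dQ.sub_const ((W 0).2 / (W 0).1))).fderiv
    have hv' := congrArg (fun A : ℂ × ℂ →L[ℂ] ℂ × ℂ => A v) key.symm
    have hv1 : fderiv ℂ (kapExc d) 0 v = 0 := by
      have := (congrArg Prod.fst hv').trans (congrArg Prod.fst hv)
      simpa [kapExc_zero, hP] using this
    have hv2 : fderiv ℂ Q 0 v = 0 := by
      have := (congrArg Prod.snd hv').trans (congrArg Prod.snd hv)
      simpa using this
    rw [hv1, zero_smul] at dK'
    rw [dK'] at dW'
    simp only [map_zero, zero_apply, zero_add] at dW'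
    have hQW : (fun w => (W w).2) =ᶠ[𝓝 0] fun w => Q w * (W w).1 := by
      filter_upwards [hW1.continuousAt.eventually_ne hP] with w hw
      simp [hQ, hw]
    have h3 := congrArg (fun A : ℂ × ℂ →L[ℂ] ℂ => A v)
      (dW2.unique ((dQ.mul dW1).congr_of_eventuallyEq hQW))
    have h4 : (fderiv ℂ W 0 v).2 = Q 0 * (fderiv ℂ W 0 v).1 + (W 0).1 * fderiv ℂ Q 0 v := by
      simpa using h3
    rw [hv2, mul_zero, add_zero] at h4
    -- Along a kernel vector `v` the slope of W is stationary, so dW(v) is proportional to W 0. As L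
    -- 0 is injective, the derivative of the direction vector along `v` is proportional to the
    -- direction vector; one coordinate of the latter is constantly 1, so that derivative is zero.
    have h5 : L 0 ((W 0).1 • fderiv ℂ (kapVec d) 0 v - (fderiv ℂ W 0 v).1 • kapVec d 0) = 0 := by
      rw [map_sub, map_smul, map_smul, ← dW', ← hW0]
      ext
      · simp [mul_comm]
      · simp only [Prod.snd_sub, Prod.smul_snd, smul_eq_mul, h4, hQ, Prod.snd_zero]
        field_simp
        ring
    rw [← hL0] at h5
    have h6 := h.fderiv_injective h5
    induction d using OnePoint.rec with
    | infty =>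
      have e1 : HasFDerivAt (kapVec OnePoint.infty)
          ((ContinuousLinearMap.fst ℂ ℂ ℂ).prod 0) 0 :=
        hasFDerivAt_fst.prodMk (hasFDerivAt_const _ _)
      have e2 : HasFDerivAt (kapExc OnePoint.infty) (ContinuousLinearMap.snd ℂ ℂ ℂ) 0 :=
        hasFDerivAt_snd
      rw [e1.fderiv] at h6
      rw [e2.fderiv] at hv1
      have a1 := congrArg Prod.fst h6
      have a2 := congrArg Prod.snd h6
      simp only [kapVec, OnePoint.elim_infty, Prod.snd_sub, Prod.fst_sub, Prod.smul_fst,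
        Prod.smul_snd] at a1 a2
      simp at a1 a2
      simp [hP] at a1
      exact Prod.ext a1 hv1
    | coe s =>
      have e1 : HasFDerivAt (kapVec (s : OnePoint ℂ))
          ((0 : ℂ × ℂ →L[ℂ] ℂ).prod (ContinuousLinearMap.snd ℂ ℂ ℂ)) 0 :=
        (hasFDerivAt_const _ _).prodMk (hasFDerivAt_snd.add_const _)
      have e2 : HasFDerivAt (kapExc (s : OnePoint ℂ)) (ContinuousLinearMap.fst ℂ ℂ ℂ) 0 :=
        hasFDerivAt_fst
      rw [e1.fderiv] at h6
      rw [e2.fderiv] at hv1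
      have a1 := congrArg Prod.fst h6
      have a2 := congrArg Prod.snd h6
      simp [kapVec] at a1
      simp [kapVec, hP, a1] at a2
      exact Prod.ext hv1 a2
  · simp [kapExc_zero]
  · have hne : ∀ᶠ w in 𝓝 0, (W w).1 ≠ 0 := hW1.continuousAt.eventually_ne hP
    filter_upwards [hne, (tendsto_kap d).eventually hβL] with w hw hw'
    simp only [Function.comp_apply, kap_coe, sub_add_cancel]
    rw [hw']
    conv_lhs => rw [kap_eq_smul d w, map_smul, ← kap_eq_smul d w]
    ext
    · simp [hW]
    · simp only [hW, Prod.smul_snd, smul_eq_mul] at hw ⊢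
      field_simp

/-- A change of coordinates lifts to the blowing-up of the origin. -/
lemma IsParam.exists_comp_kap {β : ℂ × ℂ → ℂ × ℂ} (h : IsParam β) (h0 : β 0 = 0)
    (d : OnePoint ℂ) : ∃ d' : OnePoint ℂ, ∃ β' : ℂ × ℂ → ℂ × ℂ, IsParam β' ∧ β' 0 = 0 ∧
      β ∘ kap d =ᶠ[𝓝 0] kap d' ∘ β' := by
  by_cases hP : (fderiv ℂ β 0 (kapVec d 0)).1 ≠ 0
  · exact ⟨_, h.exists_comp_kap_aux h0 d hP⟩
  rw [not_not] at hP
  -- The image direction is vertical: after exchanging the coordinates of the target its slope is 0.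
  have hs : IsParam (Prod.swap ∘ β) := isParam_swap.comp h h0
  have hne : fderiv ℂ β 0 (kapVec d 0) ≠ 0 := fun h1 => kapVec_ne_zero d 0 (h.fderiv_injective h1)
  have hfd : fderiv ℂ (Prod.swap ∘ β) 0 = (ContinuousLinearMap.snd ℂ ℂ ℂ |>.prod
      (ContinuousLinearMap.fst ℂ ℂ ℂ)).comp (fderiv ℂ β 0) :=
    (((ContinuousLinearMap.snd ℂ ℂ ℂ |>.prod
      (ContinuousLinearMap.fst ℂ ℂ ℂ)).hasFDerivAt).comp (0 : ℂ × ℂ)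
        (hol_iff_analyticAt.1 h.hol).differentiableAt.hasFDerivAt).fderiv
  have hP' : (fderiv ℂ (Prod.swap ∘ β) 0 (kapVec d 0)).1 ≠ 0 := by
    rw [hfd]
    exact fun h1 => hne (Prod.ext hP h1)
  obtain ⟨β', g1, g2, g3⟩ := hs.exists_comp_kap_aux (by simp [h0]) d hP'
  have h0' : (fderiv ℂ (Prod.swap ∘ β) 0 (kapVec d 0)).2 = 0 := by
    rw [hfd]
    exact hP
  rw [h0', zero_div] at g3
  refine ⟨OnePoint.infty, Prod.swap ∘ β', isParam_swap.comp g1 g2, by simp [g2], ?_⟩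
  filter_upwards [g3] with z hz
  simp only [Function.comp_apply, kap_coe, add_zero] at hz
  rw [Function.comp_apply, ← Prod.swap_swap (β (kap d z)), hz]
  simp [mul_comm]

end PointBlowup

/-! ### Local parametrizations of the blowing-up of a surface -/

namespace PointBlowup

open Filter

namespace Blowup

variable {M : Type}

/-- The inverse of the blowing-down map off the center. -/
def up (p : M) (x : M) : Blowup M p :=
  -- The value at the center is arbitrary; any exceptional point keeps `down_up` true everywhere.
  open Classical in if h : x = p then dir OnePoint.infty else away x h

lemma up_of_ne {p x : M} (h : x ≠ p) : up p x = away x h := dif_neg h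

lemma down_up {p : M} (x : M) : down (up p x) = x := by
  by_cases h : x = p
  · simp [up, h, down]
  · simp [up, h, down]

lemma up_down {p : M} {b : Blowup M p} (h : b.down ≠ p) : up p b.down = b := by
  cases b with
  | away x hx => exact up_of_ne hx
  | dir t => exact absurd rfl h

lemma down_eq_center {p : M} {b : Blowup M p} (h : b.down = p) : ∃ d, b = dir d := by
  cases b with
  | away x hx => exact absurd h hx
  | dir t => exact ⟨t, rfl⟩

end Blowup

section Surface

variable {M N K : Type} [TopologicalSpace M] [ChartedSpace (ℂ × ℂ) M]
  [TopologicalSpace N] [ChartedSpace (ℂ × ℂ) N]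

/-- Holomorphy can be tested in a parametrization. -/
lemma IsParam.hol_iff {γ : ℂ × ℂ → M} (h : IsParam γ) {f : M → N} :
    Hol f (γ 0) ↔ Hol (f ∘ γ) 0 := by
  constructor
  · intro hf
    exact ContMDiffAt.comp (0 : ℂ × ℂ) hf h.hol
  · intro hf
    obtain ⟨κ, h1, h2, h3, h4⟩ := h
    have hk : κ (γ 0) = 0 := h3.self_of_nhds
    have : Hol ((f ∘ γ) ∘ κ) (γ 0) := ContMDiffAt.comp _ (by rwa [hk]) h2
    refine this.congr_of_eventuallyEq ?_
    filter_upwards [h4] with q hq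
    simp [hq]

lemma IsParam.eventually_iff {γ : ℂ × ℂ → M} (h : IsParam γ) {P : M → Prop} :
    (∀ᶠ q in 𝓝 (γ 0), P q) ↔ ∀ᶠ z in 𝓝 0, P (γ z) := by
  constructor
  · intro hP
    exact h.hol.continuousAt.eventually hP
  · intro hP
    obtain ⟨κ, h1, h2, h3, h4⟩ := h
    have hk : κ (γ 0) = 0 := h3.self_of_nhds
    have hk' : Tendsto κ (𝓝 (γ 0)) (𝓝 0) := by
      have := h2.continuousAt
      rwa [ContinuousAt, hk] at this
    filter_upwards [h4, hk'.eventually hP] with q hq hq'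
    rwa [hq] at hq'

lemma IsParam.eventually_eq_iff {γ : ℂ × ℂ → M} (h : IsParam γ) :
    ∀ᶠ z in 𝓝 0, γ z = γ 0 ↔ z = 0 := by
  obtain ⟨κ, h1, h2, h3, h4⟩ := h
  filter_upwards [h3] with z hz
  constructor
  · intro h
    rw [← hz, h, h3.self_of_nhds]
  · rintro rfl
    rfl

/-- A germ of map into `M` factors through a parametrization. -/
lemma IsParam.exists_factor {γ : ℂ × ℂ → M} (h : IsParam γ) {G : ℂ × ℂ → M} (hG : Hol G 0)
    (h0 : G 0 = γ 0) : ∃ ψ : ℂ × ℂ → ℂ × ℂ, AnalyticAt ℂ ψ 0 ∧ ψ 0 = 0 ∧ G =ᶠ[𝓝 0] γ ∘ ψ := by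
  obtain ⟨κ, h1, h2, h3, h4⟩ := h
  have hk : κ (γ 0) = 0 := h3.self_of_nhds
  refine ⟨κ ∘ G, hol_iff_analyticAt.1 (ContMDiffAt.comp (0 : ℂ × ℂ) (by rwa [h0]) hG), ?_, ?_⟩
  · simp [h0, hk]
  · have : Tendsto G (𝓝 0) (𝓝 (γ 0)) := by
      have := hG.continuousAt
      rwa [ContinuousAt, h0] at this
    filter_upwards [this.eventually h4] with z hz
    simp [hz]

namespace Blowup

lemma down_chartX_symm {p : M} {w : ℂ × ℂ} :
    down ((chartX p).symm w) = point p (w.1, w.1 * w.2) := by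
  by_cases h : point p (w.1, w.1 * w.2) = p
  · rw [show (chartX p).symm w = _ from dif_pos h]
    exact h.symm
  · rw [show (chartX p).symm w = _ from dif_neg h]
    rfl

lemma down_chartY_symm {p : M} {w : ℂ × ℂ} :
    down ((chartY p).symm w) = point p (w.1 * w.2, w.2) := by
  by_cases h : point p (w.1 * w.2, w.2) = p
  · rw [show (chartY p).symm w = _ from dif_pos h]
    exact h.symm
  · rw [show (chartY p).symm w = _ from dif_neg h]
    rfl

end Blowup

variable [IsManifold 𝓘(ℂ, ℂ × ℂ) ω M]

/-- The preferred chart gives a parametrization. -/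
lemma isParam_point (q : M) : IsParam (Blowup.point q) := by
  have h0 : Blowup.point q 0 = q := Blowup.point_zero q
  refine ⟨Blowup.coord q, ?_, ?_, ?_, ?_⟩
  · have h1 : Hol (fun z : ℂ × ℂ => z + chartAt (ℂ × ℂ) q q) 0 :=
      hol_iff_analyticAt.2 (analyticAt_id.add analyticAt_const)
    have h2 : Hol (chartAt (ℂ × ℂ) q).symm (0 + chartAt (ℂ × ℂ) q q) := by
      rw [zero_add]
      exact contMDiffOn_chart_symm.contMDiffAt
        ((chartAt (ℂ × ℂ) q).open_target.mem_nhds (mem_chart_target _ q))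
    exact ContMDiffAt.comp (0 : ℂ × ℂ) h2 h1
  · rw [h0]
    have h1 : Hol (fun z : ℂ × ℂ => z - chartAt (ℂ × ℂ) q q) (chartAt (ℂ × ℂ) q q) :=
      hol_iff_analyticAt.2 (analyticAt_id.sub analyticAt_const)
    have h2 : Hol (chartAt (ℂ × ℂ) q) q :=
      contMDiffOn_chart.contMDiffAt
        ((chartAt (ℂ × ℂ) q).open_source.mem_nhds (mem_chart_source _ q))
    exact ContMDiffAt.comp q h1 h2
  · filter_upwards [(Blowup.isOpen_dom q).mem_nhds (Blowup.zero_mem_dom q)] with z hz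
    exact Blowup.coord_point hz
  · rw [h0]
    filter_upwards [(chartAt (ℂ × ℂ) q).open_source.mem_nhds (mem_chart_source _ q)] with x hx
    exact Blowup.point_coord hx

namespace Blowup

lemma coe_chartAt {p : M} (b : Blowup M p) :
    (chartAt (ℂ × ℂ) b : Blowup M p → ℂ × ℂ) = prefChart b := rfl

lemma coe_chartAt_symm {p : M} (b : Blowup M p) :
    ((chartAt (ℂ × ℂ) b).symm : ℂ × ℂ → Blowup M p) = (prefChart b).symm := rfl

lemma chartAt_source {p : M} (b : Blowup M p) :
    (chartAt (ℂ × ℂ) b).source = (prefChart b).source := rfl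

lemma chartAt_target {p : M} (b : Blowup M p) :
    (chartAt (ℂ × ℂ) b).target = (prefChart b).target := rfl

/-- The summand `s` in `kap s` comes from centring the chart at `dir s`; the chart at ∞ is already
centred. -/
lemma down_point_dir {p : M} (d : OnePoint ℂ) (z : ℂ × ℂ) :
    down (point (dir d : Blowup M p) z) = point p (kap d z) := by
  induction d using OnePoint.rec with
  | infty =>
    have : point (dir OnePoint.infty : Blowup M p) z = (chartY p).symm (z + (0, 0)) := by
      simp only [point, coe_chartAt, coe_chartAt_symm, prefChart]
      rfl
    rw [this, down_chartY_symm]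
    simp
  | coe s =>
    have : point (dir s : Blowup M p) z = (chartX p).symm (z + (0, s)) := by
      have h1 : prefChart (dir (s : OnePoint ℂ) : Blowup M p) = chartX p := by
        simp [prefChart]
      simp only [point, coe_chartAt, coe_chartAt_symm, h1]
      rfl
    rw [this, down_chartX_symm]
    simp

lemma point_away {p x : M} (hx : x ≠ p) (z : ℂ × ℂ) :
    point (away x hx : Blowup M p) z = up p (point x z) := by
  rfl

lemma hol_down {p : M} (b : Blowup M p) : Hol (down : Blowup M p → M) b := by
  rw [← point_zero b, (isParam_point b).hol_iff]
  cases b with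
  | dir d =>
    have : (down ∘ point (dir d : Blowup M p)) = point p ∘ kap d := funext (down_point_dir d)
    rw [this]
    exact ContMDiffAt.comp (0 : ℂ × ℂ) (by rw [kap_zero]; exact (isParam_point p).hol)
      (hol_iff_analyticAt.2 (analyticAt_kap d 0))
  | away x hx =>
    have : (down ∘ point (away x hx : Blowup M p)) = point x := by
      funext z
      rw [Function.comp_apply, point_away, down_up]
    rw [this]
    exact (isParam_point x).hol

lemma continuous_down {p : M} : Continuous (down : Blowup M p → M) :=
  continuous_iff_continuousAt.2 fun b => (hol_down b).continuousAt

lemma hol_up {p x : M} (hx : x ≠ p) : Hol (up p) x := by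
  rw [← point_zero x, (isParam_point x).hol_iff]
  have : up p ∘ point x = point (away x hx : Blowup M p) := funext fun z => (point_away hx z).symm
  rw [this]
  exact (isParam_point _).hol

end Blowup

open Blowup

/-- A parametrization off the center lifts. -/
lemma IsParam.up {p : M} [T1Space M] {γ : ℂ × ℂ → M} (h : IsParam γ) (h0 : γ 0 ≠ p) :
    IsParam (Blowup.up p ∘ γ) := by
  obtain ⟨κ, h1, h2, h3, h4⟩ := h
  have hd : Blowup.down (Blowup.up p (γ 0)) = γ 0 := down_up _
  refine ⟨κ ∘ Blowup.down, ContMDiffAt.comp (0 : ℂ × ℂ) (hol_up h0) h1, ?_, ?_, ?_⟩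
  · exact ContMDiffAt.comp _ (by rw [Function.comp_apply, hd]; exact h2) (hol_down _)
  · simpa [down_up] using h3
  · have h5 : Tendsto (Blowup.down : Blowup M p → M) (𝓝 (Blowup.up p (γ 0))) (𝓝 (γ 0)) := by
      have := continuous_down.continuousAt (x := Blowup.up p (γ 0))
      rwa [ContinuousAt, hd] at this
    simp only [Function.comp_apply]
    filter_upwards [h5.eventually h4, h5.eventually_ne h0] with b hb hb'
    rw [hb, up_down hb']

/-- Every point of the exceptional line has a parametrization which is a blowing-up chart with
respect to a given parametrization at the center. -/
lemma IsParam.exists_dir {p : M} {γ : ℂ × ℂ → M} (h : IsParam γ) (hp : γ 0 = p)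
    (b : Blowup M p) (hb : b.down = p) : ∃ d : OnePoint ℂ, ∃ γ' : ℂ × ℂ → Blowup M p, IsParam γ' ∧
      γ' 0 = b ∧ Blowup.down ∘ γ' =ᶠ[𝓝 0] γ ∘ kap d := by
  subst hp
  obtain ⟨d', rfl⟩ := down_eq_center hb
  -- `β` compares γ with the preferred coordinates at the center. Its lift sends the direction `d'`
  -- to `d`, and the inverse `τ` of the lift corrects the preferred parametrization at `dir d'`.
  obtain ⟨β, b1, b2, b3⟩ := h.exists_comp (isParam_point (γ 0)) (point_zero _)
  obtain ⟨d, β', c1, c2, c3⟩ := b1.exists_comp_kap b2 d'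
  obtain ⟨τ, t1, t2, t3, t4⟩ := c1.exists_inv c2
  have ht : Tendsto τ (𝓝 0) (𝓝 0) := by
    have := t1.hol.continuousAt
    rwa [ContinuousAt, t2] at this
  refine ⟨d, point (dir d' : Blowup M (γ 0)) ∘ τ, (isParam_point _).comp t1 t2, ?_, ?_⟩
  · simp [t2, point_zero]
  · filter_upwards [t4, ht.eventually c3, ((tendsto_kap d').comp ht).eventually b3] with z h1 h2 h3
    simp only [Function.comp_apply] at h1 h2 h3 ⊢
    rw [down_point_dir, h3, h2, h1]

/-- Every blowing-up chart with respect to a given parametrization at the center is a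
parametrization of the blowing-up. -/
lemma IsParam.exists_lift_kap {p : M} {γ : ℂ × ℂ → M} (h : IsParam γ) (hp : γ 0 = p)
    (d : OnePoint ℂ) :
    ∃ γ' : ℂ × ℂ → Blowup M p, IsParam γ' ∧ Blowup.down ∘ γ' =ᶠ[𝓝 0] γ ∘ kap d := by
  subst hp
  obtain ⟨β, b1, b2, b3⟩ := (isParam_point (γ 0)).exists_comp h (point_zero _).symm
  obtain ⟨d', β', c1, c2, c3⟩ := b1.exists_comp_kap b2 d
  refine ⟨point (dir d' : Blowup M (γ 0)) ∘ β', (isParam_point _).comp c1 c2, ?_⟩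
  filter_upwards [c3, (tendsto_kap d).eventually b3] with z h2 h3
  simp only [Function.comp_apply] at h2 h3 ⊢
  rw [down_point_dir, h3, h2]

end Surface

end PointBlowup

/-! ### Topology of the blowing-up: separation, properness, density -/

namespace PointBlowup

open Filter

namespace Blowup

variable {M : Type}

lemma preimage_down_center (p : M) :
    (down : Blowup M p → M) ⁻¹' {p} = Set.range (dir : OnePoint ℂ → Blowup M p) := by
  ext b
  constructor
  · intro hb
    obtain ⟨d, rfl⟩ := down_eq_center hb
    exact ⟨d, rfl⟩
  · rintro ⟨d, rfl⟩
    rfl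

lemma preimage_down_of_ne {p y : M} (hy : y ≠ p) :
    (down : Blowup M p → M) ⁻¹' {y} = {up p y} := by
  ext b
  simp only [Set.mem_preimage, Set.mem_singleton_iff]
  constructor
  · rintro rfl
    exact (up_down hy).symm
  · rintro rfl
    exact down_up y

variable [TopologicalSpace M] [ChartedSpace (ℂ × ℂ) M]

lemma prefChart_coe {p : M} (s : ℂ) : prefChart (dir (s : OnePoint ℂ) : Blowup M p) = chartX p := by
  simp [prefChart]

lemma prefChart_infty {p : M} : prefChart (dir OnePoint.infty : Blowup M p) = chartY p := by
  simp [prefChart]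

lemma tendsto_coord (p : M) : Tendsto (coord p) (𝓝 p) (𝓝 0) := by
  have h2 : ContinuousAt (coord p) p :=
    ((chartAt (ℂ × ℂ) p).continuousAt (mem_chart_source _ p)).sub continuousAt_const
  rwa [ContinuousAt, coord_self] at h2

variable [IsManifold 𝓘(ℂ, ℂ × ℂ) ω M]

lemma separated_by_chart {p : M} {x y b : Blowup M p} (hx : x ∈ (chartAt (ℂ × ℂ) b).source)
    (hy : y ∈ (chartAt (ℂ × ℂ) b).source) (h : x ≠ y) :
    ∃ u v : Set (Blowup M p), IsOpen u ∧ IsOpen v ∧ x ∈ u ∧ y ∈ v ∧ Disjoint u v := by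
  set e := chartAt (ℂ × ℂ) b
  obtain ⟨U, V, hU, hV, hxU, hyV, hUV⟩ := t2_separation (e.injOn.ne hx hy h)
  refine ⟨_, _, e.isOpen_inter_preimage hU, e.isOpen_inter_preimage hV, ⟨hx, hxU⟩, ⟨hy, hyV⟩, ?_⟩
  exact (hUV.preimage e).mono Set.inter_subset_right Set.inter_subset_right

/-- These are the only two directions without a common chart; the regions |y / x| < 1 and |x / y| <
1 separate them. -/
lemma separated_zero_infty (p : M) : ∃ u v : Set (Blowup M p), IsOpen u ∧ IsOpen v ∧
    dir (0 : ℂ) ∈ u ∧ dir OnePoint.infty ∈ v ∧ Disjoint u v := by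
  set e := chartAt (ℂ × ℂ) (dir (0 : ℂ) : Blowup M p) with he
  set e' := chartAt (ℂ × ℂ) (dir OnePoint.infty : Blowup M p) with he'
  have hU : IsOpen {w : ℂ × ℂ | ‖w.2‖ < 1} := isOpen_lt continuous_snd.norm continuous_const
  have hV : IsOpen {w : ℂ × ℂ | ‖w.1‖ < 1} := isOpen_lt continuous_fst.norm continuous_const
  refine ⟨_, _, e.isOpen_inter_preimage hU, e'.isOpen_inter_preimage hV,
    ⟨mem_chart_source _ _, ?_⟩, ⟨mem_chart_source _ _, ?_⟩, ?_⟩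
  · simp [he, coe_chartAt, prefChart_coe, chartX]
  · simp [he', coe_chartAt, prefChart_infty, chartY]
  · rw [Set.disjoint_left]
    rintro b ⟨h1, h2⟩ ⟨h3, h4⟩
    rw [he, chartAt_source, prefChart_coe] at h1
    rw [he', chartAt_source, prefChart_infty] at h3
    simp only [he, he', coe_chartAt, prefChart_coe, prefChart_infty, Set.mem_preimage,
      Set.mem_ofPred_eq] at h2 h4
    cases b with
    | away x hx =>
      have k1 := (away_mem_chartX.1 h1).2
      have k2 := (away_mem_chartY.1 h3).2
      simp only [chartX, chartY, norm_div] at h2 h4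
      rw [div_lt_one (norm_pos_iff.2 k1)] at h2
      rw [div_lt_one (norm_pos_iff.2 k2)] at h4
      exact lt_asymm h2 h4
    | dir t =>
      induction t using OnePoint.rec with
      | infty => exact absurd rfl (dir_mem_chartX.1 h1)
      | coe s =>
        have hs : s ≠ 0 := fun hs => dir_mem_chartY.1 h3 (by rw [hs])
        simp only [chartX, chartY, finSlope_some, invSlope_some, norm_inv] at h2 h4
        exact lt_asymm h2 ((inv_lt_one₀ (norm_pos_iff.2 hs)).1 h4)

instance {p : M} [T2Space M] : T2Space (Blowup M p) := by
  refine ⟨fun x y hxy => ?_⟩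
  by_cases hd : x.down = y.down
  · cases x with
    | away x hx =>
      have h1 : y.down ≠ p := fun h => hx (hd.trans h)
      exact absurd ((up_down (b := away x hx) hx).symm.trans ((congrArg (up p) hd).trans
        (up_down h1))) hxy
    | dir t =>
      obtain ⟨t', rfl⟩ := down_eq_center hd.symm
      have hX : ∀ s : ℂ, (dir s : Blowup M p) ∈
          (chartAt (ℂ × ℂ) (dir (0 : ℂ) : Blowup M p)).source := by
        intro s
        rw [chartAt_source, prefChart_coe, dir_mem_chartX]
        exact OnePoint.coe_ne_infty _
      have hY : ∀ t : OnePoint ℂ, t ≠ (0 : ℂ) → (dir t : Blowup M p) ∈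
          (chartAt (ℂ × ℂ) (dir OnePoint.infty : Blowup M p)).source := by
        intro t ht
        rwa [chartAt_source, prefChart_infty, dir_mem_chartY]
      have hswap : ∀ s : ℂ, ∃ u v : Set (Blowup M p), IsOpen u ∧ IsOpen v ∧ dir s ∈ u ∧
          dir OnePoint.infty ∈ v ∧ Disjoint u v := by
        intro s
        by_cases hs : s = 0
        · exact hs ▸ separated_zero_infty p
        · exact separated_by_chart (hY s (by simpa using hs)) (hY _ (OnePoint.infty_ne_coe 0))
            (by simp)
      induction t using OnePoint.rec with
      | infty =>
        induction t' using OnePoint.rec with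
        | infty => exact absurd rfl hxy
        | coe s =>
          obtain ⟨u, v, h1, h2, h3, h4, h5⟩ := hswap s
          exact ⟨v, u, h2, h1, h4, h3, h5.symm⟩
      | coe s =>
        induction t' using OnePoint.rec with
        | infty => exact hswap s
        | coe s' => exact separated_by_chart (hX s) (hX s') hxy
  · exact separated_by_continuous continuous_down hd

/-- A neighbourhood of the exceptional line contains the preimage of a neighbourhood of the
center. -/
lemma eventually_forall_down {p : M} {O : Set (Blowup M p)} (hO : IsOpen O)
    (hE : ∀ d, dir d ∈ O) : ∀ᶠ x in 𝓝 p, ∀ b : Blowup M p, b.down = x → b ∈ O := by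
  -- The exceptional line is the union of two closed unit discs, |y / x| ≤ 1 and |x / y| ≤ 1. The
  -- tube lemma applies to each, and every point near the center satisfies |y| ≤ |x| or |x| ≤ |y|.
  have hX : ∀ᶠ u in 𝓝 (0 : ℂ), ∀ s ∈ Metric.closedBall (0 : ℂ) 1, (chartX p).symm (u, s) ∈ O := by
    refine (isCompact_closedBall _ _).eventually_forall_of_forall_eventually fun s _ => ?_
    have h1 := (chartAt (ℂ × ℂ) (dir (0 : ℂ) : Blowup M p)).symm.continuousAt (x := (0, s)) (by
      rw [OpenPartialHomeomorph.symm_source, chartAt_target, prefChart_coe]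
      have : ((0 : ℂ), (0 : ℂ)) ∈ dom p := zero_mem_dom p
      simpa [chartX] using this)
    rw [coe_chartAt_symm, prefChart_coe] at h1
    refine h1.eventually (hO.mem_nhds ?_)
    rw [chartX_symm_dir rfl]
    exact hE _
  have hY : ∀ᶠ u in 𝓝 (0 : ℂ), ∀ s ∈ Metric.closedBall (0 : ℂ) 1, (chartY p).symm (s, u) ∈ O := by
    refine (isCompact_closedBall _ _).eventually_forall_of_forall_eventually fun s _ => ?_
    have h1 := (chartAt (ℂ × ℂ) (dir OnePoint.infty : Blowup M p)).symm.continuousAt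
      (x := (s, 0)) (by
      rw [OpenPartialHomeomorph.symm_source, chartAt_target, prefChart_infty]
      have : ((0 : ℂ), (0 : ℂ)) ∈ dom p := zero_mem_dom p
      simpa [chartY] using this)
    rw [coe_chartAt_symm, prefChart_infty] at h1
    have h2 : Tendsto (fun z : ℂ × ℂ => (z.2, z.1)) (𝓝 (0, s)) (𝓝 (s, 0)) :=
      (continuous_snd.prodMk continuous_fst).tendsto _
    refine (Tendsto.comp h1 h2).eventually (hO.mem_nhds ?_)
    rw [chartY_symm_dir rfl]
    exact hE _
  have hc := tendsto_coord p
  have hc1 : Tendsto (fun x => (coord p x).1) (𝓝 p) (𝓝 0) := (continuous_fst.tendsto _).comp hc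
  have hc2 : Tendsto (fun x => (coord p x).2) (𝓝 p) (𝓝 0) := (continuous_snd.tendsto _).comp hc
  filter_upwards [hc1.eventually hX, hc2.eventually hY,
    (chartAt (ℂ × ℂ) p).open_source.mem_nhds (mem_chart_source _ p)] with x h1 h2 h3 b hb
  cases b with
  | dir d => exact hE d
  | away y hy =>
    obtain rfl : y = x := hb
    rcases le_total ‖(coord p y).2‖ ‖(coord p y).1‖ with h | h
    · have h0 : (coord p y).1 ≠ 0 := by
        intro h0
        have h0' : (coord p y).2 = 0 := by simpa [h0] using h
        apply hy
        rw [← point_coord h3, show coord p y = 0 from Prod.ext h0 h0', point_zero]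
      have hs : away y hy ∈ (chartX p).source := away_mem_chartX.2 ⟨h3, h0⟩
      rw [← (chartX p).left_inv hs]
      refine h1 _ ?_
      rw [mem_closedBall_zero_iff, norm_div]
      exact div_le_one_of_le₀ h (norm_nonneg _)
    · have h0 : (coord p y).2 ≠ 0 := by
        intro h0
        have h0' : (coord p y).1 = 0 := by simpa [h0] using h
        apply hy
        rw [← point_coord h3, show coord p y = 0 from Prod.ext h0' h0, point_zero]
      have hs : away y hy ∈ (chartY p).source := away_mem_chartY.2 ⟨h3, h0⟩
      rw [← (chartY p).left_inv hs]
      refine h2 _ ?_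
      rw [mem_closedBall_zero_iff, norm_div]
      exact div_le_one_of_le₀ h (norm_nonneg _)

lemma isCompact_range_dir (p : M) : IsCompact (Set.range (dir : OnePoint ℂ → Blowup M p)) := by
  set e := chartAt (ℂ × ℂ) (dir (0 : ℂ) : Blowup M p) with he
  set e' := chartAt (ℂ × ℂ) (dir OnePoint.infty : Blowup M p) with he'
  have h0 : ((0 : ℂ), (0 : ℂ)) ∈ dom p := zero_mem_dom p
  have h1 : IsCompact (e.symm '' ({0} ×ˢ Metric.closedBall 0 1)) := by
    refine (isCompact_singleton.prod (isCompact_closedBall _ _)).image_of_continuousOn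
      (e.continuousOn_symm.mono ?_)
    rintro ⟨u, v⟩ ⟨hu, -⟩
    obtain rfl : _ = (0 : ℂ) := hu
    rw [he, chartAt_target, prefChart_coe]
    simpa [chartX] using h0
  have h2 : IsCompact (e'.symm '' (Metric.closedBall 0 1 ×ˢ {0})) := by
    refine ((isCompact_closedBall _ _).prod isCompact_singleton).image_of_continuousOn
      (e'.continuousOn_symm.mono ?_)
    rintro ⟨u, v⟩ ⟨-, hu⟩
    obtain rfl : _ = (0 : ℂ) := hu
    rw [he', chartAt_target, prefChart_infty]
    simpa [chartY] using h0
  convert h1.union h2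
  rw [he, he', coe_chartAt_symm, coe_chartAt_symm, prefChart_coe, prefChart_infty]
  ext b
  constructor
  · rintro ⟨t, rfl⟩
    induction t using OnePoint.rec with
    | infty =>
      refine Or.inr ⟨(0, 0), by simp, ?_⟩
      rw [chartY_symm_dir rfl]
      simp [slopeInv]
    | coe s =>
      rcases le_total ‖s‖ 1 with h | h
      · refine Or.inl ⟨(0, s), by simpa using h, ?_⟩
        rw [chartX_symm_dir rfl]
      · have hs : s ≠ 0 := by
          rintro rfl
          simp at h
          linarith
        refine Or.inr ⟨(s⁻¹, 0), by simpa using inv_le_one_of_one_le₀ h, ?_⟩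
        rw [chartY_symm_dir rfl]
        simp [slopeInv, hs]
  · rintro (⟨⟨u, v⟩, ⟨hu, -⟩, rfl⟩ | ⟨⟨u, v⟩, ⟨-, hu⟩, rfl⟩)
    · exact ⟨_, (chartX_symm_dir hu).symm⟩
    · exact ⟨_, (chartY_symm_dir hu).symm⟩

/-- Closedness is tested on neighbourhoods of fibres: over the center it is
`eventually_forall_down`, elsewhere the fibre is one point and `up` is a continuous local inverse.
-/
lemma isProperMap_down [T1Space M] (p : M) : IsProperMap (down : Blowup M p → M) := by
  refine isProperMap_iff_isClosedMap_and_compact_fibers.2 ⟨continuous_down, ?_, fun y => ?_⟩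
  · rw [isClosedMap_iff_comap_nhds_le]
    intro y
    by_cases hy : y = p
    · subst hy
      intro s hs
      rw [preimage_down_center, mem_nhdsSet_iff_exists] at hs
      obtain ⟨O, hO, hE, hs⟩ := hs
      rw [mem_comap]
      refine ⟨_, eventually_forall_down hO fun d => hE ⟨d, rfl⟩, fun b hb => hs (hb b rfl)⟩
    · rw [preimage_down_of_ne hy, nhdsSet_singleton]
      intro s hs
      rw [mem_comap]
      refine ⟨_, inter_mem ((hol_up hy).continuousAt.preimage_mem_nhds hs)
        (isOpen_ne.mem_nhds hy), ?_⟩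
      rintro b ⟨h1, h2⟩
      have h3 : up p b.down ∈ s := h1
      rwa [up_down h2] at h3
  · by_cases hy : y = p
    · rw [hy, preimage_down_center]
      exact isCompact_range_dir p
    · rw [preimage_down_of_ne hy]
      exact isCompact_singleton

lemma frequently_kap_ne_zero (d : OnePoint ℂ) : ∃ᶠ z in 𝓝 (0 : ℂ × ℂ), kap d z ≠ 0 := by
  have h1 : Tendsto (fun t : ℂ => (t, t)) (𝓝[≠] 0) (𝓝 (0 : ℂ × ℂ)) :=
    ((continuous_id.prodMk continuous_id).tendsto (0 : ℂ)).mono_left nhdsWithin_le_nhds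
  refine h1.frequently (Eventually.frequently ?_)
  filter_upwards [self_mem_nhdsWithin] with t ht
  have ht : t ≠ 0 := ht
  induction d using OnePoint.rec <;> simp [ht]

/-- The complement of the exceptional line is dense. -/
lemma dense_down_ne (p : M) : Dense {b : Blowup M p | b.down ≠ p} := by
  intro b
  by_cases hb : b.down = p
  · obtain ⟨d, γ, h1, rfl, h3⟩ := (isParam_point p).exists_dir (point_zero p) b hb
    rw [mem_closure_iff_frequently]
    refine h1.hol.continuousAt.frequently ?_
    have h4 := (tendsto_kap d).eventually (isParam_point p).eventually_eq_iff
    refine ((frequently_kap_ne_zero d).and_eventually (h3.and h4)).mono ?_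
    rintro z ⟨k1, k2, k3⟩
    rw [point_zero] at k3
    rw [Set.mem_ofPred_eq, show (γ z).down = _ from k2, Function.comp_apply, Ne, k3]
    exact k1
  · exact subset_closure hb

end Blowup

end PointBlowup

/-! ### Modifications of ℂ² and pointwise existence of lifts -/

namespace PointBlowup

open Filter

/-- The properties of the map of a sequence of point blowing-ups to `ℂ²` used below. -/
structure IsModification (X : Surface) : Prop where
  nonempty : Nonempty X.carrier
  t2 : T2Space X.carrier
  hol : ∀ q, Hol X.proj q
  proper : IsProperMap X.proj
  inj : ∀ q q', X.proj q = X.proj q' → X.proj q ≠ 0 → q = q'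
  dense : Dense {q | X.proj q ≠ 0}

lemma isModification_plane : IsModification Surface.plane where
  nonempty := ⟨(0 : ℂ × ℂ)⟩
  t2 := inferInstanceAs (T2Space (ℂ × ℂ))
  hol _ := contMDiffAt_id
  proper := isProperMap_id
  inj _ _ h _ := h
  dense := dense_compl_singleton (0 : ℂ × ℂ)

lemma IsModification.blowup {X : Surface} (h : IsModification X) {c : X.carrier}
    (hc : X.proj c = 0) : IsModification (X.blowup c) := by
  have := h.t2
  refine ⟨⟨(Blowup.dir OnePoint.infty : Blowup X.carrier c)⟩,
    inferInstanceAs (T2Space (Blowup X.carrier c)), fun b => ?_, ?_, ?_, ?_⟩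
  · exact ContMDiffAt.comp (M := Blowup X.carrier c) (g := X.proj) (f := Blowup.down) b (h.hol _)
      (Blowup.hol_down b)
  · exact h.proper.comp (Blowup.isProperMap_down c)
  · intro (b : Blowup X.carrier c) (b' : Blowup X.carrier c) hb hb0
    have h1 := h.inj _ _ hb hb0
    have h2 : ∀ b : Blowup X.carrier c, X.proj b.down ≠ 0 → b.down ≠ c := by
      intro b hb h
      rw [h] at hb
      exact hb hc
    have h3 : b.down ≠ c := h2 b hb0
    have h4 : b'.down ≠ c := h1 ▸ h3
    rw [← Blowup.up_down h3, ← Blowup.up_down h4, h1]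
  · have h1 : {b : Blowup X.carrier c | b.down ≠ c} ⊆
        closure {b : Blowup X.carrier c | X.proj b.down ≠ 0} := by
      intro b hb
      rw [mem_closure_iff_frequently]
      have h2 := mem_closure_iff_frequently.1 (h.dense b.down)
      have h3 := (Blowup.hol_up hb).continuousAt
      rw [ContinuousAt, Blowup.up_down hb] at h3
      refine h3.frequently (h2.mono fun x hx => ?_)
      simpa [Blowup.down_up] using hx
    have h2 : Dense {b : Blowup X.carrier c | X.proj b.down ≠ 0} := by
      have := (Blowup.dense_down_ne c).mono h1
      rwa [dense_closure] at this
    exact h2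

lemma BlowupSeq.isModification {X : Surface} (s : BlowupSeq X) : IsModification X := by
  induction s with
  | nil => exact isModification_plane
  | cons s c hc ih => exact ih.blowup hc

/-- The map `π⁻¹ ∘ ρ`, where `π : X → ℂ²`, has no indeterminacy at the point `q` of `W`. -/
def LiftsAt (ρ : ℂ × ℂ → ℂ × ℂ) (X W : Surface) (q : W.carrier) : Prop :=
  ∃ f : W.carrier → X.carrier, Hol f q ∧ ∀ᶠ q' in 𝓝 q, X.proj (f q') = ρ (W.proj q')

variable {ρ : ℂ × ℂ → ℂ × ℂ} {X W : Surface}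

lemma Hol.eventually {M N : Type} [TopologicalSpace M] [ChartedSpace (ℂ × ℂ) M]
    [IsManifold 𝓘(ℂ, ℂ × ℂ) ω M] [TopologicalSpace N] [ChartedSpace (ℂ × ℂ) N]
    [IsManifold 𝓘(ℂ, ℂ × ℂ) ω N] {f : M → N} {q : M} (h : Hol f q) : ∀ᶠ q' in 𝓝 q, Hol f q' :=
  (contMDiffAt_iff_contMDiffAt_nhds (by simp)).1 h

lemma LiftsAt.eventually {q : W.carrier} (h : LiftsAt ρ X W q) :
    ∀ᶠ q' in 𝓝 q, LiftsAt ρ X W q' := by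
  obtain ⟨f, h1, h2⟩ := h
  filter_upwards [h1.eventually, h2.eventually_nhds] with q' h3 h4
  exact ⟨f, h3, h4⟩

/-- Off the fibre over 0 two lifts agree because `X.proj` is injective away from its zeros, and `hρ`
keeps their values away from these. Density of the complement of the fibre and separation of X do
the rest. -/
lemma IsModification.lift_unique (hX : IsModification X) (hW : IsModification W)
    (hρ : ∀ z, ρ z = 0 ↔ z = 0) {q : W.carrier} {f g : W.carrier → X.carrier}
    (hf : ContinuousAt f q) (hg : ContinuousAt g q)
    (hf' : ∀ᶠ q' in 𝓝 q, X.proj (f q') = ρ (W.proj q'))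
    (hg' : ∀ᶠ q' in 𝓝 q, X.proj (g q') = ρ (W.proj q')) : f q = g q := by
  have := hX.t2
  refine tendsto_nhds_unique_of_frequently_eq hf hg ?_
  refine ((mem_closure_iff_frequently.1 (hW.dense q)).and_eventually (hf'.and hg')).mono ?_
  rintro q' ⟨h1, h2, h3⟩
  refine hX.inj _ _ (h2.trans h3.symm) ?_
  rw [h2, Ne, hρ]
  exact h1

/-- By properness, a neighbourhood of the whole fibre contains the preimage of a neighbourhood of
the origin. -/
lemma IsModification.eventually_of_fibre (hW : IsModification W) {P : W.carrier → Prop}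
    (hP : ∀ q, W.proj q = 0 → ∀ᶠ q' in 𝓝 q, P q') :
    ∀ᶠ z in 𝓝 (0 : ℂ × ℂ), ∀ q, W.proj q = z → P q := by
  have h1 := isClosedMap_iff_comap_nhds_le.1 hW.proper.isClosedMap (y := 0)
  have h2 : {q | P q} ∈ 𝓝ˢ (W.proj ⁻¹' {0}) := by
    rw [mem_nhdsSet_iff_forall]
    exact fun q hq => hP q hq
  exact mem_comap'.1 (h1 h2)

/-- Elimination of indeterminacies can be checked point by point on the fibre. -/
lemma extends_of_liftsAt (hX : IsModification X) (hW : IsModification W)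
    (hρ : ∀ z, ρ z = 0 ↔ z = 0) (h : ∀ q, W.proj q = 0 → LiftsAt ρ X W q) : Extends ρ X W := by
  classical
  have := hX.nonempty
  -- A lift is chosen independently at each point. By uniqueness these choices agree near `q` with
  -- the single lift chosen at `q`, so the glued map is holomorphic.
  let f : W.carrier → X.carrier := fun q =>
    if hq : LiftsAt ρ X W q then hq.choose q else Classical.arbitrary _
  have hf : ∀ q, (hq : LiftsAt ρ X W q) → f q = hq.choose q := fun q hq => dif_pos hq
  suffices hP : ∀ q, W.proj q = 0 → ∀ᶠ q' in 𝓝 q, Hol f q' ∧ X.proj (f q') = ρ (W.proj q') from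
    ⟨f, (hW.eventually_of_fibre hP).mono fun z hz q hq => hq ▸ hz q hq⟩
  intro q hq
  filter_upwards [(h q hq).eventually] with q hq
  have h1 := hq.choose_spec
  have h2 : f =ᶠ[𝓝 q] hq.choose := by
    filter_upwards [hq.eventually, h1.1.eventually, h1.2.eventually_nhds] with q' h3 h4 h5
    rw [hf q' h3]
    exact hX.lift_unique hW hρ h3.choose_spec.1.continuousAt h4.continuousAt h3.choose_spec.2 h5
  exact ⟨h1.1.congr_of_eventuallyEq h2, by rw [hf q hq]; exact h1.2.self_of_nhds⟩

lemma liftsAt_of_extends (hW : IsModification W) (h : Extends ρ X W) {q : W.carrier}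
    (hq : W.proj q = 0) : LiftsAt ρ X W q := by
  obtain ⟨f, hf⟩ := h
  have h1 : Tendsto W.proj (𝓝 q) (𝓝 0) := by
    have := (hW.hol q).continuousAt
    rwa [ContinuousAt, hq] at this
  have h2 := h1.eventually hf
  exact ⟨f, (h2.self_of_nhds q rfl).1, h2.mono fun q' h => (h q' rfl).2⟩

lemma liftsAt_iff {γ : ℂ × ℂ → W.carrier} (hγ : IsParam γ) : LiftsAt ρ X W (γ 0) ↔
    ∃ G : ℂ × ℂ → X.carrier, Hol G 0 ∧ ∀ᶠ z in 𝓝 0, X.proj (G z) = ρ (W.proj (γ z)) := by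
  constructor
  · rintro ⟨f, h1, h2⟩
    exact ⟨f ∘ γ, hγ.hol_iff.1 h1, hγ.eventually_iff.1 h2⟩
  · rintro ⟨G, h1, h2⟩
    have hγ' := hγ
    obtain ⟨κ, g1, g2, g3, g4⟩ := hγ
    have h3 : ∀ᶠ z in 𝓝 0, G (κ (γ z)) = G z := g3.mono fun z hz => by rw [hz]
    refine ⟨G ∘ κ, hγ'.hol_iff.2 (h1.congr_of_eventuallyEq h3), hγ'.eventually_iff.2 ?_⟩
    filter_upwards [h2, h3] with z hz hz'
    rw [Function.comp_apply, hz', hz]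

lemma LiftsAt.of_blowup {c : X.carrier} {q : W.carrier} (h : LiftsAt ρ (X.blowup c) W q) :
    LiftsAt ρ X W q := by
  obtain ⟨f, h1, h2⟩ := h
  exact ⟨fun q => Blowup.down (f q), ContMDiffAt.comp (M' := Blowup X.carrier c) q
    (Blowup.hol_down _) h1, h2⟩

lemma Extends.of_blowup {c : X.carrier} (hX : IsModification X) (hW : IsModification W)
    (hρ : ∀ z, ρ z = 0 ↔ z = 0) (h : Extends ρ (X.blowup c) W) : Extends ρ X W :=
  extends_of_liftsAt hX hW hρ fun _ hq => (liftsAt_of_extends hW h hq).of_blowup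

/-- A lift whose value is not the center lifts to the blowing-up. -/
lemma liftsAt_blowup_of_ne {c : X.carrier} {q : W.carrier} {f : W.carrier → X.carrier}
    (h1 : Hol f q) (h2 : ∀ᶠ q' in 𝓝 q, X.proj (f q') = ρ (W.proj q')) (h3 : f q ≠ c) :
    LiftsAt ρ (X.blowup c) W q := by
  refine ⟨fun q => (Blowup.up c (f q) : Blowup X.carrier c),
    ContMDiffAt.comp (I'' := 𝓘(ℂ, ℂ × ℂ)) (M'' := Blowup X.carrier c) q (Blowup.hol_up h3) h1, ?_⟩
  filter_upwards [h2] with q' hq'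
  rw [← hq']
  exact congrArg X.proj (Blowup.down_up _)

end PointBlowup

/-! ### Composites of blowing-up charts and domination between sequences -/

namespace PointBlowup

open Filter

lemma IsParam.tendsto {β : ℂ × ℂ → ℂ × ℂ} (h : IsParam β) (h0 : β 0 = 0) :
    Tendsto β (𝓝 0) (𝓝 0) := by
  have := h.hol.continuousAt
  rwa [ContinuousAt, h0] at this

/-- Germs of composites of finitely many blowing-up charts and changes of coordinates. -/
inductive IsBlowGerm : (ℂ × ℂ → ℂ × ℂ) → Prop
  | iso {φ : ℂ × ℂ → ℂ × ℂ} : IsParam φ → φ 0 = 0 → IsBlowGerm φ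
  | blow {φ β χ : ℂ × ℂ → ℂ × ℂ} (d : OnePoint ℂ) : IsParam β → β 0 = 0 → IsBlowGerm χ →
      φ =ᶠ[𝓝 0] β ∘ kap d ∘ χ → IsBlowGerm φ

namespace IsBlowGerm

variable {φ ψ χ β : ℂ × ℂ → ℂ × ℂ}

lemma congr (h : IsBlowGerm φ) (e : ψ =ᶠ[𝓝 0] φ) : IsBlowGerm ψ := by
  cases h with
  | iso h1 h2 => exact iso (h1.congr e) (e.self_of_nhds.trans h2)
  | blow d h1 h2 h3 h4 => exact blow d h1 h2 h3 (e.trans h4)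

lemma map_zero (h : IsBlowGerm φ) : φ 0 = 0 := by
  induction h with
  | iso h1 h2 => exact h2
  | blow d h1 h2 h3 h4 ih => rw [h4.self_of_nhds]; simp [ih, kap_zero, h2]

lemma analyticAt (h : IsBlowGerm φ) : AnalyticAt ℂ φ 0 := by
  induction h with
  | iso h1 h2 => exact hol_iff_analyticAt.1 h1.hol
  | @blow φ β χ d h1 h2 h3 h4 ih =>
    have e1 : AnalyticAt ℂ (kap d ∘ χ) 0 := (analyticAt_kap d _).comp ih
    have e2 : AnalyticAt ℂ (β ∘ kap d ∘ χ) 0 := by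
      refine AnalyticAt.comp ?_ e1
      simpa [h3.map_zero, kap_zero] using hol_iff_analyticAt.1 h1.hol
    exact e2.congr h4.symm

lemma tendsto (h : IsBlowGerm φ) : Tendsto φ (𝓝 0) (𝓝 0) := by
  have := h.analyticAt.continuousAt
  rwa [ContinuousAt, h.map_zero] at this

lemma comp_param_left (h : IsBlowGerm φ) (hβ : IsParam β) (h0 : β 0 = 0) :
    IsBlowGerm (β ∘ φ) := by
  have ht := h.tendsto
  cases h with
  | iso h1 h2 => exact iso (hβ.comp h1 h2) (by simp [h2, h0])
  | blow d h1 h2 h3 h4 =>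
    refine blow d (hβ.comp h1 h2) (by simp [h2, h0]) h3 ?_
    filter_upwards [h4] with z hz
    simp [hz]

lemma comp_param_right (h : IsBlowGerm φ) (hβ : IsParam β) (h0 : β 0 = 0) :
    IsBlowGerm (φ ∘ β) := by
  have hb := hβ.tendsto h0
  induction h with
  | iso h1 h2 => exact iso (h1.comp hβ h0) (by simp [h2, h0])
  | blow d h1 h2 h3 h4 ih =>
    refine blow d h1 h2 ih ?_
    filter_upwards [hb.eventually h4] with z hz
    simp [hz]

lemma comp_kap (h : IsBlowGerm φ) (d : OnePoint ℂ) : IsBlowGerm (φ ∘ kap d) := by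
  induction h with
  | iso h1 h2 => exact blow d h1 h2 (iso isParam_id rfl) (by rfl)
  | blow d' h1 h2 h3 h4 ih =>
    refine blow d' h1 h2 ih ?_
    filter_upwards [(tendsto_kap d).eventually h4] with z hz
    simpa using hz

end IsBlowGerm

/-- A map that factors through a blowing-up chart is not a change of coordinates. -/
lemma not_isParam_kap_comp (d : OnePoint ℂ) (ξ : ℂ × ℂ → ℂ × ℂ) {θ : ℂ × ℂ → ℂ × ℂ}
    (hθ : IsParam θ) (h0 : θ 0 = 0) (e : θ =ᶠ[𝓝 0] kap d ∘ ξ) : False := by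
  obtain ⟨τ, t1, t2, t3, t4⟩ := hθ.exists_inv h0
  have h1 : ∀ᶠ z in 𝓝 0, kap d (ξ (τ z)) = z := by
    filter_upwards [t4, (t1.tendsto t2).eventually e] with z hz hz'
    rw [← Function.comp_apply (f := kap d), ← hz', hz]
  induction d using OnePoint.rec with
  | infty =>
    -- The image of `kap ∞` meets the axis v = 0 only at the origin. For a finite slope the axis u =
    -- 0 plays this role.
    have h2 : Tendsto (fun t : ℂ => (t, (0 : ℂ))) (𝓝[≠] 0) (𝓝 (0 : ℂ × ℂ)) :=
      ((continuous_id.prodMk continuous_const).tendsto (0 : ℂ)).mono_left nhdsWithin_le_nhds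
    obtain ⟨t, ht, ht'⟩ := ((h2.eventually h1).and self_mem_nhdsWithin).exists
    have h3 := congrArg Prod.fst ht
    have h4 := congrArg Prod.snd ht
    simp only [kap_infty] at h3 h4
    rw [h4, mul_zero] at h3
    exact ht' h3.symm
  | coe s =>
    have h2 : Tendsto (fun t : ℂ => ((0 : ℂ), t)) (𝓝[≠] 0) (𝓝 (0 : ℂ × ℂ)) :=
      ((continuous_const.prodMk continuous_id).tendsto (0 : ℂ)).mono_left nhdsWithin_le_nhds
    obtain ⟨t, ht, ht'⟩ := ((h2.eventually h1).and self_mem_nhdsWithin).exists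
    have h3 := congrArg Prod.fst ht
    have h4 := congrArg Prod.snd ht
    simp only [kap_coe] at h3 h4
    rw [h3, zero_mul] at h4
    exact ht' h4.symm

/-- Factorizations through blowing-up charts are unique. -/
lemma kap_comp_unique {d e : OnePoint ℂ} {χ ξ : ℂ × ℂ → ℂ × ℂ} (hχ : ∀ᶠ z in 𝓝 0, ContinuousAt χ z)
    (hξ : ∀ᶠ z in 𝓝 0, ContinuousAt ξ z) (hχ0 : χ 0 = 0) (hξ0 : ξ 0 = 0)
    (h : kap d ∘ χ =ᶠ[𝓝 0] kap e ∘ ξ)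
    (hD : ∀ᶠ z in 𝓝 (0 : ℂ × ℂ), ∃ᶠ z' in 𝓝 z, kap d (χ z') ≠ 0) : χ =ᶠ[𝓝 0] ξ := by
  -- The direction vectors are proportional wherever the common value is nonzero, hence near 0 by
  -- density and continuity. At 0 this identifies the two directions, and then the slope coordinates
  -- agree.
  have hc : ∀ᶠ z in 𝓝 (0 : ℂ × ℂ), (kapVec d (χ z)).1 * (kapVec e (ξ z)).2 =
      (kapVec d (χ z)).2 * (kapVec e (ξ z)).1 := by
    filter_upwards [hχ, hξ, h.eventually_nhds, hD] with z h1 h2 h3 h4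
    have c1 : ContinuousAt (fun z => kapVec d (χ z)) z :=
      (analyticAt_kapVec d _).continuousAt.comp h1
    have c2 : ContinuousAt (fun z => kapVec e (ξ z)) z :=
      (analyticAt_kapVec e _).continuousAt.comp h2
    refine tendsto_nhds_unique_of_frequently_eq (c1.fst.mul c2.snd) (c1.snd.mul c2.fst) ?_
    refine (h4.and_eventually h3).mono ?_
    rintro w ⟨k1, k2⟩
    simp only [Function.comp_apply] at k2
    have k3 : kap e (ξ w) ≠ 0 := k2 ▸ k1
    rw [kap_eq_smul d, kap_eq_smul e] at k2
    rw [kap_eq_smul, smul_ne_zero_iff] at k1 k3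
    have k4 := congrArg Prod.fst k2
    have k5 := congrArg Prod.snd k2
    simp only [Prod.smul_fst, Prod.smul_snd, smul_eq_mul] at k4 k5
    have k6 := mul_ne_zero k1.1 k3.1
    refine mul_left_cancel₀ k6 ?_
    change _ * ((kapVec d (χ w)).1 * (kapVec e (ξ w)).2) =
      _ * ((kapVec d (χ w)).2 * (kapVec e (ξ w)).1)
    linear_combination (kapExc e (ξ w) * (kapVec e (ξ w)).2) * k4 -
      (kapExc e (ξ w) * (kapVec e (ξ w)).1) * k5
  have hde : d = e := by
    have := hc.self_of_nhds
    rw [hχ0, hξ0] at this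
    induction d using OnePoint.rec <;> induction e using OnePoint.rec <;> simp [kapVec] at this ⊢
    exact this.symm
  subst hde
  filter_upwards [hc, h] with z h1 h2
  induction d using OnePoint.rec with
  | infty =>
    simp only [kapVec, OnePoint.elim_infty, Function.comp_apply, kap_infty, Prod.mk.injEq] at h1 h2
    exact Prod.ext (by simpa using h1) h2.2
  | coe s =>
    simp only [kapVec, OnePoint.elim_some, Function.comp_apply, kap_coe, Prod.mk.injEq] at h1 h2
    exact Prod.ext h2.1 (by simpa using h1.symm)

lemma AnalyticAt.eventually_continuousAt' {f : ℂ × ℂ → ℂ × ℂ} (h : AnalyticAt ℂ f 0) :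
    ∀ᶠ z in 𝓝 0, ContinuousAt f z :=
  h.eventually_analyticAt.mono fun _ h => h.continuousAt

/-- The left factor of a germ of composite of blowing-up charts can be cancelled. -/
lemma IsBlowGerm.of_comp {φ ψ : ℂ × ℂ → ℂ × ℂ} (hφ : IsBlowGerm φ) (hψ : AnalyticAt ℂ ψ 0)
    (h0 : ψ 0 = 0) (h : IsBlowGerm (φ ∘ ψ))
    (hD : ∀ᶠ z in 𝓝 (0 : ℂ × ℂ), ∃ᶠ z' in 𝓝 z, φ (ψ z') ≠ 0) : IsBlowGerm ψ := by
  have hψt : Tendsto ψ (𝓝 0) (𝓝 0) := by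
    have := hψ.continuousAt
    rwa [ContinuousAt, h0] at this
  induction hφ with
  | iso h1 h2 =>
    obtain ⟨τ, t1, t2, t3, t4⟩ := h1.exists_inv h2
    refine (h.comp_param_left t1 t2).congr ?_
    filter_upwards [hψt.eventually t3] with z hz
    simp [hz]
  | @blow φ β φ' d h1 h2 h3 h4 ih =>
    obtain ⟨τ, t1, t2, t3, t4⟩ := h1.exists_inv h2
    have h5 : φ ∘ ψ =ᶠ[𝓝 0] β ∘ kap d ∘ φ' ∘ ψ := hψt.eventually h4
    have hφψ : Tendsto (φ' ∘ ψ) (𝓝 0) (𝓝 0) := h3.tendsto.comp hψt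
    have h6 := (tendsto_kap d).comp hφψ
    have hφψa : AnalyticAt ℂ (φ' ∘ ψ) 0 := AnalyticAt.comp (by rw [h0]; exact h3.analyticAt) hψ
    have hφψ0 : φ' (ψ 0) = 0 := by rw [h0, h3.map_zero]
    refine ih ?_ ?_
    · cases h with
      | iso g1 g2 =>
        -- A change of coordinates cannot begin with a blowing-up, so this case is void.
        refine (not_isParam_kap_comp d (φ' ∘ ψ) (t1.comp g1 g2)
          (by rw [Function.comp_apply, g2, t2]) ?_).elim
        filter_upwards [h5, h6.eventually t3] with z k1 k2
        simp only [Function.comp_apply] at k1 k2 ⊢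
        rw [k1, k2]
      | @blow _ β' χ d' g1 g2 g3 g4 =>
        obtain ⟨σ, s1, s2, s3, s4⟩ := g1.exists_inv g2
        -- Both factorizations begin by blowing up the origin, in coordinates differing by `σ ∘ β`.
        -- Lifting this change brings them to charts of the same blowing-up, and `kap_comp_unique`
        -- identifies the remaining factors.
        obtain ⟨e, β'', b1, b2, b3⟩ := (s1.comp h1 h2).exists_comp_kap (by simp [h2, s2]) d
        have hχ := (tendsto_kap d').comp g3.tendsto
        have key : kap d' ∘ χ =ᶠ[𝓝 0] kap e ∘ β'' ∘ φ' ∘ ψ := by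
          filter_upwards [h5, g4, hφψ.eventually b3, hχ.eventually s3] with z k1 k2 k3 k4
          simp only [Function.comp_apply] at k1 k2 k3 k4 ⊢
          rw [← k4, ← k2, k1, k3]
        have hD' : ∀ᶠ z in 𝓝 (0 : ℂ × ℂ), ∃ᶠ z' in 𝓝 z, kap d' (χ z') ≠ 0 := by
          filter_upwards [hD, g4.eventually_nhds] with z k1 k2
          refine (k1.and_eventually k2).mono ?_
          rintro w ⟨k3, k4⟩ k5
          simp only [Function.comp_apply] at k4
          rw [k4, k5, g2] at k3
          exact k3 rfl
        have hu := kap_comp_unique (AnalyticAt.eventually_continuousAt' g3.analyticAt)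
          (AnalyticAt.eventually_continuousAt' (f := β'' ∘ φ' ∘ ψ) (AnalyticAt.comp
            (by rw [Function.comp_apply, hφψ0]; exact hol_iff_analyticAt.1 b1.hol) hφψa))
          g3.map_zero (by simp [hφψ0, b2]) key hD'
        obtain ⟨υ, u1, u2, u3, u4⟩ := b1.exists_inv b2
        refine (g3.comp_param_left u1 u2).congr ?_
        filter_upwards [hu, hφψ.eventually u3] with z k1 k2
        simp only [Function.comp_apply] at k1 k2 ⊢
        rw [k1, k2]
    · filter_upwards [hD, h5.eventually_nhds] with z k1 k2
      refine (k1.and_eventually k2).mono ?_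
      rintro w ⟨k3, k4⟩ k5
      simp only [Function.comp_apply] at k4
      rw [k4, k5, kap_zero, h2] at k3
      exact k3 rfl

/-- Over the last center the projection gains one chart `kap d` on the right; away from it nothing
changes but coordinates. -/
lemma BlowupSeq.isBlowGerm {W : Surface} (s : BlowupSeq W) {γ : ℂ × ℂ → W.carrier}
    (hγ : IsParam γ) (h0 : W.proj (γ 0) = 0) : IsBlowGerm (W.proj ∘ γ) := by
  induction s with
  | nil => exact IsBlowGerm.iso hγ h0
  | @cons X s c hc ih =>
    have := s.isModification.t2
    suffices key : ∀ δ : ℂ × ℂ → Blowup X.carrier c, IsParam δ → X.proj (δ 0).down = 0 →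
        IsBlowGerm (fun z => X.proj (δ z).down) from key γ hγ h0
    clear hγ h0
    intro δ hδ h0
    by_cases hd : (δ 0).down = c
    · obtain ⟨d, γ', h1, h2, h3⟩ := (isParam_point c).exists_dir (Blowup.point_zero c) (δ 0) hd
      obtain ⟨β, b1, b2, b3⟩ := h1.exists_comp hδ h2.symm
      have h4 := ih (isParam_point c) (by rw [Blowup.point_zero]; exact hc)
      refine ((h4.comp_kap d).comp_param_right b1 b2).congr ?_
      filter_upwards [b3, (b1.tendsto b2).eventually h3] with z k1 k2
      simp only [Function.comp_apply] at k1 k2 ⊢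
      rw [k1, k2]
    · have h1 := (isParam_point (δ 0).down).up (p := c) (by rwa [Blowup.point_zero])
      obtain ⟨β, b1, b2, b3⟩ := h1.exists_comp hδ
        (by rw [Function.comp_apply, Blowup.point_zero, Blowup.up_down hd])
      have h4 := ih (isParam_point (δ 0).down) (by rw [Blowup.point_zero]; exact h0)
      refine (h4.comp_param_right b1 b2).congr ?_
      filter_upwards [b3] with z k1
      simp only [Function.comp_apply] at k1 ⊢
      rw [k1, Blowup.down_up]

lemma IsModification.frequently_ne {Z : Surface} (hZ : IsModification Z) {ζ : ℂ × ℂ → Z.carrier}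
    (hζ : IsParam ζ) : ∀ᶠ z in 𝓝 (0 : ℂ × ℂ), ∃ᶠ z' in 𝓝 z, Z.proj (ζ z') ≠ 0 := by
  obtain ⟨κ, h1, h2, h3, h4⟩ := hζ
  have h5 := h1.continuousAt.eventually h2.eventually
  have h6 := h1.continuousAt.eventually h4.eventually_nhds
  filter_upwards [h3, h5, h6] with z k1 k2 k3
  have k4 : Tendsto κ (𝓝 (ζ z)) (𝓝 z) := by
    have := k2.continuousAt
    rwa [ContinuousAt, k1] at this
  refine k4.frequently (((mem_closure_iff_frequently.1 (hZ.dense (ζ z))).and_eventually k3).mono ?_)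
  rintro q ⟨k5, k6⟩
  rw [k6]
  exact k5

/-- If a sequence of blowing-ups `Z` eliminates the indeterminacies of `π⁻¹ ∘ ρ` and dominates `W`,
then it dominates the blowing-up of `W` at every point of indeterminacy. -/
lemma extends_blowup_of_not_liftsAt {ρ : ℂ × ℂ → ℂ × ℂ} {X W Z : Surface} (sW : BlowupSeq W)
    (sZ : BlowupSeq Z) (hXZ : Extends ρ X Z) (hWZ : Extends id W Z) {c : W.carrier}
    (hc : W.proj c = 0) (hl : ¬ LiftsAt ρ X W c) : Extends id (W.blowup c) Z := by
  have hW := sW.isModification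
  have hZ := sZ.isModification
  refine extends_of_liftsAt (hW.blowup hc) hZ (fun z => Iff.rfl) fun q hq => ?_
  obtain ⟨g, hg, hg'⟩ := liftsAt_of_extends hZ hWZ hq
  by_cases hgc : g q = c
  · have hζ := isParam_point q
    set ζ := Blowup.point q with hζd
    have hζ0 : ζ 0 = q := Blowup.point_zero q
    clear_value ζ
    subst hζ0
    have hγ := isParam_point c
    set γ := Blowup.point c with hγd
    have hγ0 : γ 0 = c := Blowup.point_zero c
    clear_value γ
    subst hγ0
    obtain ⟨ψ, p1, p2, p3⟩ := hγ.exists_factor (hζ.hol_iff.1 hg) hgc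
    have hproj : W.proj ∘ γ ∘ ψ =ᶠ[𝓝 0] Z.proj ∘ ζ := by
      filter_upwards [p3, hζ.eventually_iff.1 hg'] with z k1 k2
      simp only [Function.comp_apply, id] at k1 k2 ⊢
      rw [← k1, k2]
    have hB : IsBlowGerm ψ := by
      refine (sW.isBlowGerm hγ hc).of_comp p1 p2 ((sZ.isBlowGerm hζ hq).congr hproj) ?_
      filter_upwards [hZ.frequently_ne hζ, hproj.eventually_nhds] with z k1 k2
      refine (k1.and_eventually k2).mono ?_
      rintro w ⟨k3, k4⟩
      simp only [Function.comp_apply] at k4 ⊢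
      rwa [k4]
    cases hB with
    | iso i1 i2 =>
      -- If Z → W is a local isomorphism at this point, the lift existing on Z is transported to the
      -- point of W, which was assumed to be an indeterminacy.
      exfalso
      obtain ⟨τ, t1, t2, t3, t4⟩ := i1.exists_inv i2
      obtain ⟨G, g1, g2⟩ := (liftsAt_iff hζ).1 (liftsAt_of_extends hZ hXZ hq)
      refine hl ((liftsAt_iff hγ).2 ⟨G ∘ τ,
        ContMDiffAt.comp (0 : ℂ × ℂ) (by rwa [t2]) t1.hol, ?_⟩)
      filter_upwards [t4, (t1.tendsto t2).eventually g2, (t1.tendsto t2).eventually hproj]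
        with z k1 k2 k3
      simp only [Function.comp_apply] at k3 ⊢
      rw [k2, ← k3, k1]
    | @blow _ β χ d h1 h2 h3 h4 =>
      -- Otherwise the first blowing-up contained in `ψ` is that of the center, and what follows it
      -- is the desired lift.
      obtain ⟨γ', e1, e2⟩ := (hγ.comp h1 h2).exists_lift_kap (p := γ 0) (by simp [h2]) d
      refine (liftsAt_iff hζ).2 ⟨γ' ∘ χ, ?_, ?_⟩
      · exact ContMDiffAt.comp (M'' := Blowup W.carrier (γ 0)) (0 : ℂ × ℂ)
          (by rw [h3.map_zero]; exact e1.hol) (hol_iff_analyticAt.2 h3.analyticAt)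
      · filter_upwards [h4, h3.tendsto.eventually e2, hproj] with z k1 k2 k3
        simp only [Function.comp_apply, id] at k1 k2 k3 ⊢
        rw [← k3, k1, ← k2]
        rfl
  · exact liftsAt_blowup_of_ne hg hg' hgc

end PointBlowup

/-! ### Local models and their behaviour under blowing-up -/

namespace PointBlowup

open Filter

variable {ρ : ℂ × ℂ → ℂ × ℂ} {X W : Surface}

/-- In the parametrizations `γ` of `W` and `δ` of `X`, the map `π⁻¹ ∘ ρ` is `Φ`, and the function
`u` on `ℂ²` is `e`. -/
structure HasGerm (ρ : ℂ × ℂ → ℂ × ℂ) (X W : Surface) (γ : ℂ × ℂ → W.carrier)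
    (δ : ℂ × ℂ → X.carrier) (Φ : ℂ × ℂ → ℂ × ℂ) (e : ℂ × ℂ → ℂ) : Prop where
  source : IsParam γ
  target : IsParam δ
  analyticAt : AnalyticAt ℂ Φ 0
  map_zero : Φ 0 = 0
  proj_eq : ∀ᶠ z in 𝓝 0, X.proj (δ (Φ z)) = ρ (W.proj (γ z))
  fst_eq : ∀ᶠ z in 𝓝 0, (W.proj (γ z)).1 = e z

namespace HasGerm

variable {γ : ℂ × ℂ → W.carrier} {δ : ℂ × ℂ → X.carrier} {Φ : ℂ × ℂ → ℂ × ℂ} {e : ℂ × ℂ → ℂ}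

lemma tendsto (h : HasGerm ρ X W γ δ Φ e) : Tendsto Φ (𝓝 0) (𝓝 0) := by
  have := h.analyticAt.continuousAt
  rwa [ContinuousAt, h.map_zero] at this

lemma exists_lift (h : HasGerm ρ X W γ δ Φ e) : ∃ f : W.carrier → X.carrier, Hol f (γ 0) ∧
    (∀ᶠ q in 𝓝 (γ 0), X.proj (f q) = ρ (W.proj q)) ∧ ∀ᶠ z in 𝓝 0, f (γ z) = δ (Φ z) := by
  have hγ := h.source
  obtain ⟨κ, g1, g2, g3, g4⟩ := h.source
  have h3 : ∀ᶠ z in 𝓝 0, δ (Φ (κ (γ z))) = δ (Φ z) := g3.mono fun z hz => by rw [hz]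
  refine ⟨δ ∘ Φ ∘ κ, hγ.hol_iff.2 ?_, hγ.eventually_iff.2 ?_, h3⟩
  · refine ContMDiffAt.congr_of_eventuallyEq ?_ h3
    exact ContMDiffAt.comp (0 : ℂ × ℂ) (by rw [h.map_zero]; exact h.target.hol)
      (hol_iff_analyticAt.2 h.analyticAt)
  · filter_upwards [h3, h.proj_eq] with z k1 k2
    rw [Function.comp_apply, Function.comp_apply, k1, k2]

lemma liftsAt (h : HasGerm ρ X W γ δ Φ e) : LiftsAt ρ X W (γ 0) := by
  obtain ⟨f, h1, h2, -⟩ := h.exists_lift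
  exact ⟨f, h1, h2⟩

lemma congr (h : HasGerm ρ X W γ δ Φ e) {Φ' : ℂ × ℂ → ℂ × ℂ} (h' : Φ =ᶠ[𝓝 0] Φ') :
    HasGerm ρ X W γ δ Φ' e where
  source := h.source
  target := h.target
  analyticAt := h.analyticAt.congr h'
  map_zero := by rw [← h'.self_of_nhds, h.map_zero]
  proj_eq := by
    filter_upwards [h.proj_eq, h'] with z k1 k2
    rw [← k2, k1]
  fst_eq := h.fst_eq

/-- Change of coordinates in the source. -/
lemma comp_source (h : HasGerm ρ X W γ δ Φ e) {β : ℂ × ℂ → ℂ × ℂ} (hβ : IsParam β)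
    (h0 : β 0 = 0) : HasGerm ρ X W (γ ∘ β) δ (Φ ∘ β) (e ∘ β) where
  source := h.source.comp hβ h0
  target := h.target
  analyticAt := AnalyticAt.comp (by rw [h0]; exact h.analyticAt) (hol_iff_analyticAt.1 hβ.hol)
  map_zero := by rw [Function.comp_apply, h0, h.map_zero]
  proj_eq := (hβ.tendsto h0).eventually h.proj_eq
  fst_eq := (hβ.tendsto h0).eventually h.fst_eq

/-- Change of coordinates in the target. -/
lemma comp_target {β Φ' : ℂ × ℂ → ℂ × ℂ} (h : HasGerm ρ X W γ δ Φ e) (hβ : IsParam β)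
    (h0 : β 0 = 0) (ha : AnalyticAt ℂ Φ' 0) (ha0 : Φ' 0 = 0) (he : Φ =ᶠ[𝓝 0] β ∘ Φ') :
    HasGerm ρ X W γ (δ ∘ β) Φ' e where
  source := h.source
  target := h.target.comp hβ h0
  analyticAt := ha
  map_zero := ha0
  proj_eq := by
    filter_upwards [h.proj_eq, he] with z k1 k2
    rw [← k1, k2]
    rfl
  fst_eq := h.fst_eq

/-- A germ which factors through a blowing-up chart lifts to the blowing-up of the target. -/
lemma lift_target {Φ' : ℂ × ℂ → ℂ × ℂ} {c : X.carrier} (h : HasGerm ρ X W γ δ Φ e) (hc : δ 0 = c)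
    (d : OnePoint ℂ) (ha : AnalyticAt ℂ Φ' 0) (ha0 : Φ' 0 = 0) (he : Φ =ᶠ[𝓝 0] kap d ∘ Φ') :
    ∃ δ', HasGerm ρ (X.blowup c) W γ δ' Φ' e := by
  obtain ⟨δ', h1, h2⟩ := h.target.exists_lift_kap hc d
  have ht : Tendsto Φ' (𝓝 0) (𝓝 0) := by
    have := ha.continuousAt
    rwa [ContinuousAt, ha0] at this
  refine ⟨δ', h.source, h1, ha, ha0, ?_, h.fst_eq⟩
  filter_upwards [h.proj_eq, he, ht.eventually h2] with z k1 k2 k3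
  rw [← k1, k2]
  exact congrArg X.proj k3

/-- A germ whose value is not the center lifts to the blowing-up of the target. -/
lemma up_target [T1Space X.carrier] {c : X.carrier} (h : HasGerm ρ X W γ δ Φ e) (hc : δ 0 ≠ c) :
    HasGerm ρ (X.blowup c) W γ (Blowup.up c ∘ δ : ℂ × ℂ → Blowup X.carrier c) Φ e := by
  refine ⟨h.source, h.target.up hc, h.analyticAt, h.map_zero, ?_, h.fst_eq⟩
  filter_upwards [h.proj_eq] with z k1
  rw [← k1]
  exact congrArg X.proj (Blowup.down_up _)

/-- A germ at a point different from the center, on the blowing-up of the source. -/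
lemma up_source [T1Space W.carrier] {c : W.carrier} (h : HasGerm ρ X W γ δ Φ e) (hc : γ 0 ≠ c) :
    HasGerm ρ X (W.blowup c) (Blowup.up c ∘ γ : ℂ × ℂ → Blowup W.carrier c) δ Φ e := by
  have h1 : ∀ z, (W.blowup c).proj (Blowup.up c (γ z) : Blowup W.carrier c) = W.proj (γ z) :=
    fun z => congrArg W.proj (Blowup.down_up _)
  refine ⟨h.source.up hc, h.target, h.analyticAt, h.map_zero, ?_, ?_⟩
  · filter_upwards [h.proj_eq] with z k1
    rw [k1]
    exact congrArg ρ (h1 z).symm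
  · filter_upwards [h.fst_eq] with z k1
    rw [← k1]
    exact congrArg Prod.fst (h1 z)

/-- A germ at a point of the exceptional line of the blowing-up of the source. -/
lemma kap_source {c : W.carrier} {γ' : ℂ × ℂ → Blowup W.carrier c} {d : OnePoint ℂ}
    (h : HasGerm ρ X W γ δ Φ e) (h' : IsParam γ') (hd : Blowup.down ∘ γ' =ᶠ[𝓝 0] γ ∘ kap d) :
    HasGerm ρ X (W.blowup c) γ' δ (Φ ∘ kap d) (e ∘ kap d) := by
  have h1 : ∀ᶠ z in 𝓝 0, (W.blowup c).proj (γ' z) = W.proj (γ (kap d z)) := by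
    filter_upwards [hd] with z hz
    exact congrArg W.proj hz
  refine ⟨h', h.target, ?_, by simp [kap_zero, h.map_zero], ?_, ?_⟩
  · exact AnalyticAt.comp (by rw [kap_zero]; exact h.analyticAt) (analyticAt_kap d 0)
  · filter_upwards [(tendsto_kap d).eventually h.proj_eq, h1] with z k1 k2
    rw [k2, ← k1]
    rfl
  · filter_upwards [(tendsto_kap d).eventually h.fst_eq, h1] with z k1 k2
    rw [k2, k1]
    rfl

end HasGerm

/-- The local models of the map to `X` at the points of `W` where the exceptional divisor `u = 0`
of `W` is reduced: at a regular point whose component is not contracted, at a regular point whose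
component is contracted to a crossing of two components, and at a crossing. -/
inductive Model (n B : ℕ) : (ℂ × ℂ → ℂ × ℂ) → (ℂ × ℂ → ℂ) → Prop
  -- In all models `a` and `b` stand for multiplicities of u = 0 on X along the axes (divided by `g`
  -- at a corner). Only their relation with `n` is kept: the pull-back of u from X is the n-th power
  -- of u on W, up to a constant in the coordinates used.
  | regular (a m : ℕ) (ha : 1 ≤ a) (haB : a ≤ B) (hm : 1 ≤ m) (h : a * m = n) :
      Model n B (fun z => (z.1 ^ m, z.2)) (fun z => z.1)
  -- The nonzero determinant guarantees that the slope of the image varies along the component once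
  -- `i = j`.
  | contracted (a b i j : ℕ) (k l : ℤ) (y : ℂ) (hy : y ≠ 0) (ha : 1 ≤ a) (hab : a + b ≤ B)
      (hi : 1 ≤ i) (hj : 1 ≤ j) (h : a * i + b * j = n) (hd : i * l - j * k ≠ 0) :
      Model n B (fun z => (z.1 ^ i * (z.2 + y) ^ k, z.1 ^ j * (z.2 + y) ^ l)) (fun z => z.1)
  -- The exponent vectors (i, j + a) and (i + b, j) of the two branches lie on the line g (a p + b
  -- q) = n and differ by the primitive vector (b, -a): they are consecutive lattice points.
  | corner (g a b i j : ℕ) (hg : 1 ≤ g) (ha : 1 ≤ a) (hb : 1 ≤ b) (hgB : g * (a + b) ≤ B)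
      (hab : a.Coprime b) (h : g * (a * i + b * (j + a)) = n) :
      Model n B (fun z => (z.1 ^ i * z.2 ^ (i + b), z.1 ^ (j + a) * z.2 ^ j))
        (fun z => z.1 * z.2)

/-- The map from `W` to `X` has one of the local models at `q`. -/
def HasModel (ρ : ℂ × ℂ → ℂ × ℂ) (n B : ℕ) (X W : Surface) (q : W.carrier) : Prop :=
  ∃ γ δ Φ e, γ 0 = q ∧ HasGerm ρ X W γ δ Φ e ∧ Model n B Φ e

/-- The map from `W` to `X` is `(x, y) ↦ (x ^ (i + w), x ^ i * y)` at `q`, and it takes there the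
value `c`, so that `w` points have to be blown up in order to lift it to the blowing-up at `c`. -/
def Pending (ρ : ℂ × ℂ → ℂ × ℂ) (n B : ℕ) (X : Surface) (c : X.carrier) (W : Surface) (w : ℕ)
    (q : W.carrier) : Prop :=
  1 ≤ w ∧ ∃ a i γ δ, 1 ≤ a ∧ a ≤ B ∧ a * (i + w) = n ∧ γ 0 = q ∧ δ 0 = c ∧
    HasGerm ρ X W γ δ (fun z => (z.1 ^ (i + w), z.1 ^ i * z.2)) (fun z => z.1)

lemma Model.mono {n B B' : ℕ} {Φ : ℂ × ℂ → ℂ × ℂ} {e : ℂ × ℂ → ℂ} (h : Model n B Φ e)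
    (hB : B ≤ B') : Model n B' Φ e := by
  cases h with
  | regular a m ha haB hm h => exact .regular a m ha (haB.trans hB) hm h
  | contracted a b i j k l y hy ha hab hi hj h hd =>
    exact .contracted a b i j k l y hy ha (hab.trans hB) hi hj h hd
  | corner g a b i j hg ha hb hgB hab h => exact .corner g a b i j hg ha hb (hgB.trans hB) hab h

lemma analyticAt_pow_mul_zpow {y : ℂ} (hy : y ≠ 0) (i : ℕ) (k : ℤ) :
    AnalyticAt ℂ (fun z : ℂ × ℂ => z.1 ^ i * (z.2 + y) ^ k) 0 :=
  (analyticAt_fst.pow i).mul ((analyticAt_snd.add analyticAt_const).zpow (by simpa using hy))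

lemma Model.analyticAt {n B : ℕ} {Φ : ℂ × ℂ → ℂ × ℂ} {e : ℂ × ℂ → ℂ} (h : Model n B Φ e) :
    AnalyticAt ℂ Φ 0 := by
  cases h with
  | regular a m ha haB hm h => exact (analyticAt_fst.pow m).prod analyticAt_snd
  | contracted a b i j k l y hy ha hab hi hj h hd =>
    exact (analyticAt_pow_mul_zpow hy i k).prod (analyticAt_pow_mul_zpow hy j l)
  | corner g a b i j hg ha hb hgB hab h =>
    exact ((analyticAt_fst.pow _).mul (analyticAt_snd.pow _)).prod
      ((analyticAt_fst.pow _).mul (analyticAt_snd.pow _))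

lemma Model.map_zero {n B : ℕ} {Φ : ℂ × ℂ → ℂ × ℂ} {e : ℂ × ℂ → ℂ} (h : Model n B Φ e) :
    Φ 0 = 0 := by
  cases h with
  | regular a m ha haB hm h => simp; omega
  | contracted a b i j k l y hy ha hab hi hj h hd =>
    have h1 : i ≠ 0 := by omega
    have h2 : j ≠ 0 := by omega
    simp [h1, h2]
  | corner g a b i j hg ha hb hgB hab h =>
    have h1 : i + b ≠ 0 := by omega
    have h2 : j + a ≠ 0 := by omega
    simp only [Prod.fst_zero, Prod.snd_zero, zero_pow h1, zero_pow h2, mul_zero, zero_mul]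
    rfl

/-- The coordinate change in the target that absorbs the powers of the unit z.2 + y when a
contracted component ceases to be contracted. -/
lemma isParam_contracted {y : ℂ} (hy : y ≠ 0) (k l : ℤ) (hl : l ≠ 0) :
    IsParam (fun z : ℂ × ℂ => (z.1 * (z.2 + y) ^ k, (z.2 + y) ^ l - y ^ l)) := by
  have hY : ∀ k : ℤ, HasFDerivAt (fun z : ℂ × ℂ => (z.2 + y) ^ k)
      ((k * y ^ (k - 1)) • ContinuousLinearMap.snd ℂ ℂ ℂ) 0 := by
    intro k
    have h1 := hasDerivAt_zpow k ((0 : ℂ × ℂ).2 + y) (Or.inl (by simpa using hy))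
    have h2 : HasFDerivAt (fun z : ℂ × ℂ => z.2 + y) (ContinuousLinearMap.snd ℂ ℂ ℂ) 0 :=
      hasFDerivAt_snd.add_const _
    have h3 := h1.comp_hasFDerivAt (0 : ℂ × ℂ) h2
    rw [Prod.snd_zero, zero_add] at h3
    exact h3
  have ha : ∀ k : ℤ, AnalyticAt ℂ (fun z : ℂ × ℂ => (z.2 + y) ^ k) 0 := fun k =>
    (analyticAt_snd.add analyticAt_const).zpow (by simpa using hy)
  refine isParam_of_fderiv_injective
    ((analyticAt_fst.mul (ha k)).prod ((ha l).sub analyticAt_const)) fun v hv => ?_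
  have h1 := ((hasFDerivAt_fst (𝕜 := ℂ) (p := (0 : ℂ × ℂ))).mul (hY k)).prodMk
    ((hY l).sub_const (y ^ l))
  have h2 := congrArg (fun A : ℂ × ℂ →L[ℂ] ℂ × ℂ => A v) h1.fderiv
  have h3 := h2.symm.trans hv
  have e1 := congrArg Prod.fst h3
  have e2 := congrArg Prod.snd h3
  have hl' : (l : ℂ) ≠ 0 := by exact_mod_cast hl
  simp [hy, zpow_ne_zero] at e1
  simp [hl', hy, zpow_ne_zero] at e2
  exact Prod.ext e1 e2

lemma HasGerm.hasModel_of_kap {n B : ℕ} {c : X.carrier} {γ : ℂ × ℂ → W.carrier}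
    {δ : ℂ × ℂ → X.carrier} {Φ Φ' : ℂ × ℂ → ℂ × ℂ} {e : ℂ × ℂ → ℂ} (h : HasGerm ρ X W γ δ Φ e)
    (hc : δ 0 = c) (d : OnePoint ℂ) (hm : Model n B Φ' e) (he : Φ =ᶠ[𝓝 0] kap d ∘ Φ') :
    HasModel ρ n B (X.blowup c) W (γ 0) := by
  obtain ⟨δ', h'⟩ := h.lift_target hc d hm.analyticAt hm.map_zero he
  exact ⟨γ, δ', Φ', e, rfl, h', hm⟩

/-- At the non-regular models the map lifts to every blowing-up of the target; at the regular ones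
it lifts if the value is not the center. -/
lemma HasModel.blowup_target [T1Space X.carrier] {n B : ℕ} {q : W.carrier}
    (h : HasModel ρ n B X W q) (hn : ∀ d, 0 < d → d ≤ B → d ∣ n) (c : X.carrier) :
    HasModel ρ n (2 * B) (X.blowup c) W q ∨ ∃ a m γ δ, 1 ≤ a ∧ a ≤ B ∧ 1 ≤ m ∧ a * m = n ∧
      γ 0 = q ∧ δ 0 = c ∧ HasGerm ρ X W γ δ (fun z => (z.1 ^ m, z.2)) (fun z => z.1) := by
  obtain ⟨γ, δ, Φ, e, rfl, h, hm⟩ := h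
  by_cases hc : δ 0 = c
  swap
  · exact Or.inl ⟨γ, _, Φ, e, rfl, h.up_target hc, hm.mono (by omega)⟩
  cases hm with
  | regular a m ha haB hm hn =>
    exact Or.inr ⟨a, m, γ, δ, ha, haB, hm, hn, rfl, hc, h⟩
  | contracted a b i j k l y hy ha hab hi hj hN hd =>
    left
    have hY : ∀ᶠ z in 𝓝 (0 : ℂ × ℂ), z.2 + y ≠ 0 :=
      (analyticAt_snd.add analyticAt_const).continuousAt.eventually_ne (by simpa using hy)
    -- The slope of the image is z.1 ^ (j - i) times a power of the unit z.2 + y: at the point it is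
    -- 0, finite and nonzero, or ∞.
    rcases lt_trichotomy i j with hij | hij | hij
    · obtain ⟨j, rfl⟩ := Nat.exists_eq_add_of_lt hij
      refine h.hasModel_of_kap hc (0 : ℂ) (Model.contracted (a + b) b i (j + 1) k (l - k) y hy
        (by omega) (by omega) hi (by omega) ?_ ?_) ?_
      · rw [← hN]; ring
      · convert hd using 1; push_cast; ring
      · filter_upwards [hY] with z hz
        simp only [Function.comp_apply, kap_coe, add_zero, Prod.mk.injEq, true_and]
        rw [zpow_sub₀ hz]
        have := zpow_ne_zero k hz
        field_simp
        ring
    · subst hij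
      -- Here the component maps onto an open part of the new exceptional line, of multiplicity a +
      -- b, so the model becomes regular.
      have hlk : l - k ≠ 0 := by
        rintro h0
        apply hd
        rw [← mul_sub, h0, mul_zero]
      have hlam : AnalyticAt ℂ (fun z : ℂ × ℂ => (z.2 + y) ^ (l - k) - y ^ (l - k)) 0 :=
        ((analyticAt_snd.add analyticAt_const).zpow (by simpa using hy)).sub analyticAt_const
      obtain ⟨δ', h'⟩ := h.lift_target hc (y ^ (l - k) : ℂ)
        (Φ' := fun z => (z.1 ^ i * (z.2 + y) ^ k, (z.2 + y) ^ (l - k) - y ^ (l - k)))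
        ((analyticAt_pow_mul_zpow hy i k).prod hlam)
        (by simp [show i ≠ 0 by omega]) (by
          filter_upwards [hY] with z hz
          simp only [Function.comp_apply, kap_coe, sub_add_cancel, Prod.mk.injEq, true_and]
          rw [zpow_sub₀ hz]
          have := zpow_ne_zero k hz
          field_simp)
      have hm : Model n (2 * B) (fun z : ℂ × ℂ => (z.1 ^ i, z.2)) (fun z => z.1) :=
        Model.regular (a + b) i (by omega) (by omega) hi (by rw [← hN]; ring)
      have h'' := h'.comp_target (isParam_contracted hy k (l - k) hlk) (by simp) hm.analyticAt
        hm.map_zero (by rfl)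
      exact ⟨γ, _, _, _, rfl, h'', hm⟩
    · obtain ⟨i, rfl⟩ := Nat.exists_eq_add_of_lt hij
      refine h.hasModel_of_kap hc OnePoint.infty (Model.contracted a (a + b) (i + 1) j (k - l) l y
        hy ha (by omega) (by omega) hj ?_ ?_) ?_
      · rw [← hN]; ring
      · convert hd using 1; push_cast; ring
      · filter_upwards [hY] with z hz
        simp only [Function.comp_apply, kap_infty, Prod.mk.injEq, and_true]
        rw [zpow_sub₀ hz]
        have := zpow_ne_zero l hz
        field_simp
        ring
  | corner g a b i j hg ha hb hgB hab hN =>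
    left
    -- The new exceptional line has multiplicity g (a + b), which divides n. So its ray p = q meets
    -- the line g (a p + b q) = n in a lattice point, which cannot lie strictly between two
    -- consecutive ones: one coordinate of the map divides the other.
    have h1 : g * (a + b) ∣ g * (a * i + b * (j + a)) := by
      rw [hN]
      exact hn _ (by positivity) hgB
    have h2 : a + b ∣ a * i + b * (j + a) := Nat.dvd_of_mul_dvd_mul_left hg h1
    have hcop : IsCoprime ((a + b : ℕ) : ℤ) (b : ℤ) := by
      rw [Nat.isCoprime_iff_coprime]
      simpa using hab
    have h3 : ((a + b : ℕ) : ℤ) ∣ (j + a - i : ℤ) := by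
      refine hcop.dvd_of_dvd_mul_left ?_
      have h4 : ((a + b : ℕ) : ℤ) ∣ ((a * i + b * (j + a) : ℕ) : ℤ) := by exact_mod_cast h2
      have h5 : (b * (j + a - i) : ℤ) = ((a * i + b * (j + a) : ℕ) : ℤ) - ((a + b : ℕ) : ℤ) * i := by
        push_cast; ring
      rw [h5]
      exact dvd_sub h4 (Dvd.intro _ rfl)
    -- The sums of multiplicities at the two crossings with the new line; they force the doubling of
    -- the bound.
    have hgB' : g * (a + b + b) ≤ 2 * B ∧ g * (a + (a + b)) ≤ 2 * B := by
      constructor <;> nlinarith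
    by_cases hlt : i < j + a
    · have h4 : i + b ≤ j := by
        have := Int.le_of_dvd (by omega) h3
        push_cast at this
        omega
      obtain ⟨j, rfl⟩ := Nat.exists_eq_add_of_le h4
      refine h.hasModel_of_kap hc (0 : ℂ) (Model.corner g (a + b) b i j hg (by omega) hb hgB'.1
        (by simpa using hab) ?_) ?_
      · rw [← hN]; ring
      · refine Eventually.of_forall fun z => ?_
        simp only [Function.comp_apply, kap_coe, add_zero, Prod.mk.injEq, true_and]
        ring
    · obtain ⟨i, rfl⟩ := Nat.exists_eq_add_of_le (not_lt.1 hlt)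
      refine h.hasModel_of_kap hc OnePoint.infty (Model.corner g a (a + b) i j hg ha (by omega)
        hgB'.2 (by simpa using hab) ?_) ?_
      · rw [← hN]; ring
      · refine Eventually.of_forall fun z => ?_
        simp only [Function.comp_apply, kap_infty, Prod.mk.injEq, and_true]
        ring

lemma HasModel.up_source [T1Space W.carrier] {n B : ℕ} {c : W.carrier}
    {b : Blowup W.carrier c} (hb : b.down ≠ c) (h : HasModel ρ n B X W b.down) :
    HasModel ρ n B X (W.blowup c) b := by
  obtain ⟨γ, δ, Φ, e, h0, h, hm⟩ := h
  refine ⟨_, δ, Φ, e, ?_, h.up_source (by rwa [h0]), hm⟩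
  rw [Function.comp_apply, h0, Blowup.up_down hb]

lemma Pending.up_source [T1Space W.carrier] {n B w : ℕ} {c : W.carrier} {p : X.carrier}
    {b : Blowup W.carrier c} (hb : b.down ≠ c) (h : Pending ρ n B X p W w b.down) :
    Pending ρ n B X p (W.blowup c) w b := by
  obtain ⟨hw, a, i, γ, δ, h1, h2, h3, h4, h5, h⟩ := h
  refine ⟨hw, a, i, _, δ, h1, h2, h3, ?_, h5, h.up_source (by rwa [h4])⟩
  rw [Function.comp_apply, h4, Blowup.up_down hb]

/-- The directions of the charts of the blowing-up determine the points. -/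
lemma eq_of_down_eq {M : Type} [TopologicalSpace M] [ChartedSpace (ℂ × ℂ) M]
    [IsManifold 𝓘(ℂ, ℂ × ℂ) ω M] [T2Space M] {p : M} {γ : ℂ × ℂ → M} (h : IsParam γ)
    (h0 : γ 0 = p) {d : OnePoint ℂ} {γ₁ γ₂ : ℂ × ℂ → Blowup M p} (h1 : IsParam γ₁)
    (h2 : IsParam γ₂) (e1 : Blowup.down ∘ γ₁ =ᶠ[𝓝 0] γ ∘ kap d)
    (e2 : Blowup.down ∘ γ₂ =ᶠ[𝓝 0] γ ∘ kap d) : γ₁ 0 = γ₂ 0 := by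
  refine tendsto_nhds_unique_of_frequently_eq h1.hol.continuousAt h2.hol.continuousAt ?_
  refine ((Blowup.frequently_kap_ne_zero d).and_eventually
    ((e1.and e2).and ((tendsto_kap d).eventually h.eventually_eq_iff))).mono ?_
  rintro z ⟨k1, ⟨k2, k3⟩, k4⟩
  simp only [Function.comp_apply] at k2 k3
  rw [Ne, ← k4, h0] at k1
  rw [← Blowup.up_down (b := γ₁ z) (by rwa [k2]), ← Blowup.up_down (b := γ₂ z) (by rwa [k3]), k2, k3]

/-- Blowing up a pending point of the source: all the new points have a local model for the
blowing-up of the target, except possibly one, which needs one blowing-up less. -/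
lemma Pending.blowup_source [T2Space W.carrier] {n B w : ℕ} {p : X.carrier} {c : W.carrier}
    (h : Pending ρ n B X p W w c) : ∃ b₀ : Blowup W.carrier c, ∀ b : Blowup W.carrier c,
      b.down = c → HasModel ρ n (2 * B) (X.blowup p) (W.blowup c) b ∨
        (b = b₀ ∧ Pending ρ n B X p (W.blowup c) (w - 1) b) := by
  obtain ⟨hw, a, i, γ, δ, ha, haB, hN, h4, h5, h⟩ := h
  obtain ⟨γ₀, g1, g2⟩ := h.source.exists_lift_kap h4 (0 : ℂ)
  refine ⟨γ₀ 0, fun b hb => ?_⟩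
  obtain ⟨d, γ', e1, e2, e3⟩ := h.source.exists_dir h4 b hb
  have h' := h.kap_source e1 e3
  obtain ⟨w, rfl⟩ := Nat.exists_eq_add_of_le' hw
  subst e2
  induction d using OnePoint.rec with
  | infty =>
    left
    -- Here the new line of W meets the strict transform of x = 0. The image is a crossing of two
    -- branches of multiplicity a, that is, a corner with g = a and coprime part (1, 1); the swap
    -- gives it the orientation required by the model.
    have h'' := h'.comp_source isParam_swap rfl
    suffices HasModel ρ n (2 * B) (X.blowup p) (W.blowup c) ((γ' ∘ Prod.swap) 0) from this
    refine h''.hasModel_of_kap h5 OnePoint.infty (Φ' := fun z => (z.1 ^ w * z.2 ^ (w + 1),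
      z.1 ^ (i + 1) * z.2 ^ i)) ?_ ?_
    · have := Model.corner (n := n) (B := 2 * B) a 1 1 w i ha le_rfl le_rfl (by omega)
        (by simp) (by rw [← hN]; ring)
      convert this using 2 with z
      simp [mul_comm]
    · refine Eventually.of_forall fun z => ?_
      simp only [Function.comp_apply, kap_infty, Prod.fst_swap, Prod.snd_swap, Prod.mk.injEq]
      constructor <;> ring
  | coe s =>
    -- The weight is now w + 1. For w = 0 the slope of the image is z.2 + s, so the new line of W is
    -- not contracted and every finite direction lifts.
    rcases Nat.eq_zero_or_pos w with rfl | hw0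
    · left
      refine h'.hasModel_of_kap h5 (s : OnePoint ℂ) (Φ' := fun z => (z.1 ^ (i + 1), z.2)) ?_ ?_
      · exact Model.regular a (i + 1) ha (by omega) (by omega) (by simpa using hN)
      · refine Eventually.of_forall fun z => ?_
        simp only [Function.comp_apply, kap_coe, Prod.mk.injEq]
        exact ⟨by simp, by ring⟩
    · by_cases hs : s = 0
      · right
        subst hs
        refine ⟨eq_of_down_eq h.source h4 e1 g1 e3 g2, by omega, a, i + 1, γ', δ, ha, haB,
          by rw [← hN]; congr 1; omega, rfl, h5, ?_⟩
        refine h'.congr (Eventually.of_forall fun z => ?_)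
        simp only [Function.comp_apply, kap_coe, Prod.mk.injEq]
        constructor
        · congr 1; omega
        · ring
      · left
        -- For s ≠ 0 the inverse slope is z.1 ^ w / (z.2 + s), so the new line of W is contracted to
        -- the direction ∞, a crossing of two branches of multiplicity a.
        refine h'.hasModel_of_kap h5 OnePoint.infty (Model.contracted (n := n) (B := 2 * B) a a w
          (i + 1) (-1) 1 s hs ha (by omega) hw0 (by omega) (by rw [← hN]; ring) ?_) ?_
        · push_cast; omega
        · have hY : ∀ᶠ z in 𝓝 (0 : ℂ × ℂ), z.2 + s ≠ 0 :=
            (analyticAt_snd.add analyticAt_const).continuousAt.eventually_ne (by simpa using hs)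
          filter_upwards [hY] with z hz
          simp only [Function.comp_apply, kap_infty, kap_coe, Prod.mk.injEq, zpow_neg, zpow_one]
          constructor
          · field_simp
            ring
          · ring

end PointBlowup

/-! ### Construction of the minimal elimination -/

namespace PointBlowup

open Filter

variable {ρ : ℂ × ℂ → ℂ × ℂ} {X W : Surface}

lemma IsModification.lift_eventuallyEq (hX : IsModification X) (hW : IsModification W)
    (hρ : ∀ z, ρ z = 0 ↔ z = 0) {q : W.carrier} {f g : W.carrier → X.carrier}
    (hf : Hol f q) (hg : Hol g q)
    (hf' : ∀ᶠ q' in 𝓝 q, X.proj (f q') = ρ (W.proj q'))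
    (hg' : ∀ᶠ q' in 𝓝 q, X.proj (g q') = ρ (W.proj q')) : f =ᶠ[𝓝 q] g := by
  filter_upwards [hf.eventually, hg.eventually, hf'.eventually_nhds, hg'.eventually_nhds]
    with q' h1 h2 h3 h4
  exact hX.lift_unique hW hρ h1.continuousAt h2.continuousAt h3 h4

/-- The map `(x ^ (i + w), x ^ i * y)` does not lift to the blowing-up of the origin if `w ≥ 1`. -/
lemma not_eventuallyEq_kap_comp (d : OnePoint ℂ) (i : ℕ) {w : ℕ} (hw : 1 ≤ w)
    {χ : ℂ × ℂ → ℂ × ℂ} (hχ : ContinuousAt χ 0)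
    (h : (fun z : ℂ × ℂ => (z.1 ^ (i + w), z.1 ^ i * z.2)) =ᶠ[𝓝 0] kap d ∘ χ) : False := by
  obtain ⟨w, rfl⟩ := Nat.exists_eq_add_of_le' hw
  induction d using OnePoint.rec with
  | infty =>
    -- On this curve the second coordinate of the map vanishes and the first does not, so the latter
    -- is not a multiple of the former.
    have h2 : Tendsto (fun t : ℂ => (t, (0 : ℂ))) (𝓝[≠] 0) (𝓝 (0 : ℂ × ℂ)) :=
      ((continuous_id.prodMk continuous_const).tendsto (0 : ℂ)).mono_left nhdsWithin_le_nhds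
    obtain ⟨t, ht, ht'⟩ := ((h2.eventually h).and self_mem_nhdsWithin).exists
    have h3 := congrArg Prod.fst ht
    have h4 := congrArg Prod.snd ht
    simp only [kap_infty, Function.comp_apply, mul_zero] at h3 h4
    rw [← h4, mul_zero] at h3
    exact pow_ne_zero _ ht' h3
  | coe s =>
    -- On this curve the slope of the map is t ^ (-(2 * w + 1)), with w + 1 the original weight, so
    -- it is unbounded even for weight one.
    have h2 : Tendsto (fun t : ℂ => (t ^ 2, t)) (𝓝[≠] 0) (𝓝 (0 : ℂ × ℂ)) := by
      have : Tendsto (fun t : ℂ => (t ^ 2, t)) (𝓝 0) (𝓝 (0 ^ 2, 0)) :=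
        ((continuous_pow 2).prodMk continuous_id).tendsto (0 : ℂ)
      rw [zero_pow two_ne_zero] at this
      exact this.mono_left nhdsWithin_le_nhds
    have h3 : ∀ᶠ t in 𝓝[≠] (0 : ℂ), t ^ (2 * w + 1) * ((χ (t ^ 2, t)).2 + s) = 1 := by
      filter_upwards [h2.eventually h, self_mem_nhdsWithin] with t ht ht'
      have ht' : t ≠ 0 := ht'
      have h3 := congrArg Prod.fst ht
      have h4 := congrArg Prod.snd ht
      simp only [kap_coe, Function.comp_apply] at h3 h4
      rw [← h3] at h4
      have h5 : t ^ (2 * i + 1) ≠ 0 := pow_ne_zero _ ht'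
      refine mul_left_cancel₀ h5 ?_
      linear_combination -h4
    have h4 : Tendsto (fun t : ℂ => t ^ (2 * w + 1) * ((χ (t ^ 2, t)).2 + s)) (𝓝[≠] 0)
        (𝓝 (0 * ((χ 0).2 + s))) := by
      refine Tendsto.mul ?_ (((continuous_snd.tendsto _).comp (Tendsto.comp hχ h2)).add
        tendsto_const_nhds)
      have : Tendsto (fun t : ℂ => t ^ (2 * w + 1)) (𝓝 0) (𝓝 (0 ^ (2 * w + 1))) :=
        (continuous_pow _).tendsto (0 : ℂ)
      rw [zero_pow (by omega)] at this
      exact this.mono_left nhdsWithin_le_nhds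
    have h5 := tendsto_nhds_unique_of_eventuallyEq h4 tendsto_const_nhds h3
    simp at h5

/-- A lift to the blowing-up, followed by the blowing-down, must be the known germ by uniqueness;
that germ would then factor through a blowing-up chart. -/
lemma Pending.not_liftsAt (hX : IsModification X) (hW : IsModification W)
    (hρ : ∀ z, ρ z = 0 ↔ z = 0) {n B w : ℕ} {c : X.carrier} {q : W.carrier}
    (h : Pending ρ n B X c W w q) : ¬ LiftsAt ρ (X.blowup c) W q := by
  rintro ⟨f, hf, hf'⟩
  obtain ⟨hw, a, i, γ, δ, ha, haB, hN, rfl, h5, h⟩ := h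
  obtain ⟨g, g1, g2, g3⟩ := h.exists_lift
  have hf2 : Hol (fun q => Blowup.down (f q : Blowup X.carrier c)) (γ 0) :=
    ContMDiffAt.comp (M' := Blowup X.carrier c) (γ 0) (Blowup.hol_down _) hf
  have he := h.source.eventually_iff.1 (hX.lift_eventuallyEq hW hρ hf2 g1 hf' g2)
  have h0 : Blowup.down (f (γ 0) : Blowup X.carrier c) = c := by
    rw [he.self_of_nhds, g3.self_of_nhds, h.map_zero, h5]
  obtain ⟨d, δ', d1, d2, d3⟩ := h.target.exists_dir h5 (f (γ 0)) h0
  obtain ⟨χ, x1, x2, x3⟩ := d1.exists_factor (h.source.hol_iff.1 hf) d2.symm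
  have hχ : Tendsto χ (𝓝 0) (𝓝 0) := by
    have := x1.continuousAt
    rwa [ContinuousAt, x2] at this
  obtain ⟨κ, k1, k2, k3, k4⟩ := h.target
  refine not_eventuallyEq_kap_comp d i hw x1.continuousAt ?_
  filter_upwards [he, g3, x3, hχ.eventually d3, h.tendsto.eventually k3,
    ((tendsto_kap d).comp hχ).eventually k3] with z e1 e2 e3 e4 e5 e6
  exact e5.symm.trans ((congrArg κ (e2.symm.trans (e1.symm.trans
    ((congrArg Blowup.down e3).trans e4)))).trans e6)

lemma HasModel.liftsAt {n B : ℕ} {q : W.carrier} (h : HasModel ρ n B X W q) :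
    LiftsAt ρ X W q := by
  obtain ⟨γ, δ, Φ, e, rfl, h, hm⟩ := h
  exact h.liftsAt

/-- Near a point with a local model, only that point can be an obstruction to lifting the map to
a blowing-up of the target. -/
lemma HasModel.eventually_liftsAt (hX : IsModification X)
    {n B : ℕ} {q : W.carrier} (h : HasModel ρ n B X W q) (hn : ∀ d, 0 < d → d ≤ B → d ∣ n)
    (c : X.carrier) : ∀ᶠ q' in 𝓝 q, q' = q ∨ LiftsAt ρ (X.blowup c) W q' := by
  have := hX.t2
  rcases h.blowup_target hn c with h1 | ⟨a, m, γ, δ, ha, haB, hm, hN, rfl, hc, h⟩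
  · exact h1.liftsAt.eventually.mono fun _ h => Or.inr h
  obtain ⟨f, f1, f2, f3⟩ := h.exists_lift
  rw [h.source.eventually_iff]
  have h2 := h.source.eventually_iff.1 f1.eventually
  have h3 := h.source.eventually_iff.1 f2.eventually_nhds
  filter_upwards [h2, h3, f3, h.tendsto.eventually h.target.eventually_eq_iff] with z k1 k2 k3 k4
  by_cases hz : z = 0
  · exact Or.inl (by rw [hz])
  · refine Or.inr (liftsAt_blowup_of_ne k1 k2 ?_)
    rw [k3, ← hc, Ne, k4]
    intro h5
    rw [Prod.mk_eq_zero] at h5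
    exact hz (Prod.ext (pow_eq_zero_iff (by omega) |>.1 h5.1) h5.2)

lemma HasModel.pending_or (hX : IsModification X) {n B : ℕ} {q : W.carrier}
    (h : HasModel ρ n B X W q) (hn : ∀ d, 0 < d → d ≤ B → d ∣ n) (c : X.carrier) :
    HasModel ρ n (2 * B) (X.blowup c) W q ∨ ∃ w, Pending ρ n B X c W w q := by
  have := hX.t2
  refine (h.blowup_target hn c).imp_right ?_
  rintro ⟨a, m, γ, δ, ha, haB, hm, hN, rfl, hc, h⟩
  -- The regular model (x ^ m, y) is pending with i = 0 and weight m.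
  exact ⟨m, hm, a, 0, γ, δ, ha, haB, by simpa using hN, rfl, hc, by simpa using h⟩

/-- Finitely many points of the fibre obstruct the lifting to a blowing-up of the target. -/
lemma finite_not_liftsAt (hX : IsModification X) (hW : IsModification W) {n B : ℕ}
    (h : ∀ q, W.proj q = 0 → HasModel ρ n B X W q) (hn : ∀ d, 0 < d → d ≤ B → d ∣ n)
    (c : X.carrier) : {q | W.proj q = 0 ∧ ¬ LiftsAt ρ (X.blowup c) W q}.Finite := by
  have hK : IsCompact (W.proj ⁻¹' {0}) := hW.proper.isCompact_preimage isCompact_singleton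
  obtain ⟨t, ht0, ht⟩ := hK.elim_nhds_subcover
    (fun q => {q' | W.proj q = 0 → q' = q ∨ LiftsAt ρ (X.blowup c) W q'}) fun q hq => by
      filter_upwards [(h q hq).eventually_liftsAt hX hn c] with q' hq' _
      exact hq'
  refine t.finite_toSet.subset ?_
  rintro q ⟨hq, hl⟩
  obtain ⟨q', hq', h1⟩ := Set.mem_iUnion₂.1 (ht hq)
  rcases h1 (ht0 q' hq') with rfl | h1
  · exact hq'
  · exact absurd h1 hl

/-- There is a sequence of blowing-ups `W` for which the map `π⁻¹ ∘ ρ` has a local model at every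
point of the fibre, and which is dominated by all the sequences which eliminate the
indeterminacies. -/
def HasReducedElimination (ρ : ℂ × ℂ → ℂ × ℂ) (n B : ℕ) (X : Surface) : Prop :=
  ∃ W : Surface, Nonempty (BlowupSeq W) ∧ (∀ q, W.proj q = 0 → HasModel ρ n B X W q) ∧
    ∀ Z : Surface, BlowupSeq Z → Extends ρ X Z → Extends id W Z

/-- Induction on a bound `N` for the total weight of the pending points: blowing up one of them
leaves at most one pending point above it, of weight one less, and carries the others along.
Domination by every elimination persists because a pending point is an indeterminacy. -/
lemma hasReducedElimination_of_pending (hX : IsModification X) (hρ : ∀ z, ρ z = 0 ↔ z = 0)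
    {n B : ℕ} {c : X.carrier} (N : ℕ) {W : Surface} (sW : BlowupSeq W)
    (T : Finset W.carrier) (wt : W.carrier → ℕ) (hN : ∑ q ∈ T, wt q ≤ N)
    (hT : ∀ q ∈ T, W.proj q = 0 ∧ Pending ρ n B X c W (wt q) q)
    (hT' : ∀ q ∉ T, W.proj q = 0 → HasModel ρ n (2 * B) (X.blowup c) W q)
    (hZ : ∀ Z : Surface, BlowupSeq Z → Extends ρ (X.blowup c) Z → Extends id W Z) :
    HasReducedElimination ρ n (2 * B) (X.blowup c) := by
  classical
  induction N generalizing W with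
  | zero =>
    refine ⟨W, ⟨sW⟩, fun q hq => hT' q (fun hqT => ?_) hq, hZ⟩
    have h1 : wt q = 0 := by
      have := Finset.single_le_sum (fun i _ => Nat.zero_le (wt i)) hqT
      omega
    have h2 := (hT q hqT).2.1
    omega
  | succ N ih =>
    rcases T.eq_empty_or_nonempty with rfl | ⟨q₀, hq₀⟩
    · exact ⟨W, ⟨sW⟩, fun q hq => hT' q (by simp) hq, hZ⟩
    obtain ⟨h0, hp⟩ := hT q₀ hq₀
    have hW := sW.isModification
    have := hW.t2
    obtain ⟨b₀, hb₀⟩ := hp.blowup_source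
    -- `E` contains the pending point above `q₀`, if there is one.
    let E : Finset (Blowup W.carrier q₀) := if b₀.down = q₀ ∧
      Pending ρ n B X c (W.blowup q₀) (wt q₀ - 1) b₀ then {b₀} else ∅
    have hE : ∀ b, b ∈ E ↔ b = b₀ ∧ b.down = q₀ ∧
        Pending ρ n B X c (W.blowup q₀) (wt q₀ - 1) b := by
      intro b
      by_cases hb : b₀.down = q₀ ∧ Pending ρ n B X c (W.blowup q₀) (wt q₀ - 1) b₀
      · simp only [E, if_pos hb, Finset.mem_singleton]
        exact ⟨fun h => ⟨h, h ▸ hb⟩, fun h => h.1⟩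
      · simp only [E, if_neg hb, Finset.notMem_empty, false_iff]
        rintro ⟨rfl, h⟩
        exact hb h
    let wt' : Blowup W.carrier q₀ → ℕ := fun b =>
      if b.down = q₀ then wt q₀ - 1 else wt b.down
    have hne : ∀ q ∈ T.erase q₀, (Blowup.up q₀ q).down ≠ q₀ := fun q hq => by
      rw [Blowup.down_up]
      exact Finset.ne_of_mem_erase hq
    refine ih (W := W.blowup q₀) (.cons sW q₀ h0) ((T.erase q₀).image (Blowup.up q₀) ∪ E) wt'
      ?_ ?_ ?_ ?_
    · have h1 : ∑ b ∈ (T.erase q₀).image (Blowup.up q₀), wt' b = ∑ q ∈ T.erase q₀, wt q := by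
        rw [Finset.sum_image]
        · refine Finset.sum_congr rfl fun q hq => ?_
          simp only [wt', if_neg (hne q hq), Blowup.down_up]
        · intro q _ q' _ h
          have := congrArg Blowup.down h
          rwa [Blowup.down_up, Blowup.down_up] at this
      have h2 : ∑ b ∈ E, wt' b ≤ wt q₀ - 1 := by
        by_cases hb : b₀.down = q₀ ∧ Pending ρ n B X c (W.blowup q₀) (wt q₀ - 1) b₀
        · simp [E, if_pos hb, wt', hb.1]
        · simp [E, if_neg hb]
      -- Disjointness is not needed: the sum over the intersection is nonnegative, so only an
      -- inequality is lost.
      have h3 := Finset.sum_union_inter (s₁ := (T.erase q₀).image (Blowup.up q₀)) (s₂ := E)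
        (f := wt')
      have h4 := Finset.add_sum_erase T wt hq₀
      have h5 := hp.1
      have h6 : ∑ b ∈ (T.erase q₀).image (Blowup.up q₀) ∪ E, wt' b ≤ N := by omega
      exact h6
    · intro b hb
      rcases Finset.mem_union.1 hb with hb | hb
      · obtain ⟨q, hq, rfl⟩ := Finset.mem_image.1 hb
        obtain ⟨k1, k2⟩ := hT q (Finset.mem_of_mem_erase hq)
        refine ⟨(congrArg W.proj (Blowup.down_up q)).trans k1, ?_⟩
        have h1 : wt' (Blowup.up q₀ q) = wt q := by
          simp only [wt', if_neg (hne q hq), Blowup.down_up]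
        rw [h1]
        exact Pending.up_source (hne q hq) (by rwa [Blowup.down_up])
      · obtain ⟨rfl, k1, k2⟩ := (hE b).1 hb
        refine ⟨(congrArg W.proj k1).trans h0, ?_⟩
        simpa only [wt', if_pos k1] using k2
    · intro (b : Blowup W.carrier q₀) hb hb0
      have hb := not_or.1 (fun h => hb (Finset.mem_union.2 h))
      by_cases hd : Blowup.down b = q₀
      · rcases hb₀ b hd with k1 | ⟨k1, k2⟩
        · exact k1
        · exact absurd ((hE b).2 ⟨k1, hd, k2⟩) hb.2
      · refine HasModel.up_source hd (hT' _ (fun h1 => hb.1 ?_) hb0)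
        refine Finset.mem_image.2 ⟨_, Finset.mem_erase.2 ⟨hd, h1⟩, Blowup.up_down hd⟩
    · intro Z sZ hXZ
      exact extends_blowup_of_not_liftsAt sW sZ hXZ (hZ Z sZ hXZ) h0 (hp.not_liftsAt hX hW hρ)

lemma HasReducedElimination.blowup (hX : IsModification X) (hρ : ∀ z, ρ z = 0 ↔ z = 0) {n B : ℕ}
    (h : HasReducedElimination ρ n B X) (hn : ∀ d, 0 < d → d ≤ B → d ∣ n) (c : X.carrier) :
    HasReducedElimination ρ n (2 * B) (X.blowup c) := by
  classical
  obtain ⟨W, ⟨sW⟩, h1, h2⟩ := h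
  have hW := sW.isModification
  have hfin := finite_not_liftsAt hX hW h1 hn c
  have hw : ∀ q : W.carrier, ∃ w, W.proj q = 0 → ¬ LiftsAt ρ (X.blowup c) W q →
      Pending ρ n B X c W w q := by
    intro q
    by_cases hq : W.proj q = 0
    · rcases (h1 q hq).pending_or hX hn c with h | ⟨w, h⟩
      · exact ⟨0, fun _ h' => absurd h.liftsAt h'⟩
      · exact ⟨w, fun _ _ => h⟩
    · exact ⟨0, fun h => absurd h hq⟩
  choose wt hwt using hw
  refine hasReducedElimination_of_pending hX hρ _ sW hfin.toFinset wt le_rfl ?_ ?_ ?_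
  · intro q hq
    obtain ⟨k1, k2⟩ := hfin.mem_toFinset.1 hq
    exact ⟨k1, hwt q k1 k2⟩
  · intro q hq hq0
    have h3 : LiftsAt ρ (X.blowup c) W q := by
      by_contra h3
      exact hq (hfin.mem_toFinset.2 ⟨hq0, h3⟩)
    rcases (h1 q hq0).pending_or hX hn c with h | ⟨w, h⟩
    · exact h
    · exact absurd h3 (h.not_liftsAt hX hW hρ)
  · intro Z sZ hZ
    exact h2 Z sZ (hZ.of_blowup hX sZ.isModification hρ)

/-- The ramification of order `n` along the first coordinate. -/
def ramification (n : ℕ) (z : ℂ × ℂ) : ℂ × ℂ := (z.1 ^ n, z.2)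

lemma ramification_eq_zero {n : ℕ} (hn : 0 < n) (z : ℂ × ℂ) : ramification n z = 0 ↔ z = 0 := by
  simp [ramification, Prod.ext_iff, hn.ne']

lemma isRamification_ramification {n : ℕ} (hn : 0 < n) : IsRamification (ramification n) := by
  have h : IsLocalBiholomorphism (id : ℂ × ℂ → ℂ × ℂ) :=
    ⟨rfl, analyticAt_id, ContinuousLinearEquiv.refl ℂ _, hasFDerivAt_id _⟩
  exact ⟨n, hn, id, id, h, h, Eventually.of_forall fun z => rfl⟩

lemma hasReducedElimination_plane {n : ℕ} (hn : 0 < n) :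
    HasReducedElimination (ramification n) n 1 Surface.plane := by
  refine ⟨Surface.plane, ⟨.nil⟩, fun q hq => ?_, fun Z sZ _ => ?_⟩
  · have hm : Model n 1 (fun z : ℂ × ℂ => (z.1 ^ n, z.2)) (fun z => z.1) :=
      Model.regular 1 n le_rfl le_rfl hn (one_mul n)
    refine ⟨(id : ℂ × ℂ → ℂ × ℂ), (id : ℂ × ℂ → ℂ × ℂ), _, _, hq.symm, ?_, hm⟩
    exact ⟨isParam_id, isParam_id, hm.analyticAt, hm.map_zero, Eventually.of_forall fun z => rfl,
      Eventually.of_forall fun z => rfl⟩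
  · exact ⟨Z.proj, Eventually.of_forall fun z q hq => ⟨sZ.isModification.hol q, hq⟩⟩

/-- The bound starts at 1 on the plane and doubles at each blowing-up, so it does not depend on `n`,
which is chosen afterwards. -/
lemma BlowupSeq.exists_hasReducedElimination {X : Surface} (s : BlowupSeq X) :
    ∃ B : ℕ, ∀ n, 0 < n → (∀ d, 0 < d → d ≤ B → d ∣ n) →
      HasReducedElimination (ramification n) n B X := by
  induction s with
  | nil => exact ⟨1, fun n hn _ => hasReducedElimination_plane hn⟩
  | @cons X s c hc ih =>
    obtain ⟨B, hB⟩ := ih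
    refine ⟨2 * B, fun n hn hd => ?_⟩
    have hd' : ∀ d, 0 < d → d ≤ B → d ∣ n := fun d h1 h2 => hd d h1 (by omega)
    exact (hB n hn hd').blowup s.isModification (ramification_eq_zero hn) hd' c

end PointBlowup

/-! ### Order of vanishing of u and regularity of the centers -/

namespace PointBlowup

open Filter Asymptotics

/-- The first coordinate `u` of `ℂ²`, seen on `W`, vanishes at `q` to order at least three. -/
def VanishesToOrderThree (W : Surface) (q : W.carrier) : Prop :=
  ∃ γ : ℂ × ℂ → W.carrier, IsParam γ ∧ γ 0 = q ∧
    (fun z => (W.proj (γ z)).1) =O[𝓝 0] fun z => ‖z‖ ^ 3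

/-- Vanishing to order three is preserved by pull-back. -/
lemma VanishesToOrderThree.pullback {Y W : Surface} {g : W.carrier → Y.carrier} {q : W.carrier}
    (hg : Hol g q) (hp : ∀ᶠ q' in 𝓝 q, Y.proj (g q') = W.proj q')
    (h : VanishesToOrderThree Y (g q)) {ζ : ℂ × ℂ → W.carrier} (hζ : IsParam ζ) (hζ0 : ζ 0 = q) :
    (fun z => (W.proj (ζ z)).1) =O[𝓝 0] fun z => ‖z‖ ^ 3 := by
  subst hζ0
  obtain ⟨γ, h1, h2, h3⟩ := h
  obtain ⟨ψ, p1, p2, p3⟩ := h1.exists_factor (hζ.hol_iff.1 hg) h2.symm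
  have hψt : Tendsto ψ (𝓝 0) (𝓝 0) := by
    have := p1.continuousAt
    rwa [ContinuousAt, p2] at this
  have h4 : ψ =O[𝓝 0] fun z => ‖z‖ := by
    have := p1.differentiableAt.hasFDerivAt.isBigO_sub
    simpa [p2] using this.norm_right
  have h5 : (fun z => (W.proj (ζ z)).1) =ᶠ[𝓝 0] fun z => (Y.proj (γ (ψ z))).1 := by
    filter_upwards [p3, hζ.eventually_iff.1 hp] with z k1 k2
    simp only [Function.comp_apply] at k1
    rw [← k2, k1]
  exact h5.trans_isBigO ((h3.comp_tendsto hψt).trans (h4.norm_left.pow 3))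

lemma VanishesToOrderThree.of_map {Y W : Surface} {g : W.carrier → Y.carrier} {q : W.carrier}
    (hg : Hol g q) (hp : ∀ᶠ q' in 𝓝 q, Y.proj (g q') = W.proj q')
    (h : VanishesToOrderThree Y (g q)) : VanishesToOrderThree W q :=
  ⟨Blowup.point q, isParam_point q, Blowup.point_zero q,
    h.pullback hg hp (isParam_point q) (Blowup.point_zero q)⟩

lemma not_isBigO_pow_three {m : ℕ} (hm : m ≤ 2) {e : ℂ × ℂ → ℂ} (he : ∀ t : ℂ, e (t, t) = t ^ m) :
    ¬ e =O[𝓝 0] fun z => ‖z‖ ^ 3 := by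
  intro h
  have h2 : Tendsto (fun t : ℂ => (t, t)) (𝓝 0) (𝓝 (0 : ℂ × ℂ)) :=
    (continuous_id.prodMk continuous_id).tendsto (0 : ℂ)
  have h3 := h.comp_tendsto h2
  have h4 : (fun t : ℂ => t ^ m) =O[𝓝 0] fun t : ℂ => t ^ 3 := by
    refine IsBigO.trans (IsBigO.of_bound 1 (Eventually.of_forall fun t => ?_))
      (h3.trans (IsBigO.of_bound 1 (Eventually.of_forall fun t => ?_)))
    · simp [he]
    · simp
  have h5 : (fun t : ℂ => t ^ 3) =o[𝓝 0] fun t : ℂ => t ^ m :=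
    isLittleO_pow_pow (by omega)
  have h6 : ∃ᶠ t in 𝓝 (0 : ℂ), t ∈ ({0} : Set ℂ)ᶜ :=
    (eventually_mem_nhdsWithin (s := {0}ᶜ)).frequently.filter_mono nhdsWithin_le_nhds
  exact isLittleO_irrefl' (h6.mono fun t ht => norm_ne_zero_iff.2 (pow_ne_zero m ht))
    (h4.trans_isLittleO h5)

lemma HasModel.not_vanishesToOrderThree {ρ : ℂ × ℂ → ℂ × ℂ} {n B : ℕ} {X W : Surface}
    {q : W.carrier} (h : HasModel ρ n B X W q) : ¬ VanishesToOrderThree W q := by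
  intro h'
  obtain ⟨γ, δ, Φ, e, h0, h, hm⟩ := h
  have h1 := h'.pullback (g := id) contMDiffAt_id (Eventually.of_forall fun _ => rfl) h.source h0
  have h2 : e =O[𝓝 0] fun z => ‖z‖ ^ 3 := (EventuallyEq.symm h.fst_eq).trans_isBigO h1
  cases hm with
  | regular => exact not_isBigO_pow_three (m := 1) (by omega) (fun t => (pow_one t).symm) h2
  | contracted => exact not_isBigO_pow_three (m := 1) (by omega) (fun t => (pow_one t).symm) h2
  | corner => exact not_isBigO_pow_three (m := 2) (by omega) (fun t => (pow_two t).symm) h2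

/-- A critical function vanishes to order three on some chart of the blowing-up. -/
lemma exists_kap_isBigO {F : ℂ × ℂ → ℂ} (hF : AnalyticAt ℂ F 0) (h0 : F 0 = 0)
    (h1 : fderiv ℂ F 0 = 0) : ∃ d, (F ∘ kap d) =O[𝓝 0] fun z => ‖z‖ ^ 3 := by
  obtain ⟨L, hL, hFL⟩ := AnalyticAt.exists_clm_apply hF h0
  have hL0 : L 0 = 0 := by
    have h1' := hL.differentiableAt.hasFDerivAt.clm_apply (hasFDerivAt_id (𝕜 := ℂ) (0 : ℂ × ℂ))
    have h2 := h1'.congr_of_eventuallyEq hFL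
    rw [h2.fderiv] at h1
    ext
    · simpa using congrArg (fun A : ℂ × ℂ →L[ℂ] ℂ => A (1, 0)) h1
    · simpa using congrArg (fun A : ℂ × ℂ →L[ℂ] ℂ => A (0, 1)) h1
  obtain ⟨M, hM, hLM⟩ := AnalyticAt.exists_clm_apply hL hL0
  -- The direction is a zero of the quadratic part of F: ∞ if the coefficient of the squared slope
  -- vanishes, otherwise a root of a quadratic equation over ℂ.
  obtain ⟨d, hd⟩ : ∃ d, M 0 (kapVec d 0) (kapVec d 0) = 0 := by
    by_cases hC : M 0 (0, 1) (0, 1) = 0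
    · exact ⟨OnePoint.infty, hC⟩
    · obtain ⟨s, hs⟩ := IsAlgClosed.exists_eq_mul_self (discrim (M 0 (0, 1) (0, 1))
        (M 0 (1, 0) (0, 1) + M 0 (0, 1) (1, 0)) (M 0 (1, 0) (1, 0)))
      obtain ⟨x, hx⟩ := exists_quadratic_eq_zero hC ⟨s, hs⟩
      refine ⟨(x : ℂ), ?_⟩
      have hv : kapVec (x : OnePoint ℂ) 0 = (1, 0) + x • ((0, 1) : ℂ × ℂ) := by
        simp [kapVec]
      rw [hv]
      simp only [map_add, map_smul, add_apply, smul_apply, smul_eq_mul]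
      linear_combination hx
  refine ⟨d, ?_⟩
  have e1 : (F ∘ kap d) =ᶠ[𝓝 0] fun w => kapExc d w ^ 2 *
      M (kap d w) (kapVec d w) (kapVec d w) := by
    filter_upwards [(tendsto_kap d).eventually hFL, (tendsto_kap d).eventually hLM] with w k1 k2
    rw [Function.comp_apply, k1, k2]
    have hk := kap_eq_smul d w
    generalize M (kap d w) = A
    rw [hk]
    simp only [map_smul, smul_apply, smul_eq_mul]
    ring
  have hMk : AnalyticAt ℂ (fun w => M (kap d w)) 0 :=
    AnalyticAt.fun_comp (by rwa [kap_zero]) (analyticAt_kap d 0)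
  have hV := (analyticAt_kapVec d 0).contDiffAt (n := ω)
  have hG := ((hMk.contDiffAt (n := ω)).clm_apply hV).clm_apply hV
  -- The pull-back of F is the square of the exceptional coordinate times a factor which vanishes at
  -- 0 by the choice of `d`; this gives the third order.
  have hG1 := (hG.differentiableAt (by simp)).hasFDerivAt.isBigO_sub
  have hE1 := (analyticAt_kapExc d 0).differentiableAt.hasFDerivAt.isBigO_sub
  simp only [kap_zero, hd, sub_zero] at hG1
  simp only [kapExc_zero, sub_zero] at hE1
  refine e1.trans_isBigO (((hE1.norm_right.pow 2).mul hG1.norm_right).congr_right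
    fun z => by ring)

/-- Near the points of the fibre, the map to `ℂ²` factors through the blowing-up of the origin, as
soon as at least one point was blown up. -/
lemma BlowupSeq.exists_eq_kap {X : Surface} (s : BlowupSeq X) {c : X.carrier} (hc : X.proj c = 0) :
    ∀ b : Blowup X.carrier c, X.proj b.down = 0 → ∃ χ : Blowup X.carrier c → ℂ × ℂ, Hol χ b ∧
      ∃ d, ∀ᶠ b' in 𝓝 b, X.proj b'.down = kap d (χ b') := by
  induction s with
  | nil =>
    intro b hb
    have hid : IsParam (M := Surface.plane.carrier) (id : ℂ × ℂ → ℂ × ℂ) := isParam_id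
    obtain ⟨d, γ, h1, rfl, h3⟩ := hid.exists_dir (p := c) hc.symm b (hb.trans hc.symm)
    have hγ := h1
    obtain ⟨κ, g1, g2, g3, g4⟩ := h1
    refine ⟨κ, g2, d, hγ.eventually_iff.2 ?_⟩
    filter_upwards [g3, h3] with z k1 k2
    rw [k1]
    exact k2
  | @cons X s c₀ hc₀ ih =>
    intro b hb
    obtain ⟨χ, h1, d, h2⟩ := ih hc₀ b.down hb
    refine ⟨χ ∘ Blowup.down, ContMDiffAt.comp (M' := (X.blowup c₀).carrier) b h1
      (Blowup.hol_down b), d, ?_⟩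
    exact (Blowup.hol_down b).continuousAt.eventually h2

/-- The function u itself serves as local equation: the fibre lies in u = 0, and the factorization
through `kap d` gives the converse near a point where du ≠ 0. -/
lemma isRegularPoint_fibre {X : Surface} (hX : IsModification X) {c : X.carrier}
    (hc : X.proj c = 0) {χ : X.carrier → ℂ × ℂ} (hχ : Hol χ c) {d : OnePoint ℂ}
    (hd : ∀ᶠ q in 𝓝 c, X.proj q = kap d (χ q)) {γ : ℂ × ℂ → X.carrier} (hγ : IsParam γ)
    (h0 : γ 0 = c) (hF : fderiv ℂ (fun z => (X.proj (γ z)).1) 0 ≠ 0) :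
    X.IsRegularPoint X.fibre c := by
  subst h0
  have hu : ContMDiffAt 𝓘(ℂ, ℂ × ℂ) 𝓘(ℂ, ℂ) ω (fun q => (X.proj q).1) (γ 0) :=
    ContMDiffAt.comp (γ 0) (contDiff_fst (𝕜 := ℂ) (E := ℂ) (F := ℂ)).contMDiff.contMDiffAt
      (hX.hol (γ 0))
  refine ⟨hc, fun q => (X.proj q).1, hu, fun hm => hF ?_, ?_⟩
  · have h1 := mfderiv_comp (I := 𝓘(ℂ, ℂ × ℂ)) (0 : ℂ × ℂ) (hu.mdifferentiableAt (by simp))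
      (hγ.hol.mdifferentiableAt (by simp))
    rw [hm, mfderiv_eq_fderiv] at h1
    refine Eq.trans h1 ?_
    ext <;> rfl
  · have h1 : ∀ q, (X.proj q = 0 → (X.proj q).1 = 0) := fun q hq => by rw [hq]; rfl
    induction d using OnePoint.rec with
    | coe s =>
      filter_upwards [hd] with q hq
      refine ⟨h1 q, fun hq0 => ?_⟩
      change X.proj q = 0
      rw [hq] at hq0 ⊢
      simp only [kap_coe] at hq0 ⊢
      rw [hq0, zero_mul]
      rfl
    | infty =>
      have h2 : (χ (γ 0)).2 = 0 := by
        have := hd.self_of_nhds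
        rw [hc] at this
        exact (congrArg Prod.snd this).symm
      -- In the chart ∞, u is a product whose second factor vanishes at the point. If the first
      -- vanished too, so would du. Hence u = 0 is locally the zero set of the second factor, which
      -- is v.
      have h3 : (χ (γ 0)).1 ≠ 0 := by
        intro h3
        apply hF
        have hχγ := (hol_iff_analyticAt.1 (hγ.hol_iff.1 hχ)).differentiableAt.hasFDerivAt
        have h4 := hχγ.fst.mul hχγ.snd
        have h5 : (fun z => (X.proj (γ z)).1) =ᶠ[𝓝 0]
            ((fun z => ((χ ∘ γ) z).1) * fun z => ((χ ∘ γ) z).2) := by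
          filter_upwards [hγ.eventually_iff.1 hd] with z hz
          rw [hz]
          rfl
        rw [(h4.congr_of_eventuallyEq h5).fderiv]
        ext <;> simp [h2, h3]
      have h4 : ∀ᶠ q in 𝓝 (γ 0), (χ q).1 ≠ 0 :=
        hχ.continuousAt.fst.eventually_ne h3
      filter_upwards [hd, h4] with q hq hq'
      refine ⟨h1 q, fun hq0 => ?_⟩
      change X.proj q = 0
      rw [hq] at hq0 ⊢
      simp only [kap_infty, mul_eq_zero, hq', false_or] at hq0 ⊢
      rw [hq0, mul_zero]
      rfl

/-- If the divisor `u = 0` is reduced up to nodes, then all the centers are regular. -/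
lemma BlowupSeq.centersRegular {Y : Surface} (t : BlowupSeq Y)
    (h : ∀ q, Y.proj q = 0 → ¬ VanishesToOrderThree Y q) : t.CentersRegular := by
  induction t with
  | nil => trivial
  | @cons X s c hc ih =>
    -- A point of order three on an earlier surface would give one above it on the later surface, by
    -- pull-back.
    have hX : ∀ q, X.proj q = 0 → ¬ VanishesToOrderThree X q := by
      intro q hq h'
      have h1 : Blowup.down (Blowup.up c q) = q := Blowup.down_up q
      refine h (Blowup.up c q : Blowup X.carrier c) ((congrArg X.proj h1).trans hq) ?_
      exact VanishesToOrderThree.of_map (W := X.blowup c) (g := Blowup.down)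
        (Blowup.hol_down (Blowup.up c q)) (Eventually.of_forall fun _ => rfl) (by rwa [h1])
    refine ⟨ih hX, ?_⟩
    -- A critical point of u chosen as center would create a point of order three on its exceptional
    -- line.
    have hF : fderiv ℂ (fun z => (X.proj (Blowup.point c z)).1) 0 ≠ 0 := by
      intro hF
      have ha : AnalyticAt ℂ (fun z => (X.proj (Blowup.point c z)).1) 0 :=
        analyticAt_fst.comp (hol_iff_analyticAt.1 ((isParam_point c).hol_iff.1
          (s.isModification.hol _)))
      obtain ⟨d, hd⟩ := exists_kap_isBigO ha (by rw [Blowup.point_zero, hc]; rfl) hF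
      obtain ⟨γ', g1, g2⟩ := (isParam_point c).exists_lift_kap (Blowup.point_zero c) d
      have g0 : (γ' 0).down = c := by
        have := g2.self_of_nhds
        simpa [kap_zero, Blowup.point_zero] using this
      refine h (γ' 0) ((congrArg X.proj g0).trans hc) ⟨γ', g1, rfl, ?_⟩
      refine EventuallyEq.trans_isBigO ?_ hd
      filter_upwards [g2] with z hz
      exact congrArg Prod.fst (congrArg X.proj hz)
    cases s with
    | nil => exact Or.inl rfl
    | @cons X s c₀ hc₀ =>
      right
      obtain ⟨χ, h1, d, h2⟩ := s.exists_eq_kap hc₀ c hc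
      exact isRegularPoint_fibre (s.isModification.blowup hc₀) hc h1 h2 (isParam_point c)
        (Blowup.point_zero c) hF

/-- The elimination is unique, up to maps over `ℂ²`, hence it also has the reduced fibre. -/
lemma not_vanishesToOrderThree_of_extends {Y W : Surface} (hY : IsModification Y)
    (hW : IsModification W) (hYW : Extends id Y W) (hWY : Extends id W Y)
    (h : ∀ q, W.proj q = 0 → ¬ VanishesToOrderThree W q) {q : Y.carrier} (hq : Y.proj q = 0) :
    ¬ VanishesToOrderThree Y q := by
  intro h'
  obtain ⟨f, f1, f2⟩ := liftsAt_of_extends hY hWY hq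
  have hfq : W.proj (f q) = 0 := f2.self_of_nhds.trans hq
  obtain ⟨g, g1, g2⟩ := liftsAt_of_extends hW hYW hfq
  -- By uniqueness of lifts `g ∘ f` fixes `q`, so order three at `q` could be pulled back along `g`
  -- to `f q` in W.
  have hgf : g (f q) = q := by
    refine hY.lift_unique hY (ρ := id) (fun z => Iff.rfl) (f := g ∘ f) (g := id)
      (g1.continuousAt.comp f1.continuousAt) continuousAt_id ?_ (Eventually.of_forall fun _ => rfl)
    filter_upwards [f2, f1.continuousAt.eventually g2] with q' k1 k2
    exact k2.trans k1
  exact h (f q) hfq (VanishesToOrderThree.of_map g1 g2 (by rwa [hgf]))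

end PointBlowup

end

theorem mainTheorem1 (X : PointBlowup.Surface) (s : PointBlowup.BlowupSeq X) :
    ∃ ρ : ℂ × ℂ → ℂ × ℂ, PointBlowup.IsRamification ρ ∧
      (∃ Y : PointBlowup.Surface, Nonempty (PointBlowup.BlowupSeq Y) ∧
        PointBlowup.IsElimination ρ X Y) ∧
      ∀ (Y : PointBlowup.Surface) (t : PointBlowup.BlowupSeq Y),
        PointBlowup.IsElimination ρ X Y → t.CentersRegular := by
  obtain ⟨B, hB⟩ := s.exists_hasReducedElimination
  have hn := Nat.factorial_pos B
  -- The order of ramification is B!, which is divisible by every positive integer up to B.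
  obtain ⟨W, ⟨sW⟩, hm, hmin⟩ := hB B.factorial hn fun d h1 h2 => Nat.dvd_factorial h1 h2
  have hρ := PointBlowup.ramification_eq_zero hn
  have hXW : PointBlowup.Extends (PointBlowup.ramification B.factorial) X W :=
    PointBlowup.extends_of_liftsAt s.isModification sW.isModification hρ
      fun q hq => (hm q hq).liftsAt
  refine ⟨_, PointBlowup.isRamification_ramification hn, ⟨W, ⟨sW⟩, hXW, hmin⟩, fun Y t hY => ?_⟩
  refine t.centersRegular fun q hq => ?_
  exact PointBlowup.not_vanishesToOrderThree_of_extends t.isModification sW.isModification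
    (hY.2 W sW hXW) (hmin Y t hY.1) (fun q hq => (hm q hq).not_vanishesToOrderThree) hq
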